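/- Let $n\ge 1$ and $1\le k\le m$ be integers. For $N\ge1$ let $s=(s_1,\dots,s_k)$ be $k$ independent random $\mathrm{SU}(m+1)$-polynomials of degree $N$ (random sections of $\mathcal O(N)\to\mathbb{CP}^m$), written in the affine coordinates $z=(1,z_1,\dots,z_m)$: $$s_j(z)=\sum_{j_0+\dots+j_m=N}\sqrt{\frac{N!}{j_0!\cdots j_m!}}\;c_{j,J}\,z_1^{j_1}\cdots z_m^{j_m},$$ where the $c_{j,J}$ are independent standard complex Gaussian variables (density $\pi^{-1}e^{-|c|^2}$ on $\mathbb C$). Give $\mathbb C^m\subset\mathbb{CP}^m$ the Fubini–Study metric with Kähler form $\frac i2\partial\bar\partial\log(1+|z|^2)$, let $dz$ be its Riemannian volume, and let $|Z_s|$ be the measure given by its Riemannian $(2m-2k)$-volume along the regular points of the zero set $Z_s=\{s_1=\dots=s_k=0\}$ (the zeros at which $ds_1,\dots,ds_k$ are linearly independent). Let $(\mathbb C^m)_n=\{(z^1,\dots,z^n)\in(\mathbb C^m)^n: z^p\ne z^{p'}\text{ for }p\neq p'\}$. The $n$-point zero correlation function $K^N_{nk}$ is the nonnegative continuous function on $(\mathbb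 C^m)_n$ such that $\mathbf E\,|Z_s|^n=K^N_{nk}(z^1,\dots,z^n)\,dz^1\cdots dz^n$ on $(\mathbb C^m)_n$, where $|Z_s|^n$ is the $n$-fold product measure. The scaling limit zero correlation function and its normalization are $$K^\infty_{nkm}(z^1,\dots,z^n)=\lim_{N\to\infty}\frac1{N^{nk}}K^N_{nk}\Big(\frac{z^1}{\sqrt N},\dots,\frac{z^n}{\sqrt N}\Big),\qquad \widetilde K^\infty_{nkm}=(K^\infty_{1km})^{-n}K^\infty_{nkm}.$$ Theorem. $K^N_{nk}$ exists for all sufficiently large $N$, the limit $K^\infty_{nkm}$ exists at every point of $(\mathbb C^m)_n$, $K^\infty_{1km}$ is the constant $\frac{m!}{\pi^k(m-k)!}$, and $$\widetilde K^\infty_{nkm}(z^1,\dots,z^n)=1+O\big(r^4e^{-r^2}\big)\quad\text{as } r\to\infty,\qquad r=\min_{p\ne p'}|z^p-z^{p'}|,$$ where the implied constant depends only on $n,k,m$ (for $n=1$, where $r$ is a minimum over the empty set, the last estimate is void and $\widetilde K^\infty_{1km}\equiv1$). Thus the limit zero correlations are short range. -/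

import Mathlib

open Filter Topology MeasureTheory

noncomputable section

namespace ShortRange

/-- Affine space `ℂ^m` with its standard Hermitian norm; it is the affine chart
`(1, z_1, …, z_m)` of `ℂℙ^m`. -/
abbrev Aff (m : ℕ) : Type := EuclideanSpace ℂ (Fin m)

/-- Exponents `J = (j_0, …, j_m)` with `|J| = N`. -/
abbrev Expo (m N : ℕ) : Type :=
  {J : Fin (m + 1) → ℕ // J ∈ Finset.piAntidiag (Finset.univ : Finset (Fin (m + 1))) N}

/-- The standard complex Gaussian law `π⁻¹ exp(-|c|²) dc` on `ℂ`. -/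
def stdGaussian : Measure ℂ :=
  volume.withDensity fun c => ENNReal.ofReal (Real.exp (-‖c‖ ^ 2) / Real.pi)

/-- The `SU(m+1)`-polynomial `∑_{|J| = N} √(N!/J!) c_J z^J` of degree `N` (a section of
`𝒪(N) → ℂℙ^m`), in the affine coordinates `z = (1, z_1, …, z_m)`. -/
def suPoly {m N : ℕ} (c : Expo m N → ℂ) (z : Aff m) : ℂ :=
  ∑ J : Expo m N, (Real.sqrt (Nat.multinomial Finset.univ J.1) : ℂ) * c J *
    ∏ i : Fin (m + 1), (Fin.cons 1 (fun q => z q) : Fin (m + 1) → ℂ) i ^ J.1 i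

/-- Coefficients of `k`-tuples of `SU(m+1)`-polynomials of degree `N`. -/
abbrev Coeff (k m N : ℕ) : Type := Fin k → Expo m N → ℂ

/-- The law of `k` independent random `SU(m+1)`-polynomials of degree `N`: all coefficients are
independent standard complex Gaussians. -/
def coeffLaw (k m N : ℕ) : Measure (Coeff k m N) :=
  Measure.pi fun _ => Measure.pi fun _ => stdGaussian

/-- The map `s = (s_1, …, s_k) : ℂ^m → ℂ^k`. -/
def tuple {k m N : ℕ} (c : Coeff k m N) (z : Aff m) : Fin k → ℂ := fun j => suPoly (c j) z

/-- Regular points of the simultaneous zero set `Z_s`: the zeros at which `ds_1, …, ds_k` are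
linearly independent, so that near such a point `Z_s` is a complex submanifold of dimension
`m - k` with tangent space `ker ds`. -/
def regZeros {k m N : ℕ} (c : Coeff k m N) : Set (Aff m) :=
  {z | tuple c z = 0 ∧ Function.Surjective (fderiv ℂ (tuple c) z)}

/-- The Fubini–Study Hermitian metric, with Kähler form `(i/2) ∂∂̄ log (1 + |z|²)`, i.e.
`g_{qq'} = ((1 + |z|²) δ_{qq'} - z̄_q z_{q'}) / (1 + |z|²)²`, as a form
`g_z(u, v) = ∑ g_{qq'} u_q v̄_{q'}`. (Mathlib's `inner` is conjugate linear in its first slot.) -/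
def fsMetric {m : ℕ} (z u v : Aff m) : ℂ :=
  ((1 + (‖z‖ : ℂ) ^ 2) * inner ℂ v u - inner ℂ z u * inner ℂ v z) / (1 + (‖z‖ : ℂ) ^ 2) ^ 2

/-- The ratio of the Fubini–Study volume to the Euclidean volume on a complex subspace `T` of the
tangent space at `z`: the determinant of the Gram matrix of the metric in a Euclidean orthonormal
basis of `T` (the square root of the real Gram determinant is this complex determinant). -/
def fsVolRatio {m : ℕ} (z : Aff m) (T : Submodule ℂ (Aff m)) : ℝ :=
  (Matrix.det (Matrix.of fun i j =>
    fsMetric z (stdOrthonormalBasis ℂ T i : Aff m) (stdOrthonormalBasis ℂ T j : Aff m))).re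

/-- Fubini–Study Riemannian volume on the affine chart. -/
def fsVolume (m : ℕ) : Measure (Aff m) :=
  volume.withDensity fun z => ENNReal.ofReal (fsVolRatio z ⊤)

/-- The measure `|Z_s|`: Fubini–Study Riemannian `(2m-2k)`-volume along the regular points of
`Z_s`. Here `μHE[d]` is `d`-dimensional Hausdorff measure normalised to be Euclidean surface
measure, which is multiplied by the ratio of the two volumes on the tangent space `ker ds`. -/
def zeroMeasure {k m N : ℕ} (c : Coeff k m N) : Measure (Aff m) :=
  ((μHE[2 * (m - k)] : Measure (Aff m)).restrict (regZeros c)).withDensity fun z =>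
    ENNReal.ofReal (fsVolRatio z (LinearMap.ker (fderiv ℂ (tuple c) z).toLinearMap))

/-- The product `ℂ^m × ⋯ × ℂ^m` (`n` factors) punctured along the generalised diagonal. -/
def punctured (n m : ℕ) : Set (Fin n → Aff m) := {z | Function.Injective z}

/-- `K` is the `n`-point zero correlation function of `k` independent `SU(m+1)`-polynomials of
degree `N`: the nonnegative continuous function on the punctured product with
`𝔼 |Z_s|^n = K(z) dz`, where `dz` is the product of the Fubini–Study volumes. -/
def IsZeroCorrelation (n k m N : ℕ) (K : (Fin n → Aff m) → ℝ) : Prop :=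
  ContinuousOn K (punctured n m) ∧ (∀ z ∈ punctured n m, 0 ≤ K z) ∧
    ∀ A : Set (Fin n → Aff m), MeasurableSet A → A ⊆ punctured n m →
      AEMeasurable (fun c : Coeff k m N => Measure.pi (fun _ : Fin n => zeroMeasure c) A)
        (coeffLaw k m N) ∧
      ∫⁻ c : Coeff k m N, Measure.pi (fun _ : Fin n => zeroMeasure c) A ∂(coeffLaw k m N) =
        ∫⁻ z in A, ENNReal.ofReal (K z) ∂(Measure.pi fun _ : Fin n => fsVolume m)

open Classical in
/-- The `n`-point zero correlation function `K^N_{nk}` (it is unique on the punctured product; the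
value `0` is used only where it does not exist). -/
def zeroCorrelation (n k m N : ℕ) : (Fin n → Aff m) → ℝ :=
  if h : ∃ K, IsZeroCorrelation n k m N K then h.choose else 0

/-- The rescaled correlation function `N^{-nk} K^N_{nk}(z^1/√N, …, z^n/√N)`. -/
def scaledCorrelation (n k m N : ℕ) (z : Fin n → Aff m) : ℝ :=
  ((N : ℝ) ^ (n * k))⁻¹ *
    zeroCorrelation n k m N (fun p => (((Real.sqrt N)⁻¹ : ℝ) : ℂ) • z p)

/-- The `n`-point scaling limit zero correlation function
`K^∞_{nkm}(z) = lim_{N → ∞} N^{-nk} K^N_{nk}(z/√N)`. -/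
def limitCorrelation (n k m : ℕ) (z : Fin n → Aff m) : ℝ :=
  limUnder atTop fun N : ℕ => scaledCorrelation n k m N z

/-- The normalised `n`-point scaling limit zero correlation function
`K̃^∞_{nkm} = (K^∞_{1km})^{-n} K^∞_{nkm}`, with the constant `K^∞_{1km}` evaluated at `0`. -/
def normalizedLimitCorrelation (n k m : ℕ) (z : Fin n → Aff m) : ℝ :=
  (limitCorrelation 1 k m fun _ => 0)⁻¹ ^ n * limitCorrelation n k m z

/-- `r = min_{p ≠ p'} |z^p - z^{p'}|` (for `n ≥ 2` this infimum is over a nonempty finite set). -/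
def minSep {n m : ℕ} (z : Fin n → Aff m) : ℝ :=
  ⨅ pq : {pq : Fin n × Fin n // pq.1 ≠ pq.2}, ‖z pq.1.1 - z pq.1.2‖

end ShortRange

end

/-! ### Linear coordinates adapted to a surjection, and the normal Jacobian. -/

noncomputable section

open Filter Topology MeasureTheory ShortRange

namespace ShortRange

/-! The correlation function is an explicit function of finitely many covariances. Under rescaling
these converge to the covariances of the Bargmann–Fock field, with kernel $e^{\langle z,w\rangle}$,
whose dependence between distant points decays like a Gaussian.

Explicit formula. By Kac–Rice (`kacRice_pi`), the density of $\mathbf E|Z_s|^n$ at distinct points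
is the joint density at $0$ of the values, $(\pi^n\det A)^{-k}$, times the expectation of a product
of squared Jacobians, given that the values vanish. The conditional law is Gaussian with covariance
the Schur complement $C-BA^{-1}B^*$ (`derCov_resProj`), where $A$, $B$, $C$ are the covariances of
values, of derivatives with values, and of derivatives. Wick's formula makes the expectation a
polynomial in it (`wickPoly`). The identity `jac_mul_fsVolRatio` trades the Fubini–Study volume of
the random tangent space for a polynomial in the derivative.

Kac–Rice rests on the coarea formula `coarea`. Near a point where some unit coefficient vector $v$
gives a nonzero value, one Gaussian direction $a v$ is split off. The zero set of $c+av$ is then the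
level set $a$ of a quotient of fields (`solve`), so integrating over $a$ is integrating over space.
The $n$-point formula conditions on one point at a time.

Limit. The covariance kernel is $(1+\langle z,w\rangle)^N$, which rescales to $e^{\langle
z,w\rangle}$. The limiting matrix $A$ is invertible at distinct points (`det_exp_hdot_ne_zero`), so
the density passes to the limit.

Decay. Multiplying the field by $e^{-|z|^2/2}$ and using covariant derivatives leaves the density
unchanged (`limFun_eq`). Each point alone then has the identity covariance, and entries joining
distinct points are at most $2\varepsilon$ with $\varepsilon=r^2e^{-r^2/2}$, once $r\ge\sqrt2$. They
matter only to second order: a permutation that changes the point label of one index changes that of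
another (`exists_ne_of_perm`), and the Schur correction is quadratic in $B$. The error is thus
$O(\varepsilon^2)=O(r^4e^{-r^2})$. -/

theorem volume_preserving_ofLp (ι : Type*) [Fintype ι] :
    MeasurePreserving (WithLp.ofLp : EuclideanSpace ℂ ι → (ι → ℂ)) := by
  set B := Pi.orthonormalBasis (𝕜 := ℝ) (E := fun _ : ι => ℂ)
    (fun _ : ι => Complex.orthonormalBasisOneI) with hB
  let e : EuclideanSpace ℂ ι ≃L[ℝ] (ι → ℂ) := (PiLp.continuousLinearEquiv 2 ℝ (fun _ : ι => ℂ))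
  have h1 : (volume : Measure (EuclideanSpace ℂ ι)) = B.toBasis.addHaar :=
    B.addHaar_eq_volume.symm
  have h2 : B.toBasis.addHaar = Measure.map e.symm (volume : Measure (ι → ℂ)) := by
    rw [Module.Basis.addHaar_eq_iff]
    -- The basis consists of $1$ and $i$ in each coordinate, so its parallelepiped is a product of
    -- unit squares, of volume one on both sides.
    have hset : (e.symm ⁻¹' (B.toBasis.parallelepiped : Set (EuclideanSpace ℂ ι))) =
        Set.univ.pi fun _ : ι => parallelepiped Complex.orthonormalBasisOneI := by
      have hb : parallelepiped Complex.orthonormalBasisOneI =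
          {w : ℂ | ∀ i, Complex.orthonormalBasisOneI.repr w i ∈ Set.Icc (0 : ℝ) 1} := by
        rw [← OrthonormalBasis.coe_toBasis, parallelepiped_basis_eq]
        simp
      rw [Module.Basis.coe_parallelepiped, parallelepiped_basis_eq, hb]
      ext x
      simp only [Set.mem_preimage, Set.mem_ofPred_eq, Set.mem_pi, Set.mem_univ, true_implies]
      refine ⟨fun h i j => ?_, fun h p => ?_⟩
      · have := h ⟨i, j⟩
        rw [OrthonormalBasis.coe_toBasis_repr_apply] at this
        exact (Pi.orthonormalBasis_repr (fun _ : ι => Complex.orthonormalBasisOneI) x ⟨i, j⟩) ▸ this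
      · rw [OrthonormalBasis.coe_toBasis_repr_apply]
        exact (Pi.orthonormalBasis_repr (fun _ : ι => Complex.orthonormalBasisOneI) x p).symm ▸
          h p.1 p.2
    rw [Measure.map_apply e.symm.continuous.measurable
      B.toBasis.parallelepiped.isCompact.measurableSet, hset, volume_pi, Measure.pi_pi]
    simp only [OrthonormalBasis.volume_parallelepiped, Finset.prod_const_one]
  refine ⟨e.continuous.measurable, ?_⟩
  change Measure.map e _ = _
  rw [h1, h2, Measure.map_map e.continuous.measurable e.symm.continuous.measurable]
  simp

/-- The matrix of a linear map `ℂ^m → ℂ^k`. -/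
def mat {k m : ℕ} (L : Aff m →L[ℂ] (Fin k → ℂ)) : Matrix (Fin k) (Fin m) ℂ :=
  Matrix.of fun j q => L (EuclideanSpace.single q 1) j

/-- The normal Jacobian of a linear map `ℂ^m → ℂ^k`. -/
def jac {k m : ℕ} (L : Aff m →L[ℂ] (Fin k → ℂ)) : ℝ :=
  (mat L * (mat L).conjTranspose).det.re

theorem apply_eq_mat {k m : ℕ} (L : Aff m →L[ℂ] (Fin k → ℂ)) (x : Aff m) (j : Fin k) :
    L x j = ∑ q, mat L j q * x q := by
  conv_lhs => rw [← (EuclideanSpace.basisFun (Fin m) ℂ).sum_repr x]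
  simp [mat, mul_comm]

/-- The real determinant of a complex-linear map is the norm from $\mathbb C$ to $\mathbb R$ of its
complex determinant. This is why `jac` carries no square root. -/
theorem volume_image_complexLinear {ι : Type*} [Fintype ι] [DecidableEq ι]
    (A : (ι → ℂ) →ₗ[ℂ] (ι → ℂ)) (S : Set (ι → ℂ)) :
    volume (A '' S) = ENNReal.ofReal (Complex.normSq (LinearMap.det A)) * volume S := by
  have := Measure.addHaar_image_linearMap (volume : Measure (ι → ℂ)) (A.restrictScalars ℝ) S
  rw [LinearMap.det_restrictScalars, Algebra.norm_complex_eq] at this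
  simpa [abs_of_nonneg (Complex.normSq_nonneg _)] using this

/-- Splitting of the coordinates of `ℂ^m`. -/
def splitCoord {k d m : ℕ} (e : Fin k ⊕ Fin d ≃ Fin m) : (Fin m → ℂ) ≃ᵐ (Fin k → ℂ) × Aff d :=
  ((MeasurableEquiv.piCongrLeft (fun _ => ℂ) e).symm.trans
    (MeasurableEquiv.sumPiEquivProdPi (fun _ => ℂ))).trans
    ((MeasurableEquiv.refl _).prodCongr (MeasurableEquiv.toLp 2 (Fin d → ℂ)))

theorem splitCoord_apply {k d m : ℕ} (e : Fin k ⊕ Fin d ≃ Fin m) (x : Fin m → ℂ) :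
    splitCoord e x = (fun j => x (e (.inl j)), WithLp.toLp 2 fun t => x (e (.inr t))) := by
  rfl

theorem measurePreserving_splitCoord {k d m : ℕ} (e : Fin k ⊕ Fin d ≃ Fin m) :
    MeasurePreserving (splitCoord e) := by
  refine ((volume_measurePreserving_piCongrLeft (fun _ => ℂ) e).symm.trans
    (volume_measurePreserving_sumPiEquivProdPi _)).trans ?_
  have h : MeasurePreserving (MeasurableEquiv.toLp 2 (Fin d → ℂ)) :=
    (volume_preserving_ofLp (Fin d)).symm (MeasurableEquiv.toLp 2 (Fin d → ℂ)).symm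
  exact (MeasurePreserving.id volume).prod h



theorem exists_kernel_basis {k m : ℕ} (L : Aff m →L[ℂ] (Fin k → ℂ))
    (hL : Function.Surjective L) :
    k ≤ m ∧ Nonempty (OrthonormalBasis (Fin (m - k)) ℂ (LinearMap.ker L.toLinearMap)) := by
  have h1 := LinearMap.finrank_range_add_finrank_ker L.toLinearMap
  rw [LinearMap.range_eq_top.2 hL, finrank_top] at h1
  simp only [Module.finrank_fintype_fun_eq_card, Fintype.card_fin, finrank_euclideanSpace] at h1
  refine ⟨by omega, ⟨(stdOrthonormalBasis ℂ _).reindex (finCongr (by omega))⟩⟩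

/-- The rows of $Q$ are orthonormal and orthogonal to those of $M$, so the Gram matrix of the
stacked square matrix is block diagonal with blocks $MM^*$ and $1$. -/
theorem det_fromRows_sq {k d m : ℕ} (e : Fin k ⊕ Fin d ≃ Fin m) (M : Matrix (Fin k) (Fin m) ℂ)
    (Q : Matrix (Fin d) (Fin m) ℂ) (hMQ : M * Q.conjTranspose = 0) (hQ : Q * Q.conjTranspose = 1) :
    Complex.normSq (((Matrix.fromRows M Q).submatrix e.symm id).det) =
      (M * M.conjTranspose).det.re := by
  have h : ((Matrix.fromRows M Q).submatrix e.symm id) *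
      ((Matrix.fromRows M Q).submatrix e.symm id).conjTranspose =
      (Matrix.fromBlocks (M * M.conjTranspose) 0 0 1).submatrix e.symm e.symm := by
    have h3 : Q * M.conjTranspose = 0 := by
      have := congrArg Matrix.conjTranspose hMQ
      simpa using this
    rw [Matrix.conjTranspose_submatrix, Matrix.conjTranspose_fromRows_eq_fromCols_conjTranspose,
      ← Matrix.submatrix_mul _ _ _ _ _ Function.bijective_id, Matrix.fromRows_mul_fromCols, hMQ, hQ, h3]
  have h2 := congrArg Matrix.det h
  rw [Matrix.det_mul, Matrix.det_conjTranspose, Matrix.det_submatrix_equiv_self,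
    Matrix.det_fromBlocks_zero₂₁, Matrix.det_one, mul_one, Complex.star_def, Complex.mul_conj] at h2
  rw [← h2, Complex.ofReal_re]

/-- Linear coordinates adapted to a surjective linear map `L`: the first component is `L`, the
second one is an isometric coordinate on `ker L` composed with the orthogonal projection. -/
theorem exists_adapted_coord {k m : ℕ} (L : Aff m →L[ℂ] (Fin k → ℂ))
    (hL : Function.Surjective L) :
    ∃ Φ : Aff m ≃L[ℂ] (Fin k → ℂ) × Aff (m - k), (∀ x, (Φ x).1 = L x) ∧
      (∀ x, ‖(Φ x).2‖ ≤ ‖x‖) ∧ (∀ t, ‖Φ.symm (0, t)‖ = ‖t‖) ∧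
      ∀ S : Set (Aff m), volume (Φ '' S) = ENNReal.ofReal (jac L) * volume S := by
  obtain ⟨hkm, ⟨b⟩⟩ := exists_kernel_basis L hL
  set V := LinearMap.ker L.toLinearMap with hV
  let P : Aff m →L[ℂ] Aff (m - k) :=
    (b.repr.toContinuousLinearEquiv : V →L[ℂ] Aff (m - k)).comp V.orthogonalProjectionOnto
  have hPV : ∀ v : V, P v = b.repr v := fun v => by
    simp [P]
  have hPle : ∀ x, ‖P x‖ ≤ ‖x‖ := fun x => by
    simpa [P] using V.norm_orthogonalProjectionOnto_apply_le x
  let e : Fin k ⊕ Fin (m - k) ≃ Fin m := finSumFinEquiv.trans (finCongr (by omega))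
  let Φ₁ : Aff m →L[ℂ] (Fin k → ℂ) × Aff (m - k) := L.prod P
  have hinj : Function.Injective Φ₁ := by
    rw [injective_iff_map_eq_zero]
    intro x hx
    have hx1 : L x = 0 := congrArg Prod.fst hx
    have hx2 : P x = 0 := congrArg Prod.snd hx
    have hxV : x ∈ V := hx1
    have := hPV ⟨x, hxV⟩
    rw [hx2] at this
    have h0 := b.repr.map_eq_zero_iff.1 this.symm
    exact congrArg Subtype.val h0
  have hdim : Module.finrank ℂ (Aff m) = Module.finrank ℂ ((Fin k → ℂ) × Aff (m - k)) := by
    simp; omega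
  let Φ : Aff m ≃L[ℂ] (Fin k → ℂ) × Aff (m - k) :=
    (LinearEquiv.ofInjectiveOfFinrankEq Φ₁.toLinearMap hinj hdim).toContinuousLinearEquiv
  have hΦ : ∀ x, Φ x = (L x, P x) := fun x => rfl
  refine ⟨Φ, fun x => rfl, hPle, fun t => ?_, fun S => ?_⟩
  · have : Φ.symm (0, t) = (b.repr.symm t : V) := by
      rw [ContinuousLinearEquiv.symm_apply_eq, hΦ, hPV]
      have : L (b.repr.symm t : V) = 0 := (b.repr.symm t : V).2
      simp [this]
    rw [this]
    exact b.repr.symm.norm_map t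
  -- The rows of $Q$ are the conjugates of an orthonormal basis of $\ker L$. In coordinates $\Phi$
  -- is the matrix of $L$ stacked on $Q$, whose squared determinant is `jac L`.
  · set Q : Matrix (Fin (m - k)) (Fin m) ℂ := Matrix.of fun t q => star ((b t : Aff m) q) with hQdef
    have hPQ : ∀ x t, P x t = ∑ q, Q t q * x q := by
      intro x t
      have : P x t = inner ℂ (b t : Aff m) x := by
        change b.repr (V.orthogonalProjectionOnto x) t = _
        rw [b.repr_apply_apply, Submodule.coe_inner, Submodule.coe_orthogonalProjectionOnto_apply,
          Submodule.inner_starProjection_left_eq_right V _ x |>.symm]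
        simp
      rw [this, PiLp.inner_apply]
      simp [Q, mul_comm]
    have hMQ : mat L * Q.conjTranspose = 0 := by
      ext j t
      have : L (b t : Aff m) j = 0 := congrFun (b t).2 j
      rw [apply_eq_mat] at this
      simpa [Matrix.mul_apply, Q] using this
    have hQQ : Q * Q.conjTranspose = 1 := by
      ext t t'
      have := orthonormal_iff_ite.1 b.orthonormal t t'
      rw [Submodule.coe_inner, PiLp.inner_apply] at this
      simpa [Matrix.mul_apply, Q, Matrix.one_apply, mul_comm] using this
    have hdet := det_fromRows_sq e (mat L) Q hMQ hQQ
    set R := ((Matrix.fromRows (mat L) Q).submatrix e.symm id) with hR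
    have hcomp : ∀ x : Aff m, Φ x = splitCoord e (Matrix.toLin' R x.ofLp) := by
      intro x
      rw [hΦ, splitCoord_apply]
      refine Prod.ext ?_ ?_
      · ext j
        simp [apply_eq_mat, Matrix.toLin'_apply, R, Matrix.mulVec, dotProduct]
      · ext t
        simp [hPQ, Matrix.toLin'_apply, R, Matrix.mulVec, dotProduct]
    have himg : Φ '' S = splitCoord e '' (Matrix.toLin' R '' (WithLp.ofLp '' S)) := by
      rw [Set.image_image, Set.image_image]
      exact Set.image_congr fun x _ => hcomp x
    rw [himg, ← MeasurableEquiv.preimage_symm,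
      (measurePreserving_splitCoord e).symm.measure_preimage_equiv, volume_image_complexLinear,
      LinearMap.det_toLin', hdet]
    have h4 := ((volume_preserving_ofLp (Fin m)).symm
      (MeasurableEquiv.toLp 2 (Fin m → ℂ)).symm).measure_preimage_equiv S
    have h5 : (WithLp.ofLp '' S : Set (Fin m → ℂ)) =
        (MeasurableEquiv.toLp 2 (Fin m → ℂ)).symm.symm ⁻¹' S := by
      rw [MeasurableEquiv.preimage_symm]; rfl
    rw [h5, h4]
    rfl

end ShortRange

end

/-! ### Level sets compared locally with linear models. -/

noncomputable section

open Filter Topology MeasureTheory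

namespace ShortRange

theorem continuous_mat {k m : ℕ} :
    Continuous (mat : (Aff m →L[ℂ] (Fin k → ℂ)) → Matrix (Fin k) (Fin m) ℂ) := by
  refine continuous_pi fun j => continuous_pi fun q => ?_
  simp only [mat, Matrix.of_apply]
  fun_prop

theorem continuous_jac {k m : ℕ} :
    Continuous (jac : (Aff m →L[ℂ] (Fin k → ℂ)) → ℝ) :=
  Complex.continuous_re.comp
    (continuous_mat.matrix_mul continuous_mat.matrix_conjTranspose).matrix_det

/-- The matrix $M^*(MM^*)^{-1}$ is a right inverse. -/
theorem surjective_of_det_ne_zero {k m : ℕ} {L : Aff m →L[ℂ] (Fin k → ℂ)}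
    (h : (mat L * (mat L).conjTranspose).det ≠ 0) : Function.Surjective L := by
  intro y
  refine ⟨WithLp.toLp 2 ((mat L).conjTranspose.mulVec
    ((mat L * (mat L).conjTranspose)⁻¹.mulVec y)), ?_⟩
  ext j
  rw [apply_eq_mat]
  change (mat L).mulVec ((mat L).conjTranspose.mulVec _) j = _
  rw [Matrix.mulVec_mulVec, Matrix.mulVec_mulVec, Matrix.mul_nonsing_inv _ (Ne.isUnit h),
    Matrix.one_mulVec]

/-- The adapted coordinates send the unit ball to a nonempty open set, which has positive volume. -/
theorem jac_pos {k m : ℕ} {L : Aff m →L[ℂ] (Fin k → ℂ)} (hL : Function.Surjective L) :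
    0 < jac L := by
  obtain ⟨Φ, -, -, -, h⟩ := exists_adapted_coord L hL
  have h1 := h (Metric.ball 0 1)
  by_contra hneg
  rw [ENNReal.ofReal_of_nonpos (not_lt.1 hneg), zero_mul] at h1
  have h2 : IsOpen (Φ '' Metric.ball 0 1) := Φ.toHomeomorph.isOpenMap _ Metric.isOpen_ball
  exact (h2.measure_pos volume ((Metric.nonempty_ball.2 one_pos).image _)).ne' h1

theorem jac_eq_zero {k m : ℕ} {L : Aff m →L[ℂ] (Fin k → ℂ)} (hL : ¬ Function.Surjective L) :
    jac L = 0 := by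
  have : (mat L * (mat L).conjTranspose).det = 0 := by
    by_contra h
    exact hL (surjective_of_det_ne_zero h)
  simp [jac, this]

theorem jac_ne_zero_iff {k m : ℕ} {L : Aff m →L[ℂ] (Fin k → ℂ)} :
    jac L ≠ 0 ↔ Function.Surjective L :=
  ⟨fun h => by_contra fun hL => h (jac_eq_zero hL), fun h => (jac_pos h).ne'⟩

theorem euclideanHausdorffMeasure_image_le {X Y : Type*} [EMetricSpace X] [MeasurableSpace X]
    [BorelSpace X] [EMetricSpace Y] [MeasurableSpace Y] [BorelSpace Y] {f : X → Y} {s : Set X}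
    {K : NNReal} (h : LipschitzOnWith K f s) (d : ℕ) :
    (μHE[d] : Measure Y) (f '' s) ≤ (K : ENNReal) ^ d * (μHE[d] : Measure X) s := by
  rw [Measure.euclideanHausdorffMeasure_def, Measure.euclideanHausdorffMeasure_def,
    Measure.smul_apply, Measure.smul_apply, ENNReal.smul_def, ENNReal.smul_def, smul_eq_mul,
    smul_eq_mul, mul_left_comm]
  gcongr
  simpa using h.hausdorffMeasure_image_le (d := d) (Nat.cast_nonneg d)

/-- An expanding map is injective with Lipschitz inverse, to which the upper bound applies. -/
theorem le_euclideanHausdorffMeasure_image {X Y : Type*} [EMetricSpace X] [MeasurableSpace X]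
    [BorelSpace X] [EMetricSpace Y] [MeasurableSpace Y] [BorelSpace Y] {f : X → Y} {s : Set X}
    {K : NNReal} (h : ∀ x ∈ s, ∀ y ∈ s, edist x y ≤ K * edist (f x) (f y)) (d : ℕ) :
    (μHE[d] : Measure X) s ≤ (K : ENNReal) ^ d * (μHE[d] : Measure Y) (f '' s) := by
  rcases s.eq_empty_or_nonempty with rfl | ⟨x₀, hx₀⟩
  · simp
  have : Nonempty X := ⟨x₀⟩
  have hinj : Set.InjOn f s := fun x hx y hy hxy => by
    have := h x hx y hy
    rw [hxy, edist_self, mul_zero] at this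
    exact edist_le_zero.1 this
  have hlip : LipschitzOnWith K (Function.invFunOn f s) (f '' s) := by
    rintro _ ⟨x, hx, rfl⟩ _ ⟨y, hy, rfl⟩
    rw [hinj.leftInvOn_invFunOn hx, hinj.leftInvOn_invFunOn hy]
    exact h x hx y hy
  have := euclideanHausdorffMeasure_image_le hlip d
  rwa [hinj.leftInvOn_invFunOn.image_image] at this

theorem euclideanHausdorffMeasure_aff (d : ℕ) : (μHE[2 * d] : Measure (Aff d)) = volume := by
  have h : Module.finrank ℝ (Aff d) = 2 * d := by
    rw [finrank_real_of_complex, finrank_euclideanSpace, Fintype.card_fin]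
  rw [← h]
  exact InnerProductSpace.euclideanHausdorffMeasure_eq_volume

/-- `Φ` is a linear coordinate system adapted to `L`. -/
structure IsAdapted {k m : ℕ} (L : Aff m →L[ℂ] (Fin k → ℂ))
    (Φ : Aff m ≃L[ℂ] (Fin k → ℂ) × Aff (m - k)) : Prop where
  fst : ∀ x, (Φ x).1 = L x
  snd_le : ∀ x, ‖(Φ x).2‖ ≤ ‖x‖
  symm_norm : ∀ t, ‖Φ.symm (0, t)‖ = ‖t‖
  volume_image : ∀ S : Set (Aff m), volume (Φ '' S) = ENNReal.ofReal (jac L) * volume S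

/-- The maps `s c` are, in the coordinates `Φ`, `δ`-close to `L` on the sections of `W`. -/
def Approx {X : Type*} {k m : ℕ} (L : Aff m →L[ℂ] (Fin k → ℂ))
    (Φ : Aff m ≃L[ℂ] (Fin k → ℂ) × Aff (m - k)) (δ : ℝ) (s : X → Aff m → Fin k → ℂ)
    (W : Set (X × Aff m)) : Prop :=
  ∀ c x y, (c, x) ∈ W → (c, y) ∈ W →
    ‖Φ.symm (s c x - s c y - L (x - y), 0)‖ ≤ δ * ‖x - y‖

/-- If both points lie on one level set, the $L$-component of $x-y$ is pure linearisation error, of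
size at most $\delta\|x-y\|$. The rest is carried by the isometric coordinate on $\ker L$, so
projecting a level set to $\ker L$ distorts lengths by a factor between $1-\delta$ and $1$. -/
theorem norm_sub_le_of_approx {k m : ℕ} {L : Aff m →L[ℂ] (Fin k → ℂ)}
    {Φ : Aff m ≃L[ℂ] (Fin k → ℂ) × Aff (m - k)} (hΦ : IsAdapted L Φ) {δ : ℝ} {x y : Aff m}
    {u v : Fin k → ℂ} (huv : u = v) (h : ‖Φ.symm (u - v - L (x - y), 0)‖ ≤ δ * ‖x - y‖) :
    (1 - δ) * ‖x - y‖ ≤ ‖(Φ x).2 - (Φ y).2‖ := by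
  have h1 : x - y = -Φ.symm (u - v - L (x - y), 0) + Φ.symm (0, (Φ x).2 - (Φ y).2) := by
    rw [← map_neg, ← map_add, eq_comm, ContinuousLinearEquiv.symm_apply_eq]
    refine Prod.ext ?_ ?_
    · simp [huv, hΦ.fst]
    · simp
  have h2 : ‖x - y‖ ≤ ‖Φ.symm (u - v - L (x - y), 0)‖ + ‖(Φ x).2 - (Φ y).2‖ := by
    conv_lhs => rw [h1]
    refine (norm_add_le _ _).trans ?_
    rw [norm_neg, hΦ.symm_norm]
  linarith

/-- Hausdorff measure of a subset of a level set in adapted coordinates. -/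
theorem fibre_bounds {k m : ℕ} {L : Aff m →L[ℂ] (Fin k → ℂ)}
    {Φ : Aff m ≃L[ℂ] (Fin k → ℂ) × Aff (m - k)} (hΦ : IsAdapted L Φ) {δ : ℝ} (hδ : δ < 1)
    {B : Set (Aff m)}
    (h : ∀ x ∈ B, ∀ y ∈ B, (1 - δ) * ‖x - y‖ ≤ ‖(Φ x).2 - (Φ y).2‖) :
    volume ((fun x => (Φ x).2) '' B) ≤ (μHE[2 * (m - k)] : Measure (Aff m)) B ∧
      (μHE[2 * (m - k)] : Measure (Aff m)) B ≤
        ENNReal.ofReal ((1 - δ)⁻¹) ^ (2 * (m - k)) * volume ((fun x => (Φ x).2) '' B) := by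
  rw [← euclideanHausdorffMeasure_aff]
  constructor
  · have hl : LipschitzOnWith 1 (fun x => (Φ x).2) B := by
      refine LipschitzOnWith.of_dist_le_mul fun x _ y _ => ?_
      rw [dist_eq_norm, dist_eq_norm]
      simpa using hΦ.snd_le (x - y)
    simpa using euclideanHausdorffMeasure_image_le hl (2 * (m - k))
  · refine le_euclideanHausdorffMeasure_image (fun x hx y hy => ?_) _
    have := h x hx y hy
    rw [edist_dist, edist_dist]
    change _ ≤ ENNReal.ofReal _ * _
    rw [← ENNReal.ofReal_mul (inv_nonneg.2 (by linarith)), dist_eq_norm, dist_eq_norm]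
    refine ENNReal.ofReal_le_ofReal ?_
    rw [inv_mul_eq_div, le_div_iff₀ (by linarith)]
    linarith

/-- Lindelöf gives a countable cover by good open sets. As `p` passes to subsets, it survives making
the cover disjoint. -/
theorem exists_countable_partition {Y : Type*} [TopologicalSpace Y] [SecondCountableTopology Y]
    [MeasurableSpace Y] [OpensMeasurableSpace Y] {R : Set Y} (hR : IsOpen R) (p : Set Y → Prop)
    (h0 : p ∅) (hmono : ∀ A B, A ⊆ B → p B → p A) (h : ∀ y ∈ R, ∃ W ∈ 𝓝 y, p W) :
    ∃ Q : ℕ → Set Y, (∀ i, MeasurableSet (Q i)) ∧ Pairwise (Function.onFun Disjoint Q) ∧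
      (⋃ i, Q i) = R ∧ ∀ i, p (Q i) := by
  choose! W hW hp using h
  obtain ⟨t, htR, htc, hcov⟩ := TopologicalSpace.countable_cover_nhdsWithin
    (s := R) (f := fun y => interior (W y) ∩ R)
    (fun y hy => mem_nhdsWithin_of_mem_nhds
      (inter_mem (interior_mem_nhds.2 (hW y hy)) (hR.mem_nhds hy)))
  rcases t.eq_empty_or_nonempty with rfl | hne
  · refine ⟨fun _ => ∅, fun _ => MeasurableSet.empty, fun i j _ => by simp [Function.onFun], ?_,
      fun _ => h0⟩
    simpa [eq_comm, Set.subset_empty_iff] using hcov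
  · obtain ⟨y, hy⟩ := htc.exists_eq_range hne
    let U : ℕ → Set Y := fun i => interior (W (y i)) ∩ R
    refine ⟨disjointed U, fun i => MeasurableSet.disjointed
      (fun j => (isOpen_interior.inter hR).measurableSet) i, disjoint_disjointed U, ?_,
      fun i => hmono _ _ ((disjointed_subset U i).trans
        (Set.inter_subset_left.trans interior_subset))
        (hp _ (htR (hy ▸ Set.mem_range_self i)))⟩
    rw [iUnion_disjointed]
    refine Set.Subset.antisymm (Set.iUnion_subset fun i => Set.inter_subset_right) ?_
    rw [hy, Set.biUnion_range] at hcov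
    exact hcov

/-- The derivative is close to `L = D p` near `p`, and the mean value inequality on a ball turns
this into closeness of increments. The tolerance $\delta/C$ absorbs the bound $C$ for $\Phi^{-1}$.
The neighbourhood is a product because `Approx` compares two points over the same parameter. -/
theorem exists_approx_nhds {X : Type*} [TopologicalSpace X] {k m : ℕ}
    {s : X → Aff m → Fin k → ℂ} {D : X × Aff m → (Aff m →L[ℂ] (Fin k → ℂ))} {O : Set (X × Aff m)}
    (hO : IsOpen O) (hD : ContinuousOn D O)
    (hs : ∀ p ∈ O, HasFDerivAt (s p.1) (D p) p.2) {p : X × Aff m} (hp : p ∈ O)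
    (hsurj : Function.Surjective (D p)) {δ : ℝ} (hδ : 0 < δ) :
    ∃ L Φ, IsAdapted L Φ ∧ ∃ W ∈ 𝓝 p, Approx L Φ δ s W ∧ W ⊆ O ∧
      (∃ r : ℝ, ∀ q ∈ W, ‖q.2‖ ≤ r) ∧
      ∀ q ∈ W, (1 - δ) * jac L ≤ jac (D q) ∧ jac (D q) ≤ (1 + δ) * jac L := by
  set L := D p with hL
  obtain ⟨Φ, h1, h2, h3, h4⟩ := exists_adapted_coord L hsurj
  have hΦ : IsAdapted L Φ := ⟨h1, h2, h3, h4⟩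
  refine ⟨L, Φ, hΦ, ?_⟩
  have hJ := jac_pos hsurj
  obtain ⟨C, hC, hCb⟩ := (Φ.symm : (Fin k → ℂ) × Aff (m - k) →L[ℂ] Aff m).isBoundedLinearMap.bound
  have hDc : ContinuousAt D p := hD.continuousAt (hO.mem_nhds hp)
  have hJc : ContinuousAt (fun q => jac (D q)) p := continuous_jac.continuousAt.comp hDc
  have e1 : ∀ᶠ q in 𝓝 p, ‖D q - L‖ < δ / C := by
    have := hDc.sub (continuousAt_const (y := L))
    have := this.norm
    refine this.eventually_lt continuousAt_const ?_
    change ‖D p - L‖ < δ / C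
    rw [← hL, sub_self, norm_zero]
    positivity
  have e2 : ∀ᶠ q in 𝓝 p, (1 - δ) * jac L < jac (D q) :=
    continuousAt_const.eventually_lt hJc (by rw [← hL]; nlinarith)
  have e3 : ∀ᶠ q in 𝓝 p, jac (D q) < (1 + δ) * jac L :=
    hJc.eventually_lt continuousAt_const (by rw [← hL]; nlinarith)
  have e4 : ∀ᶠ q in 𝓝 p, ‖q.2‖ < ‖p.2‖ + 1 :=
    (continuous_snd.norm.continuousAt (x := p)).eventually_lt continuousAt_const (by simp)
  have e5 : ∀ᶠ q in 𝓝 p, q ∈ O := hO.mem_nhds hp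
  have e := ((((e1.and e2).and e3).and e4).and e5)
  rw [show p = (p.1, p.2) from rfl, nhds_prod_eq] at e
  obtain ⟨V, hV, U, hU, hVU⟩ := Filter.mem_prod_iff.1 e
  obtain ⟨ρ, hρ, hball⟩ := Metric.mem_nhds_iff.1 hU
  have hsub : ∀ q ∈ V ×ˢ Metric.ball p.2 ρ, ((((‖D q - L‖ < δ / C) ∧ (1 - δ) * jac L < jac (D q)) ∧
      jac (D q) < (1 + δ) * jac L) ∧ ‖q.2‖ < ‖p.2‖ + 1) ∧ q ∈ O :=
    fun q hq => hVU ⟨hq.1, hball hq.2⟩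
  refine ⟨V ×ˢ Metric.ball p.2 ρ, prod_mem_nhds hV (Metric.ball_mem_nhds _ hρ), ?_,
    fun q hq => (hsub q hq).2, ⟨_, fun q hq => (hsub q hq).1.2.le⟩,
    fun q hq => ⟨(hsub q hq).1.1.1.2.le, (hsub q hq).1.1.2.le⟩⟩
  intro c x y hx hy
  have hlip := (convex_ball p.2 ρ).norm_image_sub_le_of_norm_hasFDerivWithin_le'
    (𝕜 := ℂ) (f := s c) (f' := fun z => D (c, z)) (φ := L) (C := δ / C)
    (fun z hz => (hs (c, z) (hsub (c, z) ⟨hx.1, hz⟩).2).hasFDerivWithinAt)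
    (fun z hz => (hsub (c, z) ⟨hx.1, hz⟩).1.1.1.1.le) hy.2 hx.2
  calc ‖Φ.symm (s c x - s c y - L (x - y), 0)‖
      ≤ C * ‖(s c x - s c y - L (x - y), (0 : Aff (m - k)))‖ := hCb _
    _ ≤ C * (δ / C * ‖x - y‖) := by
        gcongr
        simpa [Prod.norm_def] using hlip
    _ = δ * ‖x - y‖ := by field_simp

end ShortRange

end

/-! ### Measurability of the volumes of zero sets, and the coarea formula. -/

noncomputable section

open Filter Topology MeasureTheory ProbabilityTheory

namespace ShortRange

theorem ennreal_le_of_forall_le_mul {x y : ENNReal} {K : ℝ → ENNReal}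
    (hK : Tendsto K (𝓝[>] 0) (𝓝 1)) (h : ∀ δ, 0 < δ → δ < 1 → x ≤ K δ * y) : x ≤ y := by
  have h1 : Tendsto (fun δ => K δ * y) (𝓝[>] 0) (𝓝 (1 * y)) :=
    ENNReal.Tendsto.mul_const hK (Or.inl one_ne_zero)
  rw [one_mul] at h1
  refine ge_of_tendsto h1 ?_
  filter_upwards [Ioo_mem_nhdsGT (zero_lt_one' ℝ)] with δ hδ
  exact h δ hδ.1 hδ.2

theorem tendsto_ofReal_pow_one {g : ℝ → ℝ} (hg : ContinuousAt g 0) (h0 : g 0 = 1) (d : ℕ) :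
    Tendsto (fun δ => ENNReal.ofReal (g δ) ^ d) (𝓝[>] 0) (𝓝 1) := by
  have h : Tendsto g (𝓝[>] 0) (𝓝 1) := h0 ▸ hg.tendsto.mono_left nhdsWithin_le_nhds
  simpa using ENNReal.Tendsto.pow (n := d) (ENNReal.tendsto_ofReal h)

theorem tendsto_inv_one_sub_pow (d : ℕ) :
    Tendsto (fun δ : ℝ => ENNReal.ofReal ((1 - δ)⁻¹) ^ d) (𝓝[>] 0) (𝓝 1) :=
  tendsto_ofReal_pow_one (g := fun δ : ℝ => (1 - δ)⁻¹)
    ((continuousAt_const.sub continuousAt_id).inv₀ (by simp)) (by simp) d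

/-- Along a sequence $\delta_j\to0$ the bounds force $g=\sup_j f_{\delta_j}$, a countable supremum
of measurable functions. -/
theorem measurable_of_sandwich {X : Type*} [MeasurableSpace X] {g : X → ENNReal}
    {K : ℝ → ENNReal} (hK : Tendsto K (𝓝[>] 0) (𝓝 1))
    (h : ∀ δ, 0 < δ → δ < 1 → ∃ f : X → ENNReal, Measurable f ∧
      ∀ c, f c ≤ g c ∧ g c ≤ K δ * f c) : Measurable g := by
  choose! f hf hfg using h
  obtain ⟨u, -, hu, hu0⟩ := exists_seq_strictAnti_tendsto' (zero_lt_one' ℝ)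
  have : g = fun c => ⨆ j, f (u j) c := by
    ext c
    refine le_antisymm ?_ (iSup_le fun j => (hfg _ (hu j).1 (hu j).2 c).1)
    have hu' : Tendsto u atTop (𝓝[>] 0) :=
      tendsto_nhdsWithin_iff.2 ⟨hu0, Eventually.of_forall fun j => (hu j).1⟩
    have h1 : Tendsto (fun j => K (u j) * ⨆ j, f (u j) c) atTop (𝓝 (1 * ⨆ j, f (u j) c)) :=
      ENNReal.Tendsto.mul_const (hK.comp hu') (Or.inl one_ne_zero)
    rw [one_mul] at h1
    refine ge_of_tendsto h1 (Eventually.of_forall fun j => ?_)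
    exact (hfg _ (hu j).1 (hu j).2 c).2.trans (by gcongr; exact le_iSup (fun j => f (u j) c) j)
  rw [this]
  exact Measurable.iSup fun j => hf _ (hu j).1 (hu j).2

/-- The part of the zero set of `s c` in the section of `Q`. -/
def zsec {X : Type*} {k m : ℕ} (s : X → Aff m → Fin k → ℂ) (Q : Set (X × Aff m)) (c : X) :
    Set (Aff m) := {z | (c, z) ∈ Q ∧ s c z = 0}

theorem Approx.mono {X : Type*} {k m : ℕ} {s : X → Aff m → Fin k → ℂ}
    {L : Aff m →L[ℂ] (Fin k → ℂ)}
    {Φ : Aff m ≃L[ℂ] (Fin k → ℂ) × Aff (m - k)} {δ : ℝ} {Q Q' : Set (X × Aff m)}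
    (h : Approx L Φ δ s Q) (hQ : Q' ⊆ Q) : Approx L Φ δ s Q' :=
  fun c x y hx hy => h c x y (hQ hx) (hQ hy)

theorem zsec_bounds {X : Type*} {k m : ℕ} {s : X → Aff m → Fin k → ℂ}
    {L : Aff m →L[ℂ] (Fin k → ℂ)}
    {Φ : Aff m ≃L[ℂ] (Fin k → ℂ) × Aff (m - k)} (hΦ : IsAdapted L Φ) {δ : ℝ} (hδ : δ < 1)
    {Q : Set (X × Aff m)} (hQ : Approx L Φ δ s Q) (c : X) :
    volume ((fun x => (Φ x).2) '' zsec s Q c) ≤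
        (μHE[2 * (m - k)] : Measure (Aff m)) (zsec s Q c) ∧
      (μHE[2 * (m - k)] : Measure (Aff m)) (zsec s Q c) ≤
        ENNReal.ofReal ((1 - δ)⁻¹) ^ (2 * (m - k)) *
          volume ((fun x => (Φ x).2) '' zsec s Q c) :=
  fibre_bounds hΦ hδ fun x hx y hy =>
    norm_sub_le_of_approx hΦ (hx.2.trans hy.2.symm) (hQ c x y hx.1 hy.1)

/-- A family of maps `ℂ^m → ℂ^k`, differentiable on the sections of the open set `O`. -/
structure IsFamily {X : Type*} [TopologicalSpace X] {k m : ℕ} (s : X → Aff m → Fin k → ℂ)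
    (D : X × Aff m → (Aff m →L[ℂ] (Fin k → ℂ))) (O : Set (X × Aff m)) : Prop where
  isOpen : IsOpen O
  continuousOn : ContinuousOn (fun p : X × Aff m => s p.1 p.2) O
  continuousOn_deriv : ContinuousOn D O
  hasFDerivAt : ∀ p ∈ O, HasFDerivAt (s p.1) (D p) p.2

/-- The points of `O` at which the derivative is surjective. -/
def regSet {X : Type*} {k m : ℕ} (D : X × Aff m → (Aff m →L[ℂ] (Fin k → ℂ)))
    (O : Set (X × Aff m)) : Set (X × Aff m) := {p | p ∈ O ∧ Function.Surjective (D p)}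

section

variable {X : Type*} [TopologicalSpace X] {k m : ℕ} {s : X → Aff m → Fin k → ℂ}
  {D : X × Aff m → (Aff m →L[ℂ] (Fin k → ℂ))} {O : Set (X × Aff m)}

theorem IsFamily.isOpen_regSet (hF : IsFamily s D O) : IsOpen (regSet D O) := by
  have := (continuous_jac.comp_continuousOn hF.continuousOn_deriv).isOpen_inter_preimage hF.isOpen
    (isOpen_compl_singleton (x := (0 : ℝ)))
  convert this using 1
  ext p
  simp [regSet, jac_ne_zero_iff]

/-- Small pieces of the regular set. -/
def IsPiece (s : X → Aff m → Fin k → ℂ) (D : X × Aff m → (Aff m →L[ℂ] (Fin k → ℂ))) (δ : ℝ)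
    (Q : Set (X × Aff m)) : Prop :=
  Q = ∅ ∨ ∃ L Φ, IsAdapted L Φ ∧ Approx L Φ δ s Q ∧ (∃ r : ℝ, ∀ q ∈ Q, ‖q.2‖ ≤ r) ∧
      ∀ q ∈ Q, (1 - δ) * jac L ≤ jac (D q) ∧ jac (D q) ≤ (1 + δ) * jac L

theorem IsFamily.exists_partition [SecondCountableTopology X] [MeasurableSpace X] [BorelSpace X]
    (hF : IsFamily s D O) {δ : ℝ} (hδ : 0 < δ) :
    ∃ Q : ℕ → Set (X × Aff m), (∀ i, MeasurableSet (Q i)) ∧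
      Pairwise (Function.onFun Disjoint Q) ∧ (⋃ i, Q i) = regSet D O ∧
      ∀ i, IsPiece s D δ (Q i) := by
  refine exists_countable_partition hF.isOpen_regSet (IsPiece s D δ) (Or.inl rfl) ?_ ?_
  · rintro A B hAB (rfl | ⟨L, Φ, hΦ, h1, ⟨r, h2⟩, h3⟩)
    · exact Or.inl (Set.subset_empty_iff.1 hAB)
    · exact Or.inr ⟨L, Φ, hΦ, fun c x y hx hy => h1 c x y (hAB hx) (hAB hy),
        ⟨r, fun q hq => h2 q (hAB hq)⟩, fun q hq => h3 q (hAB hq)⟩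
  · rintro p ⟨hp, hsurj⟩
    obtain ⟨L, Φ, hΦ, W, hW, h1, -, h2, h3⟩ := exists_approx_nhds hF.isOpen hF.continuousOn_deriv
      hF.hasFDerivAt hp hsurj hδ
    exact ⟨W, hW, Or.inr ⟨L, Φ, hΦ, h1, h2, h3⟩⟩

variable [MeasurableSpace X] [BorelSpace X]

theorem IsFamily.measurableSet_zero [SecondCountableTopology X] (hF : IsFamily s D O)
    {Q : Set (X × Aff m)} (hQ : MeasurableSet Q) (hQO : Q ⊆ O) :
    MeasurableSet {p : X × Aff m | p ∈ Q ∧ s p.1 p.2 = 0} := by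
  have h := (hF.continuousOn.isOpen_inter_preimage hF.isOpen
    (isOpen_compl_singleton (x := (0 : Fin k → ℂ)))).measurableSet
  have : {p : X × Aff m | p ∈ Q ∧ s p.1 p.2 = 0} =
      Q \ (O ∩ (fun p : X × Aff m => s p.1 p.2) ⁻¹' {0}ᶜ) := by
    ext p
    have := @hQO p
    simp only [Set.mem_ofPred_eq, Set.mem_sdiff, Set.mem_inter_iff, Set.mem_preimage,
      Set.mem_compl_iff, Set.mem_singleton_iff]
    tauto
  rw [this]
  exact hQ.diff h

theorem IsFamily.measurableSet_zsec [SecondCountableTopology X] (hF : IsFamily s D O)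
    {Q : Set (X × Aff m)} (hQ : MeasurableSet Q) (hQO : Q ⊆ O) (c : X) :
    MeasurableSet (zsec s Q c) :=
  measurable_prodMk_left (hF.measurableSet_zero hQ hQO)

/-- On a piece, the zeros over a fixed parameter project injectively to $\ker L$. Hence the total
zero set has a continuous injective image in parameter space times $\ker L$, which is Borel by
Lusin–Souslin, and its sections have measurable volume. -/
theorem IsFamily.measurable_piece [PolishSpace X] (hF : IsFamily s D O)
    {L : Aff m →L[ℂ] (Fin k → ℂ)}
    {Φ : Aff m ≃L[ℂ] (Fin k → ℂ) × Aff (m - k)} (hΦ : IsAdapted L Φ) {δ : ℝ} (hδ : δ < 1)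
    {Q : Set (X × Aff m)} (hQ : MeasurableSet Q) (hQO : Q ⊆ O) (hQa : Approx L Φ δ s Q) :
    MeasurableSet ((fun p : X × Aff m => (p.1, (Φ p.2).2)) ''
      {p : X × Aff m | p ∈ Q ∧ s p.1 p.2 = 0}) ∧
    Measurable fun c => volume ((fun x => (Φ x).2) '' zsec s Q c) := by
  have hS : MeasurableSet ((fun p : X × Aff m => (p.1, (Φ p.2).2)) ''
      {p : X × Aff m | p ∈ Q ∧ s p.1 p.2 = 0}) := by
    refine (hF.measurableSet_zero hQ hQO).image_of_continuousOn_injOn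
      (Continuous.continuousOn (by fun_prop)) ?_
    rintro ⟨c, x⟩ ⟨hx, hx0⟩ ⟨c', y⟩ ⟨hy, hy0⟩ hxy
    obtain ⟨rfl, hxy⟩ := Prod.ext_iff.1 hxy
    have := norm_sub_le_of_approx hΦ (hx0.trans hy0.symm) (hQa c x y hx hy)
    simp only at hxy
    rw [hxy, sub_self, norm_zero] at this
    have h0 : ‖x - y‖ = 0 :=
      le_antisymm (nonpos_of_mul_nonpos_right this (by linarith)) (norm_nonneg _)
    rw [sub_eq_zero.1 (norm_eq_zero.1 h0)]
  refine ⟨hS, ?_⟩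
  convert measurable_measure_prodMk_left (ν := (volume : Measure (Aff (m - k)))) hS using 3 with c
  ext t
  simp only [zsec, Set.mem_image, Set.mem_ofPred_eq, Set.mem_preimage, Prod.exists, Prod.mk.injEq]
  constructor
  · rintro ⟨z, hz, rfl⟩; exact ⟨c, z, hz, rfl, rfl⟩
  · rintro ⟨c', z, hz, rfl, rfl⟩; exact ⟨z, hz, rfl⟩

theorem IsFamily.measure_zsec_eq_tsum [SecondCountableTopology X] (hF : IsFamily s D O)
    {Q : ℕ → Set (X × Aff m)} (hQ : ∀ i, MeasurableSet (Q i))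
    (hdisj : Pairwise (Function.onFun Disjoint Q)) (hU : (⋃ i, Q i) = regSet D O)
    {B : Set (X × Aff m)} (hB : MeasurableSet B) (hBR : B ⊆ regSet D O) (c : X)
    (μ : Measure (Aff m)) : μ (zsec s B c) = ∑' i, μ (zsec s (B ∩ Q i) c) := by
  have hQR : ∀ i, Q i ⊆ regSet D O := fun i => hU ▸ Set.subset_iUnion Q i
  rw [← measure_iUnion]
  · congr 1
    ext z
    simp only [zsec, Set.mem_ofPred_eq, Set.mem_iUnion, Set.mem_inter_iff]
    constructor
    · rintro ⟨h1, h2⟩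
      obtain ⟨i, hi⟩ := Set.mem_iUnion.1 (hU ▸ hBR h1)
      exact ⟨i, ⟨h1, hi⟩, h2⟩
    · rintro ⟨i, ⟨h1, -⟩, h2⟩
      exact ⟨h1, h2⟩
  · intro i j hij
    refine Set.disjoint_left.2 fun z hz hz' => ?_
    exact Set.disjoint_left.1 (hdisj hij) hz.1.2 hz'.1.2
  · exact fun i => hF.measurableSet_zsec (hB.inter (hQ i)) (fun p hp => (hBR hp.1).1) c

/-- Summing over the pieces, Hausdorff measure is squeezed between measurable functions whose ratio
is at most $(1-\delta)^{-2(m-k)}$, which tends to one. -/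
theorem IsFamily.measurable_measure_zsec [PolishSpace X] (hF : IsFamily s D O)
    {B : Set (X × Aff m)} (hB : MeasurableSet B) (hBR : B ⊆ regSet D O) :
    Measurable fun c => (μHE[2 * (m - k)] : Measure (Aff m)) (zsec s B c) := by
  refine measurable_of_sandwich (tendsto_inv_one_sub_pow (2 * (m - k))) fun δ hδ hδ1 => ?_
  obtain ⟨Q, hQ, hdisj, hU, hpiece⟩ := hF.exists_partition hδ
  have hpc : ∀ i, ∃ f : X → ENNReal, Measurable f ∧ ∀ c,
      f c ≤ (μHE[2 * (m - k)] : Measure (Aff m)) (zsec s (B ∩ Q i) c) ∧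
      (μHE[2 * (m - k)] : Measure (Aff m)) (zsec s (B ∩ Q i) c) ≤
        ENNReal.ofReal ((1 - δ)⁻¹) ^ (2 * (m - k)) * f c := by
    intro i
    obtain h | ⟨L, Φ, hΦ, h1, -, -⟩ := hpiece i
    · exact ⟨0, measurable_zero, fun c => by simp [h, zsec]⟩
    · have h1' := h1.mono (Set.inter_subset_right (s := B))
      exact ⟨_, (hF.measurable_piece hΦ hδ1 (hB.inter (hQ i)) (fun p hp => (hBR hp.1).1) h1').2,
        fun c => zsec_bounds hΦ hδ1 h1' c⟩
  choose f hf hfb using hpc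
  refine ⟨fun c => ∑' i, f i c, Measurable.tsum hf, fun c => ?_⟩
  rw [hF.measure_zsec_eq_tsum hQ hdisj hU hB hBR, ← ENNReal.tsum_mul_left]
  exact ⟨ENNReal.tsum_le_tsum fun i => (hfb i c).1, ENNReal.tsum_le_tsum fun i => (hfb i c).2⟩

/-- The Hausdorff measures along the regular zeros, as a kernel. -/
def IsFamily.kernel [PolishSpace X] (hF : IsFamily s D O) : Kernel X (Aff m) where
  toFun c := (μHE[2 * (m - k)] : Measure (Aff m)).restrict (zsec s (regSet D O) c)
  measurable' := by
    refine Measure.measurable_of_measurable_coe _ fun B hB => ?_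
    have := hF.measurable_measure_zsec (B := regSet D O ∩ Prod.snd ⁻¹' B)
      (hF.isOpen_regSet.measurableSet.inter (measurable_snd hB)) Set.inter_subset_left
    convert this using 2 with c
    rw [Measure.restrict_apply hB]
    congr 1
    ext z
    simp only [zsec, Set.mem_inter_iff, Set.mem_ofPred_eq, Set.mem_preimage]
    tauto

theorem IsFamily.kernel_apply [PolishSpace X] (hF : IsFamily s D O) (c : X) :
    hF.kernel c = (μHE[2 * (m - k)] : Measure (Aff m)).restrict (zsec s (regSet D O) c) := rfl

/-- Each piece lies over a bounded region, so its zeros project into a fixed ball. The bound is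
uniform in the parameter, which is what makes the kernel s-finite and allows the interchange of
integrals in Kac–Rice. -/
theorem IsFamily.exists_finite_partition [PolishSpace X] (hF : IsFamily s D O) :
    ∃ Q : ℕ → Set (X × Aff m), (∀ i, MeasurableSet (Q i)) ∧
      Pairwise (Function.onFun Disjoint Q) ∧ (⋃ i, Q i) = regSet D O ∧
      ∀ i, ∃ C : ENNReal, C < ⊤ ∧ ∀ c,
        (μHE[2 * (m - k)] : Measure (Aff m)) (zsec s (Q i) c) ≤ C := by
  obtain ⟨Q, hQ, hdisj, hU, hpiece⟩ := hF.exists_partition (δ := 1 / 2) (by norm_num)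
  refine ⟨Q, hQ, hdisj, hU, fun i => ?_⟩
  obtain h | ⟨L, Φ, hΦ, h1, ⟨r, hr⟩, -⟩ := hpiece i
  · exact ⟨0, ENNReal.zero_lt_top, fun c => by simp [h, zsec]⟩
  · refine ⟨ENNReal.ofReal ((1 - 1 / 2 : ℝ)⁻¹) ^ (2 * (m - k)) *
      volume (Metric.closedBall (0 : Aff (m - k)) r), ?_, fun c => ?_⟩
    · have h2 : ENNReal.ofReal ((1 - 1 / 2 : ℝ)⁻¹) ^ (2 * (m - k)) < ⊤ :=
        (ENNReal.pow_ne_top ENNReal.ofReal_ne_top).lt_top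
      exact ENNReal.mul_lt_top h2 measure_closedBall_lt_top
    · have hb := (zsec_bounds hΦ (by norm_num) h1 c).2
      refine hb.trans (mul_le_mul_right (measure_mono ?_) _)
      rintro _ ⟨z, hz, rfl⟩
      rw [mem_closedBall_zero_iff]
      have hzQ : (c, z) ∈ Q i := hz.1
      exact (hΦ.snd_le z).trans (hr (c, z) hzQ)

instance IsFamily.isSFiniteKernel_kernel [PolishSpace X] (hF : IsFamily s D O) :
    IsSFiniteKernel hF.kernel := by
  obtain ⟨Q, hQ, hdisj, hU, hfin⟩ := hF.exists_finite_partition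
  have hQR : ∀ i, Q i ⊆ regSet D O := fun i => hU ▸ Set.subset_iUnion Q i
  have hRm := hF.isOpen_regSet.measurableSet
  let κ : ℕ → Kernel X (Aff m) := fun i =>
    { toFun := fun c => (μHE[2 * (m - k)] : Measure (Aff m)).restrict (zsec s (Q i) c)
      measurable' := by
        refine Measure.measurable_of_measurable_coe _ fun B hB => ?_
        have := hF.measurable_measure_zsec (B := Q i ∩ Prod.snd ⁻¹' B)
          ((hQ i).inter (measurable_snd hB)) (Set.inter_subset_left.trans (hQR i))
        convert this using 2 with c
        rw [Measure.restrict_apply hB]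
        congr 1
        ext z
        simp only [zsec, Set.mem_inter_iff, Set.mem_ofPred_eq, Set.mem_preimage]
        tauto }
  have hκ : hF.kernel = Kernel.sum κ := by
    ext c B hB
    rw [Kernel.sum_apply' _ _ hB, hF.kernel_apply, Measure.restrict_apply hB]
    have h := hF.measure_zsec_eq_tsum hQ hdisj hU (B := regSet D O ∩ Prod.snd ⁻¹' B)
      (hRm.inter (measurable_snd hB)) Set.inter_subset_left c μHE[2 * (m - k)]
    convert h using 2
    · ext z
      simp only [zsec, Set.mem_inter_iff, Set.mem_ofPred_eq, Set.mem_preimage]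
      tauto
    · ext i
      change Measure.restrict _ _ _ = _
      rw [Measure.restrict_apply hB]
      congr 1
      ext z
      have := @hQR i (c, z)
      simp only [zsec, Set.mem_inter_iff, Set.mem_ofPred_eq, Set.mem_preimage]
      tauto
  have : ∀ i, IsFiniteKernel (κ i) := fun i => by
    obtain ⟨C, hC, hCb⟩ := hfin i
    refine ⟨C, hC, fun c => ?_⟩
    change Measure.restrict _ _ _ ≤ _
    rw [Measure.restrict_apply_univ]
    exact hCb c
  rw [hκ]
  exact Kernel.isSFiniteKernel_sum

instance IsFamily.sigmaFinite_kernel [PolishSpace X] (hF : IsFamily s D O) (c : X) :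
    SigmaFinite (hF.kernel c) := by
  obtain ⟨Q, hQ, hdisj, hU, hfin⟩ := hF.exists_finite_partition
  have hQR : ∀ i, Q i ⊆ regSet D O := fun i => hU ▸ Set.subset_iUnion Q i
  have hm := hF.measurableSet_zsec hF.isOpen_regSet.measurableSet (fun p hp => hp.1) c
  have hmi : ∀ i, MeasurableSet (zsec s (Q i) c) := fun i =>
    hF.measurableSet_zsec (hQ i) (fun p hp => (hQR i hp).1) c
  -- The complement of the regular zero set is null; it is added to every member only so that the
  -- sets exhaust the space.
  refine ⟨⟨⟨fun i => zsec s (Q i) c ∪ (zsec s (regSet D O) c)ᶜ, fun i => trivial, fun i => ?_, ?_⟩⟩⟩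
  · rw [hF.kernel_apply, Measure.restrict_apply ((hmi i).union hm.compl)]
    obtain ⟨C, hC, hCb⟩ := hfin i
    refine lt_of_le_of_lt ((measure_mono ?_).trans (hCb c)) hC
    rintro z ⟨h | h, h'⟩
    · exact h
    · exact absurd h' h
  · rw [Set.eq_univ_iff_forall]
    intro z
    by_cases hz : z ∈ zsec s (regSet D O) c
    · obtain ⟨i, hi⟩ := Set.mem_iUnion.1 (hU ▸ hz.1)
      exact Set.mem_iUnion.2 ⟨i, Or.inl ⟨hi, hz.2⟩⟩
    · exact Set.mem_iUnion.2 ⟨0, Or.inr hz⟩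

end

/-- For a linear map the formula is Fubini in adapted coordinates. Here $f$ differs from $L$ by the
change of variables $\chi$, which distorts distances by factors in $[1-\delta,1+\delta]$, so the
formula holds up to constants tending to one. -/
theorem coarea_piece {k m : ℕ} {f : Aff m → Fin k → ℂ} {J : Aff m → ℝ}
    {L : Aff m →L[ℂ] (Fin k → ℂ)} {Φ : Aff m ≃L[ℂ] (Fin k → ℂ) × Aff (m - k)}
    (hΦ : IsAdapted L Φ) {δ : ℝ} (hδ0 : 0 < δ) (hδ : δ < 1) {B : Set (Aff m)}
    (hB : MeasurableSet B) (hf : ContinuousOn f B)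
    (h : ∀ x ∈ B, ∀ y ∈ B, ‖Φ.symm (f x - f y - L (x - y), 0)‖ ≤ δ * ‖x - y‖)
    (hJ : ∀ x ∈ B, (1 - δ) * jac L ≤ J x ∧ J x ≤ (1 + δ) * jac L) :
    (∫⁻ a : Fin k → ℂ, (μHE[2 * (m - k)] : Measure (Aff m)) {z | z ∈ B ∧ f z = a}) ≤
      (ENNReal.ofReal ((1 - δ)⁻¹) ^ (2 * (m - k)) * ENNReal.ofReal (1 + δ) ^ (2 * m) *
        ENNReal.ofReal ((1 - δ)⁻¹) ^ 1) * ∫⁻ z in B, ENNReal.ofReal (J z) ∧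
    (∫⁻ z in B, ENNReal.ofReal (J z)) ≤
      (ENNReal.ofReal (1 + δ) ^ 1 * ENNReal.ofReal ((1 - δ)⁻¹) ^ (2 * m)) *
      ∫⁻ a : Fin k → ℂ, (μHE[2 * (m - k)] : Measure (Aff m)) {z | z ∈ B ∧ f z = a} := by
  set K := ENNReal.ofReal ((1 - δ)⁻¹) with hK
  set S := (fun z => (f z, (Φ z).2)) '' B with hS
  -- Replacing the first adapted coordinate $Lz$ by $f(z)$ gives a perturbation of the identity that
  -- straightens the level sets of $f$.
  set χ : Aff m → Aff m := fun z => Φ.symm (f z, (Φ z).2) with hχ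
  have hχsub : ∀ x y, χ x - χ y = (x - y) + Φ.symm (f x - f y - L (x - y), 0) := by
    intro x y
    simp only [hχ]
    rw [← map_sub, ContinuousLinearEquiv.symm_apply_eq, map_add,
      ContinuousLinearEquiv.apply_symm_apply]
    refine Prod.ext ?_ ?_
    · simp [hΦ.fst]
    · simp
  have hlow : ∀ x ∈ B, ∀ y ∈ B, (1 - δ) * ‖x - y‖ ≤ ‖χ x - χ y‖ := by
    intro x hx y hy
    have h1 := norm_sub_le (χ x - χ y) (Φ.symm (f x - f y - L (x - y), 0))
    rw [hχsub, add_sub_cancel_right, ← hχsub] at h1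
    linarith [h x hx y hy]
  have hupp : ∀ x ∈ B, ∀ y ∈ B, ‖χ x - χ y‖ ≤ (1 + δ) * ‖x - y‖ := by
    intro x hx y hy
    rw [hχsub]
    refine (norm_add_le _ _).trans ?_
    linarith [h x hx y hy]
  have hinj : Set.InjOn (fun z => (f z, (Φ z).2)) B := by
    intro x hx y hy hxy
    have h1 := hlow x hx y hy
    have h2 : χ x = χ y := congrArg Φ.symm hxy
    rw [h2, sub_self, norm_zero] at h1
    have h0 : ‖x - y‖ = 0 :=
      le_antisymm (nonpos_of_mul_nonpos_right h1 (by linarith)) (norm_nonneg _)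
    exact sub_eq_zero.1 (norm_eq_zero.1 h0)
  have hSm : MeasurableSet S := hB.image_of_continuousOn_injOn
    (hf.prodMk (Continuous.continuousOn (by fun_prop))) hinj
  -- Fubini over the first factor: the slice of $S$ at $a$ is the projection to $\ker L$ of the
  -- level set $f=a$.
  have hprod : volume S = ∫⁻ a : Fin k → ℂ, volume
      ((fun x => (Φ x).2) '' {z | z ∈ B ∧ f z = a}) := by
    rw [Measure.volume_eq_prod, Measure.prod_apply hSm]
    refine lintegral_congr fun a => ?_
    congr 1
    ext t
    simp only [hS, Set.mem_preimage, Set.mem_image, Prod.mk.injEq, Set.mem_ofPred_eq]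
    constructor
    · rintro ⟨z, hz, h1, h2⟩; exact ⟨z, ⟨hz, h1⟩, h2⟩
    · rintro ⟨z, ⟨hz, h1⟩, h2⟩; exact ⟨z, hz, h1, h2⟩
  have hfib : ∀ a, volume ((fun x => (Φ x).2) '' {z | z ∈ B ∧ f z = a}) ≤
        (μHE[2 * (m - k)] : Measure (Aff m)) {z | z ∈ B ∧ f z = a} ∧
      (μHE[2 * (m - k)] : Measure (Aff m)) {z | z ∈ B ∧ f z = a} ≤
        K ^ (2 * (m - k)) * volume ((fun x => (Φ x).2) '' {z | z ∈ B ∧ f z = a}) :=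
    fun a => fibre_bounds hΦ hδ fun x hx y hy =>
      norm_sub_le_of_approx hΦ (hx.2.trans hy.2.symm) (h x hx.1 y hy.1)
  have hX1 : volume S ≤
      ∫⁻ a : Fin k → ℂ, (μHE[2 * (m - k)] : Measure (Aff m)) {z | z ∈ B ∧ f z = a} := by
    rw [hprod]; exact lintegral_mono fun a => (hfib a).1
  have hX2 : (∫⁻ a : Fin k → ℂ, (μHE[2 * (m - k)] : Measure (Aff m)) {z | z ∈ B ∧ f z = a}) ≤
      K ^ (2 * (m - k)) * volume S := by
    rw [hprod, ← lintegral_const_mul' _ _ (ENNReal.pow_ne_top ENNReal.ofReal_ne_top)]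
    exact lintegral_mono fun a => (hfib a).2
  have hSχ : volume S = ENNReal.ofReal (jac L) * volume (χ '' B) := by
    rw [← hΦ.volume_image, Set.image_image]
    congr 1
    exact Set.image_congr fun x _ => (by simp [hχ])
  have hχ1 : volume (χ '' B) ≤ ENNReal.ofReal (1 + δ) ^ (2 * m) * volume B := by
    rw [← euclideanHausdorffMeasure_aff]
    refine euclideanHausdorffMeasure_image_le
      (LipschitzOnWith.of_dist_le_mul fun x hx y hy => ?_) _
    rw [dist_eq_norm, dist_eq_norm, Real.coe_toNNReal _ (by linarith)]
    exact hupp x hx y hy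
  have hχ2 : volume B ≤ K ^ (2 * m) * volume (χ '' B) := by
    rw [← euclideanHausdorffMeasure_aff]
    refine le_euclideanHausdorffMeasure_image (fun x hx y hy => ?_) _
    rw [edist_dist, edist_dist]
    change _ ≤ ENNReal.ofReal _ * _
    rw [← ENNReal.ofReal_mul (inv_nonneg.2 (by linarith)), dist_eq_norm, dist_eq_norm]
    refine ENNReal.ofReal_le_ofReal ?_
    rw [inv_mul_eq_div, le_div_iff₀ (by linarith)]
    linarith [hlow x hx y hy]
  have hY1 : ENNReal.ofReal (jac L) * volume B ≤ K * ∫⁻ z in B, ENNReal.ofReal (J z) := by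
    rw [← lintegral_const_mul' _ _ ENNReal.ofReal_ne_top, ← setLIntegral_const]
    refine setLIntegral_mono' hB fun x hx => ?_
    rw [← ENNReal.ofReal_mul (inv_nonneg.2 (by linarith))]
    refine ENNReal.ofReal_le_ofReal ?_
    rw [inv_mul_eq_div, le_div_iff₀ (by linarith)]
    linarith [(hJ x hx).1]
  have hY2 : (∫⁻ z in B, ENNReal.ofReal (J z)) ≤
      ENNReal.ofReal (1 + δ) * (ENNReal.ofReal (jac L) * volume B) := by
    rw [← mul_assoc, ← ENNReal.ofReal_mul (by linarith), ← setLIntegral_const]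
    exact setLIntegral_mono' hB fun x hx => ENNReal.ofReal_le_ofReal (hJ x hx).2
  constructor
  · calc _ ≤ K ^ (2 * (m - k)) * volume S := hX2
      _ ≤ K ^ (2 * (m - k)) * (ENNReal.ofReal (jac L) *
          (ENNReal.ofReal (1 + δ) ^ (2 * m) * volume B)) := by rw [hSχ]; gcongr
      _ = K ^ (2 * (m - k)) * ENNReal.ofReal (1 + δ) ^ (2 * m) *
          (ENNReal.ofReal (jac L) * volume B) := by ring
      _ ≤ K ^ (2 * (m - k)) * ENNReal.ofReal (1 + δ) ^ (2 * m) *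
          (K * ∫⁻ z in B, ENNReal.ofReal (J z)) := by gcongr
      _ = _ := by ring
  · calc _ ≤ ENNReal.ofReal (1 + δ) * (ENNReal.ofReal (jac L) * volume B) := hY2
      _ ≤ ENNReal.ofReal (1 + δ) * (ENNReal.ofReal (jac L) *
          (K ^ (2 * m) * volume (χ '' B))) := by gcongr
      _ = ENNReal.ofReal (1 + δ) * K ^ (2 * m) * volume S := by rw [hSχ]; ring
      _ ≤ _ := by rw [pow_one]; gcongr

section

variable {k m : ℕ} {f : Aff m → Fin k → ℂ} {f' : Aff m → (Aff m →L[ℂ] (Fin k → ℂ))}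
  {Ω : Set (Aff m)}

theorem isFamily_const (hΩ : IsOpen Ω) (hf' : ContinuousOn f' Ω)
    (hf : ∀ z ∈ Ω, HasFDerivAt f (f' z) z) :
    IsFamily (fun _ : Unit => f) (fun p => f' p.2) (Set.univ ×ˢ Ω) where
  isOpen := isOpen_univ.prod hΩ
  continuousOn := ContinuousOn.comp (g := f) (t := Ω)
    (fun z hz => (hf z hz).continuousAt.continuousWithinAt) continuousOn_snd fun _ hp => hp.2
  continuousOn_deriv := ContinuousOn.comp (g := f') (t := Ω) hf' continuousOn_snd fun _ hp => hp.2
  hasFDerivAt p hp := hf p.2 hp.2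

theorem isFamily_sub (hΩ : IsOpen Ω) (hf' : ContinuousOn f' Ω)
    (hf : ∀ z ∈ Ω, HasFDerivAt f (f' z) z) :
    IsFamily (fun (a : Fin k → ℂ) z => f z - a) (fun p => f' p.2) (Set.univ ×ˢ Ω) where
  isOpen := isOpen_univ.prod hΩ
  continuousOn := (ContinuousOn.comp (g := f) (t := Ω)
    (fun z hz => (hf z hz).continuousAt.continuousWithinAt) continuousOn_snd
      fun _ hp => hp.2).sub continuousOn_fst
  continuousOn_deriv := ContinuousOn.comp (g := f') (t := Ω) hf' continuousOn_snd fun _ hp => hp.2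
  hasFDerivAt p hp := (hf p.2 hp.2).sub_const _

/-- The inequalities on pieces are summed for fixed $\delta$; then $\delta\to0$ makes both constants
one. -/
theorem coarea_set (hΩ : IsOpen Ω) (hf' : ContinuousOn f' Ω)
    (hf : ∀ z ∈ Ω, HasFDerivAt f (f' z) z) {B : Set (Aff m)} (hB : MeasurableSet B)
    (hBΩ : ∀ z ∈ B, z ∈ Ω ∧ Function.Surjective (f' z)) :
    (∫⁻ a : Fin k → ℂ, (μHE[2 * (m - k)] : Measure (Aff m)) {z | z ∈ B ∧ f z = a}) =
      ∫⁻ z in B, ENNReal.ofReal (jac (f' z)) := by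
  have hF := isFamily_sub hΩ hf' hf
  have hfc : ContinuousOn f Ω := fun z hz => (hf z hz).continuousAt.continuousWithinAt
  have key : ∀ δ : ℝ, 0 < δ → δ < 1 →
      (∫⁻ a : Fin k → ℂ, (μHE[2 * (m - k)] : Measure (Aff m)) {z | z ∈ B ∧ f z = a}) ≤
      (ENNReal.ofReal ((1 - δ)⁻¹) ^ (2 * (m - k)) * ENNReal.ofReal (1 + δ) ^ (2 * m) *
        ENNReal.ofReal ((1 - δ)⁻¹) ^ 1) * ∫⁻ z in B, ENNReal.ofReal (jac (f' z)) ∧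
    (∫⁻ z in B, ENNReal.ofReal (jac (f' z))) ≤
      (ENNReal.ofReal (1 + δ) ^ 1 * ENNReal.ofReal ((1 - δ)⁻¹) ^ (2 * m)) *
      ∫⁻ a : Fin k → ℂ, (μHE[2 * (m - k)] : Measure (Aff m)) {z | z ∈ B ∧ f z = a} := by
    intro δ hδ0 hδ1
    obtain ⟨Q, hQ, hdisj, hU, hpiece⟩ := (isFamily_const hΩ hf' hf).exists_partition hδ0
    let Bi : ℕ → Set (Aff m) := fun i => B ∩ Prod.mk () ⁻¹' Q i
    have hBi : ∀ i, MeasurableSet (Bi i) := fun i => hB.inter (measurable_prodMk_left (hQ i))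
    have hBd : Pairwise (Function.onFun Disjoint Bi) := fun i j hij =>
      Set.disjoint_left.2 fun z hz hz' => Set.disjoint_left.1 (hdisj hij) hz.2 hz'.2
    have hBU : (⋃ i, Bi i) = B := by
      refine Set.Subset.antisymm (Set.iUnion_subset fun i => Set.inter_subset_left) fun z hz => ?_
      have : ((), z) ∈ ⋃ i, Q i := by
        rw [hU]; exact ⟨⟨trivial, (hBΩ z hz).1⟩, (hBΩ z hz).2⟩
      obtain ⟨i, hi⟩ := Set.mem_iUnion.1 this
      exact Set.mem_iUnion.2 ⟨i, hz, hi⟩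
    have hX : (∫⁻ a : Fin k → ℂ, (μHE[2 * (m - k)] : Measure (Aff m)) {z | z ∈ B ∧ f z = a}) =
        ∑' i, ∫⁻ a : Fin k → ℂ, (μHE[2 * (m - k)] : Measure (Aff m)) {z | z ∈ Bi i ∧ f z = a} := by
      have hsec : ∀ (C : Set (Aff m)) (a : Fin k → ℂ), {z | z ∈ C ∧ f z = a} =
          zsec (fun (a : Fin k → ℂ) z => f z - a) (Prod.snd ⁻¹' C) a := by
        intro C a
        ext z
        simp [zsec, sub_eq_zero]
      have hreg : ∀ C ⊆ B, Prod.snd ⁻¹' C ⊆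
          regSet (fun p : (Fin k → ℂ) × Aff m => f' p.2) (Set.univ ×ˢ Ω) :=
        fun C hC p hp => ⟨⟨trivial, (hBΩ _ (hC hp)).1⟩, (hBΩ _ (hC hp)).2⟩
      rw [← lintegral_tsum]
      · refine lintegral_congr fun a => ?_
        rw [← measure_iUnion]
        · congr 1
          ext z
          conv_lhs => rw [← hBU]
          simp only [Set.mem_ofPred_eq, Set.mem_iUnion]
          tauto
        · exact fun i j hij => Set.disjoint_left.2 fun z hz hz' =>
            Set.disjoint_left.1 (hBd hij) hz.1 hz'.1
        · intro i
          rw [hsec]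
          exact hF.measurableSet_zsec (measurable_snd (hBi i))
            (fun p hp => (hreg _ Set.inter_subset_left hp).1) a
      · intro i
        simp_rw [hsec]
        exact (hF.measurable_measure_zsec (measurable_snd (hBi i))
          (hreg _ Set.inter_subset_left)).aemeasurable
    have hY : (∫⁻ z in B, ENNReal.ofReal (jac (f' z))) =
        ∑' i, ∫⁻ z in Bi i, ENNReal.ofReal (jac (f' z)) := by
      rw [← lintegral_iUnion hBi hBd, hBU]
    have hp : ∀ i, (∫⁻ a : Fin k → ℂ, (μHE[2 * (m - k)] : Measure (Aff m))
          {z | z ∈ Bi i ∧ f z = a}) ≤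
      (ENNReal.ofReal ((1 - δ)⁻¹) ^ (2 * (m - k)) * ENNReal.ofReal (1 + δ) ^ (2 * m) *
        ENNReal.ofReal ((1 - δ)⁻¹) ^ 1) * ∫⁻ z in Bi i, ENNReal.ofReal (jac (f' z)) ∧
      (∫⁻ z in Bi i, ENNReal.ofReal (jac (f' z))) ≤
      (ENNReal.ofReal (1 + δ) ^ 1 * ENNReal.ofReal ((1 - δ)⁻¹) ^ (2 * m)) *
      ∫⁻ a : Fin k → ℂ, (μHE[2 * (m - k)] : Measure (Aff m)) {z | z ∈ Bi i ∧ f z = a} := by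
      intro i
      obtain h | ⟨L, Φ, hΦ, h1, -, h3⟩ := hpiece i
      · have : Bi i = ∅ := by simp [Bi, h]
        simp [this]
      · exact coarea_piece hΦ hδ0 hδ1 (hBi i) (hfc.mono fun z hz => (hBΩ z hz.1).1)
          (fun x hx y hy => h1 () x y hx.2 hy.2) fun x hx => h3 ((), x) hx.2
    rw [hX, hY, ← ENNReal.tsum_mul_left, ← ENNReal.tsum_mul_left]
    exact ⟨ENNReal.tsum_le_tsum fun i => (hp i).1, ENNReal.tsum_le_tsum fun i => (hp i).2⟩
  have t1 := tendsto_inv_one_sub_pow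
  have t2 : ∀ d : ℕ, Tendsto (fun δ : ℝ => ENNReal.ofReal (1 + δ) ^ d) (𝓝[>] 0) (𝓝 1) :=
    fun d => tendsto_ofReal_pow_one (g := fun δ : ℝ => 1 + δ)
      (continuousAt_const.add continuousAt_id) (by simp) d
  have hmul : ∀ {u v : ℝ → ENNReal}, Tendsto u (𝓝[>] 0) (𝓝 1) → Tendsto v (𝓝[>] 0) (𝓝 1) →
      Tendsto (fun δ => u δ * v δ) (𝓝[>] 0) (𝓝 1) := fun hu hv => by
    simpa using ENNReal.Tendsto.mul hu (Or.inl one_ne_zero) hv (Or.inl one_ne_zero)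
  exact le_antisymm
    (ennreal_le_of_forall_le_mul (hmul (hmul (t1 _) (t2 _)) (t1 1)) fun δ h0 h1 => (key δ h0 h1).1)
    (ennreal_le_of_forall_le_mul (hmul (t2 1) (t1 _)) fun δ h0 h1 => (key δ h0 h1).2)

/-- The coarea formula. -/
theorem coarea (hΩ : IsOpen Ω) (hf' : ContinuousOn f' Ω)
    (hf : ∀ z ∈ Ω, HasFDerivAt f (f' z) z) {g : Aff m → ENNReal} (hg : Measurable g) :
    (∫⁻ a : Fin k → ℂ, ∫⁻ z, g z ∂((isFamily_sub hΩ hf' hf).kernel a)) =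
      ∫⁻ z in Ω, ENNReal.ofReal (jac (f' z)) * g z := by
  set hF := isFamily_sub hΩ hf' hf
  set Ω' : Set (Aff m) := {z | z ∈ Ω ∧ Function.Surjective (f' z)} with hΩ'
  have hΩ'm : MeasurableSet Ω' := by
    have := (isFamily_const hΩ hf' hf).isOpen_regSet
    have h2 := measurable_prodMk_left (x := ()) this.measurableSet
    convert h2 using 1
    ext z
    simp [regSet, Ω']
  have hjm : AEMeasurable (fun z => ENNReal.ofReal (jac (f' z))) (volume.restrict Ω) :=
    ((continuous_jac.comp_continuousOn hf').aemeasurable hΩ.measurableSet).ennreal_ofReal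
  -- The formula becomes an identity of measures. Critical points are excluded from the kernel and
  -- have zero Jacobian, so they contribute to neither side and Sard's theorem plays no role.
  have hν : (volume : Measure (Fin k → ℂ)).bind hF.kernel =
      (volume.restrict Ω).withDensity fun z => ENNReal.ofReal (jac (f' z)) := by
    ext A hA
    rw [Measure.bind_apply hA hF.kernel.measurable.aemeasurable, withDensity_apply _ hA,
      Measure.restrict_restrict hA]
    have h1 := coarea_set hΩ hf' hf (hA.inter hΩ'm) (fun z hz => hz.2)
    have h2 : (∫⁻ z in A ∩ Ω, ENNReal.ofReal (jac (f' z))) =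
        ∫⁻ z in A ∩ Ω', ENNReal.ofReal (jac (f' z)) := by
      have hsub : A ∩ Ω' ⊆ A ∩ Ω := fun z hz => ⟨hz.1, hz.2.1⟩
      rw [← lintegral_inter_add_sdiff (fun z => ENNReal.ofReal (jac (f' z))) (A ∩ Ω)
        (hA.inter hΩ'm), Set.inter_eq_self_of_subset_right hsub]
      have h0 : (∫⁻ z in (A ∩ Ω) \ (A ∩ Ω'), ENNReal.ofReal (jac (f' z))) = 0 := by
        rw [setLIntegral_congr_fun (g := fun _ => 0)
          ((hA.inter hΩ.measurableSet).diff (hA.inter hΩ'm)), lintegral_zero]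
        intro z hz
        have : ¬ Function.Surjective (f' z) := fun hs => hz.2 ⟨hz.1.1, hz.1.2, hs⟩
        simp [jac_eq_zero this]
      rw [h0, add_zero]
    rw [h2, ← h1]
    refine lintegral_congr fun a => ?_
    rw [hF.kernel_apply, Measure.restrict_apply hA]
    congr 1
    ext z
    simp only [zsec, regSet, Ω', Set.mem_inter_iff, Set.mem_ofPred_eq, Set.mem_prod, Set.mem_univ,
      true_and, sub_eq_zero]
    tauto
  rw [← Measure.lintegral_bind hF.kernel.measurable.aemeasurable hg.aemeasurable, hν,
    lintegral_withDensity_eq_lintegral_mul₀ hjm hg.aemeasurable]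
  rfl

end

end ShortRange

end

/-! ### Complex Gaussian vectors through their characteristic functions. -/

noncomputable section

open Filter Topology MeasureTheory ProbabilityTheory
open scoped Matrix

namespace ShortRange

theorem lintegral_pi_succ {α : Type*} [MeasurableSpace α] (μ : Measure α) [SigmaFinite μ] {n : ℕ}
    {F : (Fin (n + 1) → α) → ENNReal} (hF : Measurable F) :
    ∫⁻ x, F x ∂(Measure.pi fun _ : Fin (n + 1) => μ) =
      ∫⁻ a, ∫⁻ y, F (Fin.cons a y) ∂(Measure.pi fun _ : Fin n => μ) ∂μ := by
  have h := (measurePreserving_piFinSuccAbove (fun _ : Fin (n + 1) => μ) 0).symm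
  have hm := hF.comp h.measurable
  simp only [Function.comp_def] at hm
  rw [← h.lintegral_comp hF, lintegral_prod _ hm.aemeasurable]
  simp [MeasurableEquiv.piFinSuccAbove, Fin.insertNthEquiv, Fin.insertNth_zero']

theorem lintegral_pi_prod {α : Type*} [MeasurableSpace α] (μ : Measure α) [SigmaFinite μ] {n : ℕ}
    {f : Fin n → α → ENNReal} (hf : ∀ i, Measurable (f i)) :
    ∫⁻ x, ∏ i, f i (x i) ∂(Measure.pi fun _ : Fin n => μ) = ∏ i, ∫⁻ a, f i a ∂μ := by
  induction n with
  | zero => simp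
  | succ n ih =>
    have hm : Measurable fun x : Fin (n + 1) → α => ∏ i, f i (x i) :=
      Finset.measurable_fun_prod _ fun i _ => (hf i).comp (measurable_pi_apply i)
    have hm' : Measurable fun x : Fin n → α => ∏ i : Fin n, f i.succ (x i) :=
      Finset.measurable_fun_prod _ fun i _ => (hf i.succ).comp (measurable_pi_apply i)
    rw [lintegral_pi_succ μ hm, Fin.prod_univ_succ]
    simp only [Fin.prod_univ_succ, Fin.cons_zero, Fin.cons_succ]
    rw [← lintegral_mul_const _ (hf 0)]
    refine lintegral_congr fun a => ?_
    rw [lintegral_const_mul _ hm', ih fun i => hf i.succ]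

theorem pi_withDensity {α : Type*} [MeasurableSpace α] (μ : Measure α) [SigmaFinite μ] {n : ℕ}
    {f : α → ENNReal} (hf : Measurable f) [SigmaFinite (μ.withDensity f)] :
    (Measure.pi fun _ : Fin n => μ.withDensity f) =
      (Measure.pi fun _ : Fin n => μ).withDensity fun x => ∏ i, f (x i) := by
  refine Measure.pi_eq fun s hs => ?_
  rw [withDensity_apply _ (MeasurableSet.univ_pi hs), ← lintegral_indicator (MeasurableSet.univ_pi hs)]
  have : ∀ x : Fin n → α, (Set.univ.pi s).indicator (fun x => ∏ i, f (x i)) x =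
      ∏ i, (s i).indicator f (x i) := by
    intro x
    by_cases hx : x ∈ Set.univ.pi s
    · rw [Set.indicator_of_mem hx]
      exact Finset.prod_congr rfl fun i _ => (Set.indicator_of_mem (hx i trivial) f).symm
    · rw [Set.indicator_of_notMem hx]
      simp only [Set.mem_pi, Set.mem_univ, true_implies, not_forall] at hx
      obtain ⟨i, hi⟩ := hx
      exact (Finset.prod_eq_zero (Finset.mem_univ i) (Set.indicator_of_notMem hi f)).symm
  simp_rw [this]
  rw [lintegral_pi_prod μ fun i => hf.indicator (hs i)]
  refine Finset.prod_congr rfl fun i _ => ?_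
  rw [lintegral_indicator (hs i), withDensity_apply _ (hs i)]

theorem pi_smul {α : Type*} [MeasurableSpace α] (μ : Measure α) [SigmaFinite μ] {n : ℕ}
    {r : ENNReal} [SigmaFinite (r • μ)] :
    (Measure.pi fun _ : Fin n => r • μ) = r ^ n • Measure.pi fun _ : Fin n => μ := by
  refine Measure.pi_eq fun s hs => ?_
  simp [Finset.prod_mul_distrib]

/-! ### The standard complex Gaussian -/

theorem integral_gaussian_cexp {b : ℝ} (hb : 0 < b) (c w : ℂ) :
    ∫ v : ℂ, Complex.exp (-b * ‖v‖ ^ 2 + c * (star w * v).re) =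
      Real.pi / b * Complex.exp (c ^ 2 * ‖w‖ ^ 2 / (4 * b)) := by
  have h := GaussianFourier.integral_cexp_neg_mul_sq_norm_add (V := ℂ) (b := (b : ℂ))
    (by simpa using hb) c w
  have h2 : ∀ v : ℂ, (inner ℝ w v : ℝ) = (star w * v).re := fun v => by
    rw [Complex.inner, Complex.star_def, mul_comm]
  simp only [h2, Complex.finrank_real_complex] at h
  rw [h]
  norm_num

theorem measurable_gaussian_density :
    Measurable fun c : ℂ => ENNReal.ofReal (Real.exp (-‖c‖ ^ 2) / Real.pi) := by
  fun_prop

theorem integral_stdGaussian (f : ℂ → ℂ) :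
    ∫ c, f c ∂stdGaussian = ∫ c, (Real.exp (-‖c‖ ^ 2) / Real.pi : ℝ) * f c := by
  rw [stdGaussian, integral_withDensity_eq_integral_toReal_smul measurable_gaussian_density
    (Eventually.of_forall fun _ => ENNReal.ofReal_lt_top)]
  refine integral_congr_ae (Eventually.of_forall fun c => ?_)
  simp only [ENNReal.toReal_ofReal (show 0 ≤ Real.exp (-‖c‖ ^ 2) / Real.pi by positivity)]
  rw [Complex.real_smul]

instance isProbabilityMeasure_stdGaussian : IsProbabilityMeasure stdGaussian := by
  constructor
  rw [stdGaussian, withDensity_apply _ MeasurableSet.univ, Measure.restrict_univ]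
  have h := GaussianFourier.integral_rexp_neg_mul_sq_norm (V := ℂ) (b := 1) one_pos
  rw [Complex.finrank_real_complex] at h
  have hi : Integrable fun c : ℂ => Real.exp (-‖c‖ ^ 2) := by
    by_contra hn
    have := integral_undef hn
    simp only [neg_mul, one_mul] at h
    rw [this] at h
    norm_num at h
    exact Real.pi_ne_zero h.symm
  rw [← ofReal_integral_eq_lintegral_ofReal (hi.div_const _)
    (Eventually.of_forall fun c => by positivity), integral_div]
  simp only [neg_mul, one_mul] at h
  rw [h]
  norm_num

/-- The parameter `c` is complex to serve two purposes: $c=i$ gives characteristic functions, and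
$c=-1$ gives the Laplace transform needed for tilted Gaussians. -/
theorem integral_stdGaussian_cexp {β : ℝ} (hβ : 0 ≤ β) (c w : ℂ) :
    ∫ ξ, Complex.exp (-β * ‖ξ‖ ^ 2 + c * (star w * ξ).re) ∂stdGaussian =
      (1 + β : ℂ)⁻¹ * Complex.exp (c ^ 2 * ‖w‖ ^ 2 / (4 * (1 + β))) := by
  rw [integral_stdGaussian]
  have h := integral_gaussian_cexp (b := 1 + β) (by linarith) c w
  have h2 : ∀ ξ : ℂ, ((Real.exp (-‖ξ‖ ^ 2) / Real.pi : ℝ) : ℂ) *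
      Complex.exp (-β * ‖ξ‖ ^ 2 + c * (star w * ξ).re) =
      (Real.pi : ℂ)⁻¹ * Complex.exp (-(1 + β : ℝ) * ‖ξ‖ ^ 2 + c * (star w * ξ).re) := by
    intro ξ
    push_cast
    rw [div_eq_inv_mul, mul_assoc, ← Complex.exp_add]
    congr 2
    ring
  simp_rw [h2]
  rw [integral_const_mul, h]
  have : (Real.pi : ℂ) ≠ 0 := by exact_mod_cast Real.pi_ne_zero
  push_cast
  field_simp

/-- The law of a family of independent standard complex Gaussians. -/
abbrev gauss (I : Type*) [Fintype I] : Measure (I → ℂ) := Measure.pi fun _ => stdGaussian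

section

variable {I J : Type*} [Fintype I] [Fintype J]

/-- The factor $1/4$ reflects that real and imaginary parts of a standard complex Gaussian each have
variance $1/2$. -/
theorem gauss_cf (w : I → ℂ) :
    ∫ c, Complex.exp (Complex.I * (star w ⬝ᵥ c).re) ∂(gauss I) =
      Complex.exp (-(star w ⬝ᵥ w) / 4) := by
  have h1 : ∀ c : I → ℂ, Complex.exp (Complex.I * (star w ⬝ᵥ c).re) =
      ∏ i, Complex.exp (Complex.I * (star (w i) * c i).re) := by
    intro c
    rw [← Complex.exp_sum, ← Finset.mul_sum, ← Complex.ofReal_sum]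
    simp [dotProduct]
  simp_rw [h1]
  rw [integral_fintype_prod_eq_prod
    (fun i c => Complex.exp (Complex.I * (star (w i) * c).re))]
  have h2 : ∀ i, ∫ c, Complex.exp (Complex.I * (star (w i) * c).re) ∂stdGaussian =
      Complex.exp (-(star (w i) * w i) / 4) := by
    intro i
    have := integral_stdGaussian_cexp le_rfl Complex.I (w i)
    simp only [Complex.ofReal_zero, neg_zero, zero_mul, zero_add, add_zero, inv_one, one_mul,
      mul_one, Complex.I_sq] at this
    rw [this, Complex.star_def, Complex.conj_mul']
    congr 1
    ring
  simp_rw [h2]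
  rw [← Complex.exp_sum]
  congr 1
  simp only [dotProduct, Pi.star_apply]
  rw [← Finset.sum_neg_distrib, Finset.sum_div]

theorem dual_eq_re [DecidableEq J] (L : StrongDual ℝ (J → ℂ)) :
    ∃ v : J → ℂ, ∀ x, L x = (star v ⬝ᵥ x).re := by
  refine ⟨fun j => (L (Pi.single j 1) : ℂ) + L (Pi.single j Complex.I) * Complex.I, fun x => ?_⟩
  have hx : x = ∑ j, ((x j).re • (Pi.single j 1 : J → ℂ) +
      (x j).im • (Pi.single j Complex.I : J → ℂ)) := by
    ext i
    rw [Finset.sum_apply, Finset.sum_eq_single i]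
    · simp [Complex.re_add_im]
    · intro j _ hj
      simp [Pi.single_eq_of_ne hj.symm]
    · simp
  conv_lhs => rw [hx]
  rw [map_sum, dotProduct, Complex.re_sum]
  refine Finset.sum_congr rfl fun j _ => ?_
  simp [mul_comm]

/-- Every real linear functional on $\mathbb C^J$ is the real part of a Hermitian pairing, so these
exponentials are all the characters. -/
theorem ext_of_cf {μ ν : Measure (J → ℂ)} [IsFiniteMeasure μ] [IsFiniteMeasure ν]
    (h : ∀ v : J → ℂ, ∫ x, Complex.exp (Complex.I * (star v ⬝ᵥ x).re) ∂μ =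
      ∫ x, Complex.exp (Complex.I * (star v ⬝ᵥ x).re) ∂ν) : μ = ν := by
  classical
  refine Measure.ext_of_charFunDual (funext fun L => ?_)
  obtain ⟨v, hv⟩ := dual_eq_re L
  rw [charFunDual_apply, charFunDual_apply]
  simp_rw [hv, mul_comm _ Complex.I]
  exact h v

theorem measurable_mulVec (T : Matrix J I ℂ) : Measurable fun c : I → ℂ => T *ᵥ c :=
  (Continuous.matrix_mulVec continuous_const continuous_id).measurable

theorem star_dotProduct_mulVec (v : J → ℂ) (T : Matrix J I ℂ) (c : I → ℂ) :
    star v ⬝ᵥ T *ᵥ c = star (Tᴴ *ᵥ v) ⬝ᵥ c := by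
  rw [Matrix.star_mulVec, Matrix.conjTranspose_conjTranspose, Matrix.dotProduct_mulVec]

theorem continuous_cf (v : J → ℂ) :
    Continuous fun x : J → ℂ => Complex.exp (Complex.I * (star v ⬝ᵥ x).re) := by
  simp only [dotProduct]
  fun_prop

theorem gauss_map_cf (T : Matrix J I ℂ) (v : J → ℂ) :
    ∫ x, Complex.exp (Complex.I * (star v ⬝ᵥ x).re) ∂((gauss I).map (T *ᵥ ·)) =
      Complex.exp (-(star v ⬝ᵥ (T * Tᴴ) *ᵥ v) / 4) := by
  rw [integral_map (measurable_mulVec T).aemeasurable (continuous_cf v).aestronglyMeasurable]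
  simp_rw [star_dotProduct_mulVec v T]
  rw [gauss_cf, ← star_dotProduct_mulVec, Matrix.mulVec_mulVec]

/-- Adding an independent Gaussian multiple of `v`. -/
theorem gauss_map_add {I' : Type*} [Fintype I'] (T : Matrix J I ℂ) (v : J → ℂ)
    (T' : Matrix J I' ℂ) (h : T * Tᴴ + Matrix.vecMulVec v (star v) = T' * T'ᴴ) :
    ((gauss I).prod stdGaussian).map (fun p => T *ᵥ p.1 + p.2 • v) = (gauss I').map (T' *ᵥ ·) := by
  have hm : Measurable fun p : (I → ℂ) × ℂ => T *ᵥ p.1 + p.2 • v :=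
    ((measurable_mulVec T).comp measurable_fst).add (measurable_snd.smul_const v)
  have := Measure.isProbabilityMeasure_map (μ := (gauss I).prod stdGaussian) hm.aemeasurable
  have := Measure.isProbabilityMeasure_map (μ := gauss I') (measurable_mulVec T').aemeasurable
  refine ext_of_cf fun w => ?_
  rw [gauss_map_cf, integral_map hm.aemeasurable (continuous_cf w).aestronglyMeasurable]
  have h1 : ∀ p : (I → ℂ) × ℂ, Complex.exp (Complex.I * (star w ⬝ᵥ (T *ᵥ p.1 + p.2 • v)).re) =
      Complex.exp (Complex.I * (star (Tᴴ *ᵥ w) ⬝ᵥ p.1).re) *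
      Complex.exp (-(0 : ℝ) * ‖p.2‖ ^ 2 + Complex.I * (star (star v ⬝ᵥ w) * p.2).re) := by
    intro p
    have h2 : star w ⬝ᵥ p.2 • v = star (star v ⬝ᵥ w) * p.2 := by
      rw [dotProduct_smul, smul_eq_mul, mul_comm, Matrix.star_dotProduct]
    rw [dotProduct_add, star_dotProduct_mulVec, h2, ← Complex.exp_add, Complex.add_re]
    congr 1
    push_cast
    ring
  simp_rw [h1]
  rw [integral_prod_mul (μ := gauss I) (ν := stdGaussian)
    (fun c : I → ℂ => Complex.exp (Complex.I * (star (Tᴴ *ᵥ w) ⬝ᵥ c).re))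
    (fun a : ℂ => Complex.exp (-(0 : ℝ) * ‖a‖ ^ 2 +
      Complex.I * (star (star v ⬝ᵥ w) * a).re)), gauss_cf,
    integral_stdGaussian_cexp le_rfl, ← h, ← star_dotProduct_mulVec]
  simp only [Complex.ofReal_zero, add_zero, inv_one, one_mul, mul_one, Complex.I_sq]
  rw [← Complex.exp_add, Matrix.add_mulVec, dotProduct_add, Matrix.mulVec_mulVec,
    Matrix.vecMulVec_mulVec, ← Complex.conj_mul' (star v ⬝ᵥ w), ← Complex.star_def]
  congr 1
  have h3 : star (star v ⬝ᵥ w) = star w ⬝ᵥ v := by rw [Matrix.star_dotProduct, star_star]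
  rw [h3]
  simp only [dotProduct_smul, MulOpposite.smul_eq_mul_unop, MulOpposite.unop_op]
  ring

/-- A Gaussian with a rank one perturbation of its covariance. -/
theorem gauss_map_tilt [DecidableEq I] {I' : Type*} [Fintype I'] (b : I → ℂ) {β : ℝ}
    (hβ : (β : ℂ) = b ⬝ᵥ star b) (T : Matrix J I ℂ) (T' : Matrix J I' ℂ)
    (h : T * (1 - ((1 + β : ℂ)⁻¹) • Matrix.vecMulVec (star b) b) * Tᴴ = T' * T'ᴴ) :
    ((gauss I).withDensity fun c => ENNReal.ofReal (Real.exp (-‖b ⬝ᵥ c‖ ^ 2))).map (T *ᵥ ·) =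
      ENNReal.ofReal ((1 + β)⁻¹) • (gauss I').map (T' *ᵥ ·) := by
  have hb0 : 0 ≤ β := by
    have h1 : (β : ℂ) = ((∑ i, ‖b i‖ ^ 2 : ℝ) : ℂ) := by
      rw [hβ]
      push_cast
      exact Finset.sum_congr rfl fun i _ => by
        rw [Pi.star_apply, Complex.star_def, Complex.mul_conj']
    rw [Complex.ofReal_inj.1 h1]
    positivity
  have hbc : Continuous fun c : I → ℂ => b ⬝ᵥ c := by simp only [dotProduct]; fun_prop
  have hdens : Measurable fun c : I → ℂ => ENNReal.ofReal (Real.exp (-‖b ⬝ᵥ c‖ ^ 2)) :=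
    (Real.continuous_exp.comp (hbc.norm.pow 2).neg).measurable.ennreal_ofReal
  have hfin : IsFiniteMeasure
      ((gauss I).withDensity fun c => ENNReal.ofReal (Real.exp (-‖b ⬝ᵥ c‖ ^ 2))) := by
    refine isFiniteMeasure_withDensity (ne_of_lt ?_)
    refine lt_of_le_of_lt (lintegral_mono (g := fun _ => 1) fun c => ?_) (by simp)
    rw [← ENNReal.ofReal_one]
    exact ENNReal.ofReal_le_ofReal (Real.exp_le_one_iff.2 (by simp))
  have := Measure.isProbabilityMeasure_map (μ := gauss I') (measurable_mulVec T').aemeasurable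
  have : IsFiniteMeasure (ENNReal.ofReal ((1 + β)⁻¹) • (gauss I').map (T' *ᵥ ·)) :=
    Measure.smul_finite _ ENNReal.ofReal_ne_top
  refine ext_of_cf fun v => ?_
  rw [integral_smul_measure, gauss_map_cf, integral_map (measurable_mulVec T).aemeasurable
    (continuous_cf v).aestronglyMeasurable, integral_withDensity_eq_integral_toReal_smul hdens
    (Eventually.of_forall fun _ => ENNReal.ofReal_lt_top)]
  simp only [star_dotProduct_mulVec v T, ENNReal.toReal_ofReal (Real.exp_pos _).le]
  set w := Tᴴ *ᵥ v with hw
  -- The weight $e^{-|b\cdot c|^2}$ is the characteristic function of an auxiliary Gaussian $\xi$ at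
  -- $2\,b\cdot c$. After exchanging the integrals, the one over $c$ is a plain Gaussian
  -- characteristic function and the one over $\xi$ a Gaussian integral with quadratic coefficient
  -- $1+\beta$.
  have h1 : ∀ c : I → ℂ, Real.exp (-‖b ⬝ᵥ c‖ ^ 2) • Complex.exp (Complex.I * (star w ⬝ᵥ c).re) =
      ∫ ξ, Complex.exp (Complex.I * (star (w + (2 * ξ) • star b) ⬝ᵥ c).re) ∂stdGaussian := by
    intro c
    have h2 := integral_stdGaussian_cexp le_rfl Complex.I (2 * b ⬝ᵥ c)
    have h3 : ∀ ξ : ℂ, Complex.exp (Complex.I * (star (w + (2 * ξ) • star b) ⬝ᵥ c).re) =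
        Complex.exp (Complex.I * (star w ⬝ᵥ c).re) *
        Complex.exp (-(0 : ℝ) * ‖ξ‖ ^ 2 + Complex.I * (star (2 * b ⬝ᵥ c) * ξ).re) := by
      intro ξ
      have h4 : (star (w + (2 * ξ) • star b) ⬝ᵥ c).re =
          (star w ⬝ᵥ c).re + (star (2 * b ⬝ᵥ c) * ξ).re := by
        rw [star_add, add_dotProduct, star_smul, star_star, smul_dotProduct, Complex.add_re,
          add_right_inj, ← Complex.conj_re, smul_eq_mul, map_mul, Complex.star_def,
          Complex.conj_conj, map_mul]
        congr 1
        rw [map_ofNat]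
        ring
      rw [h4, ← Complex.exp_add]
      congr 1
      push_cast
      ring
    simp_rw [h3]
    rw [integral_const_mul, h2, Complex.real_smul, mul_comm]
    congr 1
    simp only [Complex.ofReal_zero, add_zero, inv_one, one_mul, mul_one, Complex.I_sq,
      Complex.ofReal_exp]
    congr 1
    rw [norm_mul]
    push_cast
    norm_num
    ring
  simp_rw [h1]
  rw [integral_integral_swap]
  · simp_rw [gauss_cf]
    have h5 : ∀ ξ : ℂ, Complex.exp (-(star (w + (2 * ξ) • star b) ⬝ᵥ (w + (2 * ξ) • star b)) / 4) =
        Complex.exp (-(star w ⬝ᵥ w) / 4) *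
        Complex.exp (-β * ‖ξ‖ ^ 2 + (-1) * (star (b ⬝ᵥ w) * ξ).re) := by
      intro ξ
      rw [← Complex.exp_add]
      congr 1
      have h6 : star w ⬝ᵥ star b = star (b ⬝ᵥ w) := by
        rw [Matrix.star_dotProduct_star, dotProduct_comm]
      have h7 : ((star (b ⬝ᵥ w) * ξ).re : ℂ) = (star (b ⬝ᵥ w) * ξ + star ξ * (b ⬝ᵥ w)) / 2 := by
        rw [Complex.re_eq_add_conj]
        simp [mul_comm]
      rw [h7, ← Complex.conj_mul', ← Complex.star_def]
      simp only [star_add, star_smul, star_star, add_dotProduct, dotProduct_add, smul_dotProduct,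
        dotProduct_smul, smul_eq_mul, h6, ← hβ, star_mul', star_ofNat]
      ring
    simp_rw [h5]
    rw [integral_const_mul, integral_stdGaussian_cexp hb0, ← h]
    have h8 : star v ⬝ᵥ (T * (1 - ((1 + β : ℂ)⁻¹) • Matrix.vecMulVec (star b) b) * Tᴴ) *ᵥ v =
        star w ⬝ᵥ w - (1 + β : ℂ)⁻¹ * (star (b ⬝ᵥ w) * (b ⬝ᵥ w)) := by
      have h6 : star w ⬝ᵥ star b = star (b ⬝ᵥ w) := by
        rw [Matrix.star_dotProduct_star, dotProduct_comm]
      rw [← Matrix.mulVec_mulVec, ← Matrix.mulVec_mulVec, ← hw, star_dotProduct_mulVec, ← hw,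
        Matrix.sub_mulVec, Matrix.one_mulVec, Matrix.smul_mulVec, Matrix.vecMulVec_mulVec,
        dotProduct_sub, dotProduct_smul]
      simp only [dotProduct_smul, MulOpposite.smul_eq_mul_unop, MulOpposite.unop_op, h6,
        smul_eq_mul]
    have hpos : (1 + β : ℂ) ≠ 0 := by
      have : (1 + β : ℝ) ≠ 0 := by positivity
      exact_mod_cast this
    rw [h8, ENNReal.toReal_ofReal (by positivity), Complex.real_smul, mul_left_comm,
      ← Complex.exp_add, ← Complex.conj_mul', ← Complex.star_def]
    congr 1
    · push_cast; rfl
    · congr 1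
      field_simp
      ring
  · refine Integrable.of_bound (C := 1) (Continuous.aestronglyMeasurable ?_)
      (Eventually.of_forall fun p => ?_)
    · simp only [dotProduct, Pi.star_apply, Pi.add_apply, Pi.smul_apply]
      fun_prop
    · simp [Function.uncurry, Complex.norm_exp]

end

end ShortRange

end

/-! ### Linear algebra of the Fubini–Study metric. -/

noncomputable section

open Filter Topology MeasureTheory ProbabilityTheory
open scoped Matrix ComplexOrder

namespace ShortRange

/-- The matrix of the dual Fubini–Study metric. -/
def fsDual {m : ℕ} (z : Aff m) : Matrix (Fin m) (Fin m) ℂ :=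
  (1 + (‖z‖ : ℂ) ^ 2) • (1 + Matrix.vecMulVec z.ofLp (star z.ofLp))

/-- The transposed matrix of the Fubini–Study metric. -/
def fsMat {m : ℕ} (z : Aff m) : Matrix (Fin m) (Fin m) ℂ :=
  ((1 + (‖z‖ : ℂ) ^ 2) ^ 2)⁻¹ • ((1 + (‖z‖ : ℂ) ^ 2) • 1 - Matrix.vecMulVec z.ofLp (star z.ofLp))

theorem one_add_norm_sq_ne_zero {m : ℕ} (z : Aff m) : (1 + (‖z‖ : ℂ) ^ 2) ≠ 0 := by
  have : (1 + ‖z‖ ^ 2 : ℝ) ≠ 0 := by positivity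
  exact_mod_cast this

theorem star_dotProduct_self {m : ℕ} (z : Aff m) :
    star z.ofLp ⬝ᵥ z.ofLp = (‖z‖ : ℂ) ^ 2 := by
  rw [← Complex.ofReal_pow, EuclideanSpace.norm_sq_eq]
  push_cast
  exact Finset.sum_congr rfl fun i _ => by
    rw [Pi.star_apply, Complex.star_def, Complex.conj_mul']

/-- This is the Sherman–Morrison inverse of a rank-one perturbation of the identity, using
$(zz^*)^2=|z|^2zz^*$. -/
theorem fsMat_mul_fsDual {m : ℕ} (z : Aff m) : fsMat z * fsDual z = 1 := by
  have h := one_add_norm_sq_ne_zero z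
  have h2 : Matrix.vecMulVec z.ofLp (star z.ofLp) * Matrix.vecMulVec z.ofLp (star z.ofLp) =
      ((‖z‖ : ℂ) ^ 2) • Matrix.vecMulVec z.ofLp (star z.ofLp) := by
    rw [Matrix.vecMulVec_mul_vecMulVec, star_dotProduct_self, Matrix.vecMulVec_smul]
  rw [fsMat, fsDual, Matrix.smul_mul, Matrix.mul_smul, smul_smul, Matrix.sub_mul, Matrix.mul_add,
    Matrix.mul_add, h2, Matrix.mul_one, Matrix.mul_one, Matrix.smul_mul, Matrix.one_mul]
  ext i j
  simp only [Matrix.smul_apply, Matrix.sub_apply, Matrix.add_apply, smul_eq_mul]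
  field_simp
  ring

theorem posDef_fsDual {m : ℕ} (z : Aff m) : (fsDual z).PosDef := by
  rw [fsDual]
  refine Matrix.PosDef.smul (Matrix.PosDef.one.add_posSemidef
    (Matrix.posSemidef_vecMulVec_self_star _)) ?_
  have : (0 : ℝ) < 1 + ‖z‖ ^ 2 := by positivity
  exact_mod_cast this

theorem conjTranspose_fsMat {m : ℕ} (z : Aff m) : (fsMat z)ᴴ = fsMat z := by
  have h : fsMat z = (fsDual z)⁻¹ :=
    (Matrix.inv_eq_left_inv (fsMat_mul_fsDual z)).symm
  rw [h, Matrix.conjTranspose_nonsing_inv, (posDef_fsDual z).isHermitian.eq]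

/-- A form of Jacobi's complementary minor identity: the determinant of $G$ on $\ker L$ corresponds
to that of $H=G^{-1}$ on the quotient. With $R$ stacking $L$ on $QG$ and $W$ stacking $L$ on $Q$,
both $RW^*$ and $WHR^*$ are block triangular, and comparing their determinants gives the claim. The
conjugation comes from $\det R^*$ and disappears for Hermitian data. -/
theorem det_complementary {k d m : ℕ} (e : Fin k ⊕ Fin d ≃ Fin m)
    (L : Matrix (Fin k) (Fin m) ℂ) (Q : Matrix (Fin d) (Fin m) ℂ) (G H : Matrix (Fin m) (Fin m) ℂ)
    (hLQ : L * Qᴴ = 0) (hQ : Q * Qᴴ = 1) (hGH : G * H = 1) (hG : Gᴴ = G) :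
    star ((L * Lᴴ).det * (Q * G * Qᴴ).det) = G.det * (L * H * Lᴴ).det := by
  have hHG : H * G = 1 := mul_eq_one_comm.1 hGH
  set R := (Matrix.fromRows L (Q * G)).submatrix e.symm id with hR
  set W := (Matrix.fromRows L Q).submatrix e.symm id with hW
  have h1 : R * Wᴴ = (Matrix.fromBlocks (L * Lᴴ) 0 (Q * G * Lᴴ) (Q * G * Qᴴ)).submatrix
      e.symm e.symm := by
    rw [hR, hW, Matrix.conjTranspose_submatrix,
      Matrix.conjTranspose_fromRows_eq_fromCols_conjTranspose,
      ← Matrix.submatrix_mul _ _ _ _ _ Function.bijective_id, Matrix.fromRows_mul_fromCols, hLQ]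
  have h2 : W * H * Rᴴ = (Matrix.fromBlocks (L * H * Lᴴ) 0 (Q * H * Lᴴ) 1).submatrix
      e.symm e.symm := by
    have h3 : (Matrix.fromRows L Q).submatrix e.symm id * H =
        (Matrix.fromRows (L * H) (Q * H)).submatrix e.symm id := by
      rw [← Matrix.fromRows_mul]
      rfl
    have h4 : ∀ {r : ℕ} (A : Matrix (Fin r) (Fin m) ℂ), A * H * (Q * G)ᴴ = A * Qᴴ := by
      intro r A
      rw [Matrix.conjTranspose_mul, hG, ← Matrix.mul_assoc, Matrix.mul_assoc A, hHG, Matrix.mul_one]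
    rw [hR, hW, h3, Matrix.conjTranspose_submatrix,
      Matrix.conjTranspose_fromRows_eq_fromCols_conjTranspose,
      ← Matrix.submatrix_mul _ _ _ _ _ Function.bijective_id, Matrix.fromRows_mul_fromCols,
      h4, h4, hLQ, hQ]
  have d1 := congrArg Matrix.det h1
  have d2 := congrArg Matrix.det h2
  rw [Matrix.det_mul, Matrix.det_conjTranspose, Matrix.det_submatrix_equiv_self,
    Matrix.det_fromBlocks_zero₁₂] at d1
  rw [Matrix.det_mul, Matrix.det_mul, Matrix.det_conjTranspose, Matrix.det_submatrix_equiv_self,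
    Matrix.det_fromBlocks_zero₁₂, Matrix.det_one, mul_one] at d2
  have d3 : G.det * H.det = 1 := by rw [← Matrix.det_mul, hGH, Matrix.det_one]
  rw [← d1, ← d2, star_mul', star_star]
  linear_combination (-star R.det * W.det) * d3

/-- The Jacobian of a linear map with respect to the Fubini–Study metric at `z`. -/
def fsJac {k m : ℕ} (z : Aff m) (L : Aff m →L[ℂ] (Fin k → ℂ)) : ℝ :=
  (mat L * fsDual z * (mat L)ᴴ).det.re

theorem im_det_eq_zero {n : Type*} [Fintype n] [DecidableEq n] {A : Matrix n n ℂ} (hA : Aᴴ = A) :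
    A.det.im = 0 := by
  have := congrArg Matrix.det hA
  rw [Matrix.det_conjTranspose] at this
  exact Complex.conj_eq_iff_im.1 this

theorem fsMetric_eq {m : ℕ} (z u v : Aff m) :
    fsMetric z u v = star v.ofLp ⬝ᵥ (fsMat z *ᵥ u.ofLp) := by
  have hi : ∀ x y : Aff m, inner ℂ x y = star x.ofLp ⬝ᵥ y.ofLp := fun x y => by
    rw [EuclideanSpace.inner_eq_star_dotProduct, dotProduct_comm]
  rw [fsMetric, hi, hi, hi, fsMat, Matrix.smul_mulVec, Matrix.sub_mulVec, Matrix.smul_mulVec,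
    Matrix.one_mulVec, Matrix.vecMulVec_mulVec, dotProduct_smul, dotProduct_sub, dotProduct_smul,
    dotProduct_smul]
  simp only [smul_eq_mul, MulOpposite.smul_eq_mul_unop, MulOpposite.unop_op]
  rw [div_eq_inv_mul]
  ring

/-- The subspace is a separate variable so that the identity can be applied with $T=\top$ as well as
with a kernel. -/
theorem jac_mul_fsVolRatio_aux {k m : ℕ} (z : Aff m) (L : Aff m →L[ℂ] (Fin k → ℂ))
    (T : Submodule ℂ (Aff m)) (hT : T = LinearMap.ker L.toLinearMap)
    (hL : Function.Surjective L) :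
    jac L * fsVolRatio z T = (fsMat z).det.re * fsJac z L := by
  have hdim := LinearMap.finrank_range_add_finrank_ker L.toLinearMap
  rw [LinearMap.range_eq_top.2 hL, finrank_top, ← hT] at hdim
  simp only [Module.finrank_fintype_fun_eq_card, Fintype.card_fin, finrank_euclideanSpace] at hdim
  let e : Fin k ⊕ Fin (Module.finrank ℂ T) ≃ Fin m := finSumFinEquiv.trans (finCongr hdim)
  set b := stdOrthonormalBasis ℂ T
  set Q : Matrix (Fin (Module.finrank ℂ T)) (Fin m) ℂ :=
    Matrix.of fun t q => star ((b t : Aff m) q) with hQdef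
  have hMQ : mat L * Qᴴ = 0 := by
    ext j t
    have h0 : (b t : Aff m) ∈ LinearMap.ker L.toLinearMap := hT ▸ (b t).2
    have : L (b t : Aff m) j = 0 := congrFun h0 j
    rw [apply_eq_mat] at this
    simpa [Matrix.mul_apply, Q] using this
  have hQQ : Q * Qᴴ = 1 := by
    ext t t'
    have := orthonormal_iff_ite.1 b.orthonormal t t'
    rw [Submodule.coe_inner, PiLp.inner_apply] at this
    simpa [Matrix.mul_apply, Q, Matrix.one_apply, mul_comm] using this
  have hdet := det_complementary e (mat L) Q (fsMat z) (fsDual z) hMQ hQQ (fsMat_mul_fsDual z)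
    (conjTranspose_fsMat z)
  have hvol : fsVolRatio z T = (Q * fsMat z * Qᴴ).det.re := by
    rw [fsVolRatio, ← Matrix.det_transpose]
    congr 2
    ext i j
    rw [Matrix.transpose_apply, Matrix.of_apply, fsMetric_eq, Matrix.mul_assoc, Matrix.mul_apply]
    simp only [dotProduct]
    refine Finset.sum_congr rfl fun q _ => ?_
    simp [Q, b, Matrix.mul_apply, Matrix.mulVec, dotProduct]
  have i1 := im_det_eq_zero (A := mat L * (mat L)ᴴ) (by simp)
  have i2 := im_det_eq_zero (A := Q * fsMat z * Qᴴ) (by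
    simp [Matrix.conjTranspose_mul, conjTranspose_fsMat, Matrix.mul_assoc])
  have i3 := im_det_eq_zero (conjTranspose_fsMat z)
  have := congrArg Complex.re hdet
  rw [Complex.star_def, Complex.conj_re, Complex.mul_re, Complex.mul_re, i1, i3, zero_mul,
    zero_mul, sub_zero, sub_zero] at this
  rw [hvol]
  exact this

/-- The case $k=0$: the kernel of the zero map is everything and both Jacobians are empty
determinants. -/
theorem fsVolRatio_top {m : ℕ} (z : Aff m) : fsVolRatio z ⊤ = (fsMat z).det.re := by
  have := jac_mul_fsVolRatio_aux z (0 : Aff m →L[ℂ] (Fin 0 → ℂ)) ⊤ (by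
    ext x; simp) (fun y => ⟨0, Subsingleton.elim _ _⟩)
  simpa [jac, fsJac] using this

/-- The coarea factor `jac` times the volume ratio on the random tangent space becomes a
deterministic factor times `fsJac`, a polynomial in the derivative and its conjugate. This is what
makes the Kac–Rice expectation a Gaussian moment. -/
theorem jac_mul_fsVolRatio {k m : ℕ} (z : Aff m) {L : Aff m →L[ℂ] (Fin k → ℂ)}
    (hL : Function.Surjective L) :
    jac L * fsVolRatio z (LinearMap.ker L.toLinearMap) = fsVolRatio z ⊤ * fsJac z L := by
  rw [fsVolRatio_top]
  exact jac_mul_fsVolRatio_aux z L _ rfl hL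

theorem det_fsDual_pos {m : ℕ} (z : Aff m) : 0 < (fsDual z).det.re :=
  (Complex.lt_def.1 (posDef_fsDual z).det_pos).1

theorem fsVolRatio_top_eq_inv {m : ℕ} (z : Aff m) : fsVolRatio z ⊤ = ((fsDual z).det.re)⁻¹ := by
  rw [fsVolRatio_top]
  refine eq_inv_of_mul_eq_one_left ?_
  have d3 : (fsMat z).det * (fsDual z).det = 1 := by
    rw [← Matrix.det_mul, fsMat_mul_fsDual, Matrix.det_one]
  have i3 := im_det_eq_zero (conjTranspose_fsMat z)
  have := congrArg Complex.re d3
  rwa [Complex.mul_re, i3, zero_mul, sub_zero, Complex.one_re] at this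

theorem fsVolRatio_top_pos {m : ℕ} (z : Aff m) : 0 < fsVolRatio z ⊤ := by
  rw [fsVolRatio_top_eq_inv]
  exact inv_pos.2 (det_fsDual_pos z)

theorem continuous_fsDual {m : ℕ} : Continuous (fsDual : Aff m → Matrix (Fin m) (Fin m) ℂ) := by
  unfold fsDual
  have h1 : Continuous fun z : Aff m => (1 + (‖z‖ : ℂ) ^ 2) := by fun_prop
  have h2 : Continuous fun z : Aff m => z.ofLp := by fun_prop
  exact h1.smul (continuous_const.add (h2.matrix_vecMulVec h2.star))

theorem continuous_fsVolRatio_top {m : ℕ} : Continuous fun z : Aff m => fsVolRatio z ⊤ := by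
  simp_rw [fsVolRatio_top_eq_inv]
  exact (Complex.continuous_re.comp continuous_fsDual.matrix_det).inv₀ fun z =>
    (det_fsDual_pos z).ne'

theorem fsJac_nonneg {k m : ℕ} (z : Aff m) (L : Aff m →L[ℂ] (Fin k → ℂ)) : 0 ≤ fsJac z L :=
  (Complex.le_def.1 ((posDef_fsDual z).posSemidef.mul_mul_conjTranspose_same (mat L)).det_nonneg).1

/-- A left null vector of $MM^*$ already annihilates $M$, hence also $M H M^*$ for any $H$. -/
theorem fsJac_eq_zero {k m : ℕ} (z : Aff m) {L : Aff m →L[ℂ] (Fin k → ℂ)}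
    (hL : ¬ Function.Surjective L) : fsJac z L = 0 := by
  have h0 : (mat L * (mat L)ᴴ).det = 0 := by
    by_contra h
    exact hL (surjective_of_det_ne_zero h)
  obtain ⟨v, hv, hv0⟩ := Matrix.exists_vecMul_eq_zero_iff.2 h0
  have h1 : v ᵥ* mat L = 0 := by
    have h2 : (v ᵥ* mat L) ⬝ᵥ star (v ᵥ* mat L) = 0 := by
      rw [Matrix.star_vecMul, Matrix.dotProduct_mulVec, Matrix.vecMul_vecMul, hv0, zero_dotProduct]
    exact dotProduct_star_self_eq_zero.1 ((dotProduct_comm _ _).trans h2)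
  have : (mat L * fsDual z * (mat L)ᴴ).det = 0 := by
    refine Matrix.exists_vecMul_eq_zero_iff.1 ⟨v, hv, ?_⟩
    rw [← Matrix.vecMul_vecMul, ← Matrix.vecMul_vecMul, h1, Matrix.zero_vecMul, Matrix.zero_vecMul]
  simp [fsJac, this]

/-! ### Independent Gaussian rows. -/

section
variable {I : Type*} [Fintype I]

/-- The rows of `c` multiplied by the matrix `M`. -/
def rowMul {k : ℕ} (M : Matrix I I ℂ) (c : Fin k → I → ℂ) : Fin k → I → ℂ := fun j => M *ᵥ c j

/-- The law of `k` independent Gaussian rows. -/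
abbrev gaussRows (k : ℕ) (I : Type*) [Fintype I] : Measure (Fin k → I → ℂ) :=
  Measure.pi fun _ => gauss I

theorem measurable_rowMul {k : ℕ} (M : Matrix I I ℂ) :
    Measurable (rowMul M : (Fin k → I → ℂ) → _) :=
  measurable_pi_lambda _ fun j => (measurable_mulVec M).comp (measurable_pi_apply j)

theorem gaussRows_map {k : ℕ} (M : Matrix I I ℂ) :
    (gaussRows k I).map (rowMul M) = Measure.pi fun _ : Fin k => (gauss I).map (M *ᵥ ·) := by
  have := Measure.isProbabilityMeasure_map (μ := gauss I) (measurable_mulVec M).aemeasurable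
  exact Measure.pi_map_pi (μ := fun _ : Fin k => gauss I) (f := fun _ x => M *ᵥ x)
    fun _ => (measurable_mulVec M).aemeasurable

/-- Only covariances matter for centred Gaussians, so one coefficient direction `v` can be split off
in every row as an independent variable $a_j$; Kac–Rice then integrates over $a$. -/
theorem lintegral_rows_add {k : ℕ} {M M' : Matrix I I ℂ} {v : I → ℂ}
    (h : M * Mᴴ + Matrix.vecMulVec v (star v) = M' * M'ᴴ) {F : (Fin k → I → ℂ) → ENNReal}
    (hF : Measurable F) :
    ∫⁻ c, F (rowMul M' c) ∂(gaussRows k I) =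
      ∫⁻ c, ∫⁻ a, F (fun j => M *ᵥ c j + a j • v) ∂(Measure.pi fun _ : Fin k => stdGaussian)
        ∂(gaussRows k I) := by
  have hm : Measurable fun p : (I → ℂ) × ℂ => M *ᵥ p.1 + p.2 • v :=
    ((measurable_mulVec M).comp measurable_fst).add (measurable_snd.smul_const v)
  have hp := Measure.isProbabilityMeasure_map (μ := (gauss I).prod stdGaussian) hm.aemeasurable
  have h1 : (gaussRows k I).map (rowMul M') =
      (Measure.pi fun _ : Fin k => (gauss I).prod stdGaussian).map
        (fun p j => M *ᵥ (p j).1 + (p j).2 • v) := by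
    have h2 := Measure.pi_map_pi (μ := fun _ : Fin k => (gauss I).prod stdGaussian)
      (f := fun _ p => M *ᵥ p.1 + p.2 • v) fun _ => hm.aemeasurable
    rw [h2, gaussRows_map, gauss_map_add M v M' h]
  have h3 := (measurePreserving_arrowProdEquivProdArrow (I → ℂ) ℂ (Fin k) (fun _ => gauss I)
    (fun _ => stdGaussian)).symm
  have hm2 : Measurable fun (p : Fin k → (I → ℂ) × ℂ) j => M *ᵥ (p j).1 + (p j).2 • v :=
    measurable_pi_lambda _ fun j => hm.comp (measurable_pi_apply j)
  have hm3 : Measurable fun p : Fin k → (I → ℂ) × ℂ => F fun j => M *ᵥ (p j).1 + (p j).2 • v :=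
    hF.comp hm2
  rw [← lintegral_map hF (measurable_rowMul M'), h1, lintegral_map hF hm2, ← h3.map_eq,
    lintegral_map hm3 h3.measurable]
  exact lintegral_prod _ (hm3.comp h3.measurable).aemeasurable

theorem lintegral_rows_tilt [DecidableEq I] {k : ℕ} {b : I → ℂ} {β : ℝ}
    (hβ : (β : ℂ) = b ⬝ᵥ star b) {M M' : Matrix I I ℂ}
    (h : M * (1 - ((1 + β : ℂ)⁻¹) • Matrix.vecMulVec (star b) b) * Mᴴ = M' * M'ᴴ)
    {F : (Fin k → I → ℂ) → ENNReal} (hF : Measurable F) :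
    ∫⁻ c, (∏ j, ENNReal.ofReal (Real.exp (-‖b ⬝ᵥ c j‖ ^ 2))) * F (rowMul M c) ∂(gaussRows k I) =
      ENNReal.ofReal ((1 + β)⁻¹) ^ k * ∫⁻ c, F (rowMul M' c) ∂(gaussRows k I) := by
  have hbc : Continuous fun c : I → ℂ => b ⬝ᵥ c := by simp only [dotProduct]; fun_prop
  have hdens : Measurable fun c : I → ℂ => ENNReal.ofReal (Real.exp (-‖b ⬝ᵥ c‖ ^ 2)) :=
    (Real.continuous_exp.comp (hbc.norm.pow 2).neg).measurable.ennreal_ofReal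
  have hprod : Measurable fun c : Fin k → I → ℂ =>
      ∏ j, ENNReal.ofReal (Real.exp (-‖b ⬝ᵥ c j‖ ^ 2)) :=
    Finset.measurable_fun_prod _ fun j _ => hdens.comp (measurable_pi_apply j)
  have hp' := Measure.isProbabilityMeasure_map (μ := gauss I) (measurable_mulVec M').aemeasurable
  have htilt := gauss_map_tilt b hβ M M' h
  have hf1 : IsFiniteMeasure (ENNReal.ofReal ((1 + β)⁻¹) • (gauss I).map (M' *ᵥ ·)) :=
    Measure.smul_finite _ ENNReal.ofReal_ne_top
  have hf2 : IsFiniteMeasure (((gauss I).withDensity fun c =>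
      ENNReal.ofReal (Real.exp (-‖b ⬝ᵥ c‖ ^ 2))).map (M *ᵥ ·)) := by rw [htilt]; exact hf1
  have hsf : SigmaFinite ((gauss I).withDensity fun c =>
      ENNReal.ofReal (Real.exp (-‖b ⬝ᵥ c‖ ^ 2))) := SigmaFinite.withDensity_ofReal _
  have h1 := Measure.pi_map_pi (μ := fun _ : Fin k => (gauss I).withDensity fun c =>
      ENNReal.ofReal (Real.exp (-‖b ⬝ᵥ c‖ ^ 2))) (f := fun _ x => M *ᵥ x)
      fun _ => (measurable_mulVec M).aemeasurable
  calc _ = ∫⁻ c, F (rowMul M c) ∂((gaussRows k I).withDensity fun c =>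
        ∏ j, ENNReal.ofReal (Real.exp (-‖b ⬝ᵥ c j‖ ^ 2))) := by
        exact (lintegral_withDensity_eq_lintegral_mul _ hprod
          (hF.comp (measurable_rowMul M))).symm
    _ = ∫⁻ x, F x ∂(Measure.pi fun _ : Fin k => ((gauss I).withDensity fun c =>
        ENNReal.ofReal (Real.exp (-‖b ⬝ᵥ c‖ ^ 2))).map (M *ᵥ ·)) := by
        rw [← h1]
        refine Eq.trans ?_ (lintegral_map hF (measurable_rowMul M)).symm
        rw [pi_withDensity (gauss I) hdens]
    _ = _ := by
        rw [htilt, pi_smul, lintegral_smul_measure, ← gaussRows_map,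
          lintegral_map hF (measurable_rowMul M'), smul_eq_mul]

end

/-! ### Random fields spanned by finitely many functions. -/

section
variable {I : Type*} [Fintype I] {k m : ℕ}

/-- `k` linear combinations of the functions `φ`. -/
def fieldVal (φ : Aff m → I → ℂ) (c : Fin k → I → ℂ) (z : Aff m) : Fin k → ℂ :=
  fun j => φ z ⬝ᵥ c j

/-- The derivative of `fieldVal`. -/
def fieldDer (φ : Aff m → I → ℂ) (p : (Fin k → I → ℂ) × Aff m) : Aff m →L[ℂ] (Fin k → ℂ) :=
  ContinuousLinearMap.pi fun j => ∑ i, p.1 j i • fderiv ℂ (fun z => φ z i) p.2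

variable {φ : Aff m → I → ℂ}

theorem continuous_fieldDer (hφ : ∀ i, ContDiff ℂ 1 fun z => φ z i) :
    Continuous (fieldDer (k := k) φ) := by
  have h : ∀ i, Continuous (fderiv ℂ fun z => φ z i) := fun i =>
    (hφ i).continuous_fderiv one_ne_zero
  refine continuous_clm_apply.2 fun y => continuous_pi fun j => ?_
  have h2 : Continuous fun p : (Fin k → I → ℂ) × Aff m =>
      ∑ i, p.1 j i • fderiv ℂ (fun z => φ z i) p.2 := by fun_prop
  exact h2.clm_apply continuous_const

omit [Fintype I] in
theorem continuous_basis (hφ : ∀ i, ContDiff ℂ 1 fun z => φ z i) : Continuous φ :=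
  continuous_pi fun i => (hφ i).continuous

theorem isFamily_field (hφ : ∀ i, ContDiff ℂ 1 fun z => φ z i) :
    IsFamily (fieldVal (k := k) φ) (fieldDer φ) Set.univ where
  isOpen := isOpen_univ
  continuousOn := by
    have := continuous_basis hφ
    refine Continuous.continuousOn ?_
    unfold fieldVal dotProduct
    fun_prop
  continuousOn_deriv := (continuous_fieldDer hφ).continuousOn
  hasFDerivAt p _ := by
    refine hasFDerivAt_pi.2 fun j => ?_
    simp only [fieldVal, dotProduct]
    exact HasFDerivAt.fun_sum fun i _ =>
      (((hφ i).differentiable one_ne_zero p.2).hasFDerivAt.mul_const (p.1 j i))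

section
open Matrix
variable [DecidableEq I]

/-- Here $P-q^{-1}vp^*$ projects along $v$ onto coefficients whose field vanishes at the point, and
the tilt is the Gaussian weight left by eliminating the $v$-component. The resulting covariance is
that of the orthogonal projection $P-\rho^{-1}pp^*$, so the auxiliary direction $v$ drops out. -/
theorem tilt_matrix_identity {P : Matrix I I ℂ} (hP : Pᴴ = P) (hPP : P * P = P) {v p : I → ℂ}
    (hv : P *ᵥ v = v) (hp : P *ᵥ p = p) {q ρ : ℂ} (hq : star p ⬝ᵥ v = q) (hq0 : q ≠ 0)
    (hρ : star p ⬝ᵥ p = ρ) (hρ0 : ρ ≠ 0) (hρs : star ρ = ρ) :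
    (P - q⁻¹ • vecMulVec v (star p)) * (1 - (ρ / (q * star q))⁻¹ •
      vecMulVec (star (star v - q⁻¹ • star p)) (star v - q⁻¹ • star p)) *
        (P - q⁻¹ • vecMulVec v (star p))ᴴ =
    (P - ρ⁻¹ • vecMulVec p (star p)) * (P - ρ⁻¹ • vecMulVec p (star p))ᴴ := by
  have hv' : star v ᵥ* P = star v := by
    have := congrArg star hv
    rwa [star_mulVec, hP] at this
  have hp' : star p ᵥ* P = star p := by
    have := congrArg star hp
    rwa [star_mulVec, hP] at this
  have hq' : star v ⬝ᵥ p = star q := by rw [← hq, star_dotProduct]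
  have hsq0 : star q ≠ 0 := star_ne_zero.2 hq0
  simp only [conjTranspose_sub, conjTranspose_smul, conjTranspose_vecMulVec, hP, star_star,
    star_sub, star_smul, star_inv₀, hρs, vecMulVec_sub, sub_vecMulVec, smul_vecMulVec,
    vecMulVec_smul, Matrix.mul_sub, Matrix.sub_mul, Matrix.mul_one, Matrix.smul_mul,
    Matrix.mul_smul, hPP, mul_vecMulVec, vecMulVec_mul, hv, hp, hv', hp', hq, hρ, hq', smul_sub,
    smul_smul, sub_mulVec, Matrix.smul_mulVec, vecMulVec_mulVec, op_smul_eq_smul]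
  ext i j
  simp only [Matrix.sub_apply, Matrix.smul_apply, vecMulVec_apply, smul_eq_mul, Pi.star_apply]
  field_simp
  ring

end

end

end ShortRange

end

/-! ### The Kac–Rice formula at one point. -/

noncomputable section

open Filter Topology MeasureTheory ProbabilityTheory Matrix
open scoped Matrix ComplexOrder

namespace ShortRange

section
variable {I : Type*} [Fintype I] {k m : ℕ} {φ : Aff m → I → ℂ}

theorem jac_smul (r : ℂ) (L : Aff m →L[ℂ] (Fin k → ℂ)) :
    jac (r • L) = (‖r‖ ^ 2) ^ k * jac L := by
  have h : mat (r • L) = r • mat L := by ext i j; simp [mat]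
  rw [jac, jac, h, conjTranspose_smul, Matrix.smul_mul, Matrix.mul_smul, smul_smul, det_smul,
    Complex.star_def, Complex.mul_conj, Fintype.card_fin, ← Complex.ofReal_pow, Complex.re_ofReal_mul,
    Complex.normSq_eq_norm_sq]

theorem fieldDer_add_smul (c : Fin k → I → ℂ) (a : Fin k → ℂ) (v : I → ℂ) (z x : Aff m) (j : Fin k) :
    fieldDer φ (fun j => c j + a j • v, z) x j =
      fieldDer φ (c, z) x j + a j * ∑ i, v i * fderiv ℂ (fun z => φ z i) z x := by
  simp only [fieldDer, ContinuousLinearMap.coe_pi', _root_.sum_apply,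
    _root_.smul_apply, Pi.add_apply, Pi.smul_apply, smul_eq_mul, Finset.mul_sum,
    ← Finset.sum_add_distrib]
  exact Finset.sum_congr rfl fun i _ => by ring

/-- The coordinates of the solution of `fieldVal φ (c + a v) z = 0` in `a`. -/
def solve (φ : Aff m → I → ℂ) (c : Fin k → I → ℂ) (v : I → ℂ) (z : Aff m) : Fin k → ℂ :=
  fun j => -((φ z ⬝ᵥ c j) * (φ z ⬝ᵥ v)⁻¹)

/-- The zero sets of the perturbed fields $c+av$ are the level sets of one map, which brings in the
coarea formula. -/
theorem fieldVal_add_smul_eq_zero {c : Fin k → I → ℂ} {v : I → ℂ} {z : Aff m}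
    (hz : φ z ⬝ᵥ v ≠ 0) (a : Fin k → ℂ) :
    fieldVal φ (fun j => c j + a j • v) z = 0 ↔ solve φ c v z - a = 0 := by
  rw [funext_iff, sub_eq_zero, funext_iff]
  refine forall_congr' fun j => ?_
  simp only [fieldVal, solve, dotProduct_add, dotProduct_smul, smul_eq_mul, Pi.zero_apply]
  rw [← neg_mul, ← div_eq_mul_inv, div_eq_iff hz, neg_eq_iff_add_eq_zero]

theorem hasFDerivAt_dotProduct (hφ : ∀ i, ContDiff ℂ 1 fun z => φ z i) (v : I → ℂ) (z : Aff m) :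
    HasFDerivAt (fun z => φ z ⬝ᵥ v) (∑ i, v i • fderiv ℂ (fun z => φ z i) z) z :=
  HasFDerivAt.fun_sum fun i _ =>
    ((hφ i).differentiable one_ne_zero z).hasFDerivAt.mul_const (v i)

/-- In the quotient rule, the term from the denominator supplies the derivative of the component $a
v$. Up to the scalar $-(\varphi(z)\cdot v)^{-1}$ the derivative is therefore that of the field
vanishing at `z`. -/
theorem hasFDerivAt_solve (hφ : ∀ i, ContDiff ℂ 1 fun z => φ z i) (c : Fin k → I → ℂ) {v : I → ℂ}
    {z : Aff m} (hz : φ z ⬝ᵥ v ≠ 0) :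
    HasFDerivAt (solve φ c v)
      (-(φ z ⬝ᵥ v)⁻¹ • fieldDer φ (fun j => c j + solve φ c v z j • v, z)) z := by
  refine hasFDerivAt_pi'.2 fun j => ?_
  have h1 := hasFDerivAt_dotProduct hφ (c j) z
  have h2 := (hasDerivAt_inv hz).comp_hasFDerivAt z (hasFDerivAt_dotProduct hφ v z)
  have h3 := (h1.mul h2).neg
  refine h3.congr_fderiv ?_
  ext x
  have e := fieldDer_add_smul (φ := φ) c (solve φ c v z) v z x j
  change _ = -(φ z ⬝ᵥ v)⁻¹ * fieldDer φ (fun j => c j + solve φ c v z j • v, z) x j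
  rw [e]
  simp only [Function.comp_apply, _root_.smul_apply, smul_eq_mul, _root_.neg_apply,
    _root_.add_apply, _root_.sum_apply, solve, fieldDer, ContinuousLinearMap.coe_pi']
  field_simp
  ring

theorem measurable_solve (hφ : ∀ i, ContDiff ℂ 1 fun z => φ z i) (v : I → ℂ) :
    Measurable fun p : (Fin k → I → ℂ) × Aff m => solve φ p.1 v p.2 := by
  have := continuous_basis hφ
  refine measurable_pi_lambda _ fun j => ?_
  have h1 : Continuous fun p : (Fin k → I → ℂ) × Aff m => φ p.2 ⬝ᵥ p.1 j := by
    unfold dotProduct; fun_prop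
  have h2 : Continuous fun p : (Fin k → I → ℂ) × Aff m => φ p.2 ⬝ᵥ v := by
    unfold dotProduct; fun_prop
  exact (h1.measurable.mul h2.measurable.inv).neg

theorem measurable_shift (hφ : ∀ i, ContDiff ℂ 1 fun z => φ z i) (v : I → ℂ) :
    Measurable fun p : (Fin k → I → ℂ) × Aff m =>
      ((fun j => p.1 j + solve φ p.1 v p.2 j • v : Fin k → I → ℂ), p.2) := by
  refine Measurable.prodMk (measurable_pi_lambda _ fun j => ?_) measurable_snd
  exact ((measurable_pi_apply j).comp measurable_fst).add
    (((measurable_pi_apply j).comp (measurable_solve hφ v)).smul_const v)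

theorem measurable_jac_fieldDer (hφ : ∀ i, ContDiff ℂ 1 fun z => φ z i) :
    Measurable fun p : (Fin k → I → ℂ) × Aff m => ENNReal.ofReal (jac (fieldDer φ p)) :=
  (continuous_jac.comp (continuous_fieldDer hφ)).measurable.ennreal_ofReal

/-- Integration over the zero sets of the fields `c + a v` against `da` is integration over space. -/
theorem lintegral_kernel_add_smul (hφ : ∀ i, ContDiff ℂ 1 fun z => φ z i) (c : Fin k → I → ℂ)
    (v : I → ℂ) {g : (Fin k → I → ℂ) × Aff m → ENNReal} (hg : Measurable g)
    (hg0 : ∀ c z, φ z ⬝ᵥ v = 0 → g (c, z) = 0) {G : (Fin k → ℂ) → ENNReal} (hG : Measurable G) :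
    ∫⁻ a : Fin k → ℂ, G a * ∫⁻ z, g (fun j => c j + a j • v, z)
        ∂((isFamily_field hφ).kernel fun j => c j + a j • v) =
      ∫⁻ z, ENNReal.ofReal (((‖(φ z ⬝ᵥ v)⁻¹‖ ^ 2) ^ k)) * (G (solve φ c v z) *
        (ENNReal.ofReal (jac (fieldDer φ (fun j => c j + solve φ c v z j • v, z))) *
          g (fun j => c j + solve φ c v z j • v, z))) := by
  set Ω : Set (Aff m) := {z | φ z ⬝ᵥ v ≠ 0} with hΩd
  have hqc : Continuous fun z => φ z ⬝ᵥ v := by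
    have := continuous_basis hφ
    unfold dotProduct; fun_prop
  have hΩ : IsOpen Ω := isOpen_ne_fun hqc continuous_const
  have hfd : ∀ z ∈ Ω, HasFDerivAt (solve φ c v)
      (-(φ z ⬝ᵥ v)⁻¹ • fieldDer φ (fun j => c j + solve φ c v z j • v, z)) z :=
    fun z hz => hasFDerivAt_solve hφ c hz
  have hsc : ContinuousOn (solve φ c v) Ω := fun z hz => (hfd z hz).continuousAt.continuousWithinAt
  have hf' : ContinuousOn (fun z =>
      -(φ z ⬝ᵥ v)⁻¹ • fieldDer φ (fun j => c j + solve φ c v z j • v, z)) Ω := by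
    refine ContinuousOn.smul (ContinuousOn.neg (hqc.continuousOn.inv₀ fun z hz => hz)) ?_
    refine (continuous_fieldDer hφ).comp_continuousOn ((continuousOn_pi.2 fun j => ?_).prodMk
      continuousOn_id)
    exact continuousOn_const.add (((continuous_apply j).comp_continuousOn hsc).smul
      continuousOn_const)
  set h : Aff m → ENNReal := fun z => G (solve φ c v z) * g (fun j => c j + solve φ c v z j • v, z)
    with hh
  have hpair : Measurable fun z : Aff m => (c, z) := measurable_prodMk_left
  have hhm : Measurable h :=
    (hG.comp ((measurable_solve hφ v).comp hpair)).mul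
      (hg.comp ((measurable_shift hφ v).comp hpair))
  have hco := coarea hΩ hf' hfd hhm
  have hR := (isFamily_field (k := k) hφ)
  have hR2 := isFamily_sub hΩ hf' hfd
  -- Where $\varphi(z)\cdot v\ne0$ the zeros of $c+av$ and the level set $a$ of `solve` have the
  -- same regular points; elsewhere `g` vanishes.
  have hleft : ∀ a : Fin k → ℂ, G a * ∫⁻ z, g (fun j => c j + a j • v, z)
        ∂((isFamily_field hφ).kernel fun j => c j + a j • v) =
      ∫⁻ z, h z ∂((isFamily_sub hΩ hf' hfd).kernel a) := by
    intro a
    have hgm : Measurable fun z => g (fun j => c j + a j • v, z) := hg.comp measurable_prodMk_left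
    rw [← lintegral_const_mul _ hgm, IsFamily.kernel_apply, IsFamily.kernel_apply,
      ← lintegral_indicator, ← lintegral_indicator]
    · congr 1
      funext z
      by_cases hz : φ z ⬝ᵥ v = 0
      · rw [Set.indicator_of_notMem (s := zsec _ (regSet _ (Set.univ ×ˢ Ω)) a)]
        · simp [hg0 _ z hz]
        · intro hz'
          exact hz'.1.1.2 hz
      · by_cases hza : fieldVal φ (fun j => c j + a j • v) z = 0
        · have hza' := (fieldVal_add_smul_eq_zero hz a).1 hza
          have hsa : solve φ c v z = a := sub_eq_zero.1 hza'
          have hs : Function.Surjective (fieldDer φ (fun j => c j + a j • v, z)) ↔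
              Function.Surjective (-(φ z ⬝ᵥ v)⁻¹ •
                fieldDer φ (fun j => c j + solve φ c v z j • v, z)) := by
            rw [hsa, ← jac_ne_zero_iff, ← jac_ne_zero_iff, jac_smul]
            simp [hz]
          have hmem : z ∈ zsec (fieldVal φ) (regSet (fieldDer φ) Set.univ)
              (fun j => c j + a j • v) ↔ z ∈ zsec (fun (a : Fin k → ℂ) z => solve φ c v z - a)
              (regSet (fun p => -(φ p.2 ⬝ᵥ v)⁻¹ • fieldDer φ (fun j => c j +
                solve φ c v p.2 j • v, p.2)) (Set.univ ×ˢ Ω)) a := by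
            simp only [zsec, regSet, Set.mem_ofPred_eq, Set.mem_univ, true_and, Set.mem_prod]
            exact ⟨fun h => ⟨⟨hz, hs.1 h.1⟩, hza'⟩, fun h => ⟨hs.2 h.1.2, hza⟩⟩
          by_cases hm : z ∈ zsec (fieldVal φ) (regSet (fieldDer φ) Set.univ)
              (fun j => c j + a j • v)
          · rw [Set.indicator_of_mem hm, Set.indicator_of_mem (hmem.1 hm), hh]
            simp only [hsa]
          · rw [Set.indicator_of_notMem hm, Set.indicator_of_notMem (mt hmem.2 hm)]
        · rw [Set.indicator_of_notMem, Set.indicator_of_notMem]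
          · intro hz'
            exact hza ((fieldVal_add_smul_eq_zero hz a).2 hz'.2)
          · intro hz'
            exact hza hz'.2
    · exact hR2.measurableSet_zsec hR2.isOpen_regSet.measurableSet (fun p hp => hp.1) _
    · exact hR.measurableSet_zsec hR.isOpen_regSet.measurableSet (fun p hp => hp.1) _
  rw [lintegral_congr hleft, hco, ← lintegral_indicator hΩ.measurableSet]
  congr 1
  funext z
  by_cases hz : φ z ⬝ᵥ v = 0
  · rw [Set.indicator_of_notMem (fun h : z ∈ Ω => h hz), hg0 _ z hz]
    simp
  · rw [Set.indicator_of_mem (show z ∈ Ω from hz), jac_smul, norm_neg,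
      ENNReal.ofReal_mul (by positivity), hh]
    ring

end

/-! ### Conditioning on the vanishing at a point. -/

section
variable {I : Type*} [Fintype I] {k m : ℕ} {φ : Aff m → I → ℂ}

/-- The covariance of the field with the coefficients projected by `P`, with its value at `z`. -/
def condVec (φ : Aff m → I → ℂ) (P : Matrix I I ℂ) (z : Aff m) : I → ℂ := P *ᵥ star (φ z)

/-- The variance at `z` of the field with the coefficients projected by `P`. -/
def varAt (φ : Aff m → I → ℂ) (P : Matrix I I ℂ) (z : Aff m) : ℝ := (φ z ⬝ᵥ condVec φ P z).re

/-- The projection `P` conditioned on the vanishing of the field at `z`. -/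
def condProj (φ : Aff m → I → ℂ) (P : Matrix I I ℂ) (z : Aff m) : Matrix I I ℂ :=
  P - (varAt φ P z : ℂ)⁻¹ • vecMulVec (condVec φ P z) (star (condVec φ P z))

theorem star_condVec {P : Matrix I I ℂ} (hP : Pᴴ = P) (z : Aff m) :
    star (condVec φ P z) = φ z ᵥ* P := by
  rw [condVec, star_mulVec, hP, star_star]

theorem star_condVec_dotProduct {P : Matrix I I ℂ} (hP : Pᴴ = P) (hPP : P * P = P) (z : Aff m) :
    star (condVec φ P z) ⬝ᵥ condVec φ P z = φ z ⬝ᵥ condVec φ P z := by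
  rw [star_condVec hP, ← dotProduct_mulVec, condVec, mulVec_mulVec, hPP]

theorem dotProduct_condVec {P : Matrix I I ℂ} (hP : Pᴴ = P) (hPP : P * P = P) (z : Aff m) :
    φ z ⬝ᵥ condVec φ P z = (varAt φ P z : ℂ) := by
  rw [varAt, ← star_condVec_dotProduct hP hPP]
  have := dotProduct_star_self_nonneg (condVec φ P z)
  exact Complex.ext rfl (by rw [Complex.ofReal_im]; exact (Complex.nonneg_iff.1 this).2.symm)

theorem varAt_nonneg {P : Matrix I I ℂ} (hP : Pᴴ = P) (hPP : P * P = P) (z : Aff m) :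
    0 ≤ varAt φ P z := by
  have := dotProduct_star_self_nonneg (condVec φ P z)
  rw [star_condVec_dotProduct hP hPP] at this
  exact (Complex.nonneg_iff.1 this).1

theorem condVec_eq_zero_iff {P : Matrix I I ℂ} (hP : Pᴴ = P) (hPP : P * P = P) (z : Aff m) :
    condVec φ P z = 0 ↔ varAt φ P z = 0 := by
  rw [← dotProduct_star_self_eq_zero (v := condVec φ P z),
    star_condVec_dotProduct hP hPP, dotProduct_condVec hP hPP, Complex.ofReal_eq_zero]

theorem continuous_condVec (hφ : ∀ i, ContDiff ℂ 1 fun z => φ z i) (P : Matrix I I ℂ) :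
    Continuous fun z => condVec φ P z := by
  have := continuous_basis hφ
  unfold condVec mulVec dotProduct
  fun_prop

theorem continuous_varAt (hφ : ∀ i, ContDiff ℂ 1 fun z => φ z i) (P : Matrix I I ℂ) :
    Continuous fun z => varAt φ P z := by
  have := continuous_basis hφ
  have := continuous_condVec hφ P
  unfold varAt dotProduct
  fun_prop

theorem measurable_condProj (hφ : ∀ i, ContDiff ℂ 1 fun z => φ z i) (P : Matrix I I ℂ) (i j : I) :
    Measurable fun z => condProj φ P z i j := by
  have := continuous_condVec hφ P
  simp only [condProj, Matrix.sub_apply, Matrix.smul_apply, vecMulVec_apply, smul_eq_mul,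
    Pi.star_apply]
  refine Measurable.const_sub (Measurable.mul ?_ (Continuous.measurable (by fun_prop))) _
  exact (Complex.continuous_ofReal.comp (continuous_varAt hφ P)).measurable.inv

theorem measurable_rowMul_condProj (hφ : ∀ i, ContDiff ℂ 1 fun z => φ z i) (P : Matrix I I ℂ) :
    Measurable fun p : (Fin k → I → ℂ) × Aff m => rowMul (condProj φ P p.2) p.1 := by
  refine measurable_pi_lambda _ fun j => measurable_pi_lambda _ fun i => ?_
  simp only [rowMul, mulVec, dotProduct]
  refine Finset.measurable_fun_sum _ fun l _ =>
    Measurable.mul ?_ (Continuous.measurable (by fun_prop))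
  exact (measurable_condProj hφ P i l).comp measurable_snd

variable [DecidableEq I]

/-- The one-point Kac–Rice formula on the set where `v` is not a zero of the field. -/
theorem kacRice_chart (hφ : ∀ i, ContDiff ℂ 1 fun z => φ z i) {P : Matrix I I ℂ} (hP : Pᴴ = P)
    (hPP : P * P = P) {v : I → ℂ} (hv : P *ᵥ v = v) (hv1 : star v ⬝ᵥ v = 1)
    {g : (Fin k → I → ℂ) × Aff m → ENNReal} (hg : Measurable g)
    (hg0 : ∀ c z, φ z ⬝ᵥ v = 0 → g (c, z) = 0) :
    ∫⁻ c, ∫⁻ z, g (rowMul P c, z) ∂((isFamily_field hφ).kernel (rowMul P c)) ∂(gaussRows k I) =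
      ∫⁻ z, ENNReal.ofReal ((Real.pi * varAt φ P z)⁻¹) ^ k *
        ∫⁻ c, ENNReal.ofReal (jac (fieldDer φ (rowMul (condProj φ P z) c, z))) *
          g (rowMul (condProj φ P z) c, z) ∂(gaussRows k I) := by
  have hstar : star v ᵥ* P = star v := by
    have := congrArg star hv
    rwa [star_mulVec, hP] at this
  -- The projected coefficients $Pc$ have the law of $Mc+av$ with $a$ an independent Gaussian.
  set M : Matrix I I ℂ := P - vecMulVec v (star v) with hM
  have hMM : M * Mᴴ + vecMulVec v (star v) = P * Pᴴ := by
    simp only [hM, conjTranspose_sub, conjTranspose_vecMulVec, star_star, hP, Matrix.mul_sub,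
      Matrix.sub_mul, hPP, mul_vecMulVec, vecMulVec_mul, hv, hstar, vecMulVec_mulVec, hv1,
      op_smul_eq_smul, one_smul, sub_mulVec, sub_self, zero_vecMulVec, sub_zero]
    abel
  have hF : Measurable fun c : Fin k → I → ℂ =>
      ∫⁻ z, g (c, z) ∂((isFamily_field hφ).kernel c) :=
    Measurable.lintegral_kernel_prod_right' hg
  rw [lintegral_rows_add hMM hF]
  set G : (Fin k → ℂ) → ENNReal := fun a =>
    ∏ j, ENNReal.ofReal (Real.exp (-‖a j‖ ^ 2) / Real.pi) with hG
  have hGm : Measurable G := Finset.measurable_fun_prod _ fun j _ =>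
    measurable_gaussian_density.comp (measurable_pi_apply j)
  have hsf : SigmaFinite (volume.withDensity fun c : ℂ =>
      ENNReal.ofReal (Real.exp (-‖c‖ ^ 2) / Real.pi)) := SigmaFinite.withDensity_ofReal _
  have hpi : (Measure.pi fun _ : Fin k => stdGaussian) =
      (volume : Measure (Fin k → ℂ)).withDensity G := by
    have := pi_withDensity (n := k) (volume : Measure ℂ) measurable_gaussian_density
    rwa [← volume_pi] at this
  set Φ : (Fin k → I → ℂ) → Aff m → ENNReal := fun c z =>
    ENNReal.ofReal (((‖(φ z ⬝ᵥ v)⁻¹‖ ^ 2) ^ k)) * (G (solve φ c v z) *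
        (ENNReal.ofReal (jac (fieldDer φ (fun j => c j + solve φ c v z j • v, z))) *
          g (fun j => c j + solve φ c v z j • v, z))) with hΦ
  have hqc : Continuous fun z => φ z ⬝ᵥ v := by
    have := continuous_basis hφ
    unfold dotProduct; fun_prop
  have hΦm : Measurable fun p : (Fin k → I → ℂ) × Aff m => Φ p.1 p.2 := by
    refine Measurable.mul ?_ ((hGm.comp (measurable_solve hφ v)).mul
      (((measurable_jac_fieldDer hφ).comp (measurable_shift hφ v)).mul
        (hg.comp (measurable_shift hφ v))))
    exact ((((hqc.measurable.comp measurable_snd).inv).norm.pow_const 2).pow_const k).ennreal_ofReal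
  calc _ = ∫⁻ c, ∫⁻ z, Φ (rowMul M c) z ∂volume ∂(gaussRows k I) := by
        refine lintegral_congr fun c => ?_
        have hFc : Measurable fun a : Fin k → ℂ => ∫⁻ z, g (fun j => rowMul M c j + a j • v, z)
            ∂((isFamily_field hφ).kernel fun j => rowMul M c j + a j • v) := by
          refine hF.comp (measurable_pi_lambda _ fun j => ?_)
          exact measurable_const.add ((measurable_pi_apply j).smul_const v)
        change ∫⁻ a : Fin k → ℂ, ∫⁻ z, g (fun j => rowMul M c j + a j • v, z)
            ∂((isFamily_field hφ).kernel fun j => rowMul M c j + a j • v) ∂_ = _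
        rw [hpi, lintegral_withDensity_eq_lintegral_mul _ hGm hFc]
        exact lintegral_kernel_add_smul hφ (rowMul M c) v hg hg0 hGm
    _ = ∫⁻ z, ∫⁻ c, Φ (rowMul M c) z ∂(gaussRows k I) := by
        refine lintegral_lintegral_swap (Measurable.aemeasurable ?_)
        exact hΦm.comp (((measurable_rowMul M).comp measurable_fst).prodMk measurable_snd)
    _ = _ := by
        refine lintegral_congr fun z => ?_
        by_cases hz : φ z ⬝ᵥ v = 0
        · simp [hΦ, hg0 _ z hz]
        set q := φ z ⬝ᵥ v with hq
        set p := condVec φ P z with hpd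
        set ρ := varAt φ P z with hρ
        have hsp : star p = φ z ᵥ* P := star_condVec hP z
        have hpv : star p ⬝ᵥ v = q := by rw [hsp, ← dotProduct_mulVec, hv]
        have hvp : star v ⬝ᵥ p = star q := by rw [← hpv, star_dotProduct]
        have hpp : star p ⬝ᵥ p = (ρ : ℂ) := by
          rw [star_condVec_dotProduct hP hPP, dotProduct_condVec hP hPP]
        have hp : P *ᵥ p = p := by rw [hpd, condVec, mulVec_mulVec, hPP]
        have hρ0 : (ρ : ℂ) ≠ 0 := by
          intro h0
          have : p = 0 := (condVec_eq_zero_iff hP hPP z).2 (by exact_mod_cast h0)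
          rw [this] at hpv
          simp at hpv
          exact hz hpv.symm
        -- The value of $a$ at which row $c$ vanishes at `z` is $b\cdot c$, and the coefficients
        -- with that $a$ are $Tc$. The density of $a$ at $b\cdot c$ is the tilting weight, with
        -- $1+\beta=\rho/|q|^2$.
        set b : I → ℂ := star v - q⁻¹ • star p with hb
        set T : Matrix I I ℂ := P - q⁻¹ • vecMulVec v (star p) with hT
        have hqn : q * star q = ((‖q‖ ^ 2 : ℝ) : ℂ) := by
          rw [Complex.star_def, Complex.mul_conj, Complex.normSq_eq_norm_sq]
        have hq2 : 0 < ‖q‖ ^ 2 := by have := norm_pos_iff.2 hz; positivity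
        have hβ : ((ρ / ‖q‖ ^ 2 - 1 : ℝ) : ℂ) = b ⬝ᵥ star b := by
          have hsq : star q ≠ 0 := star_ne_zero.2 hz
          rw [hb, star_sub, star_star, star_smul, star_star, sub_dotProduct, dotProduct_sub,
            dotProduct_sub, smul_dotProduct, smul_dotProduct, dotProduct_smul, dotProduct_smul,
            hv1, hvp, hpv, hpp, star_inv₀]
          push_cast
          rw [← Complex.ofReal_pow, ← hqn]
          simp only [smul_eq_mul]
          field_simp
          ring
        have hsol : ∀ c : Fin k → I → ℂ, ∀ j, solve φ (rowMul M c) v z j = b ⬝ᵥ c j := by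
          intro c j
          simp only [solve, rowMul, hM, sub_mulVec, vecMulVec_mulVec, dotProduct_sub, hb,
            sub_dotProduct, smul_dotProduct, dotProduct_smul, op_smul_eq_smul, smul_eq_mul, hsp,
            dotProduct_mulVec, ← hq]
          field_simp
          ring
        have hshift : ∀ c : Fin k → I → ℂ,
            (fun j => rowMul M c j + solve φ (rowMul M c) v z j • v) = rowMul T c := by
          intro c
          funext j
          rw [hsol]
          simp only [rowMul, hM, hT, sub_mulVec, Matrix.smul_mulVec, vecMulVec_mulVec, hb,
            sub_dotProduct, smul_dotProduct, op_smul_eq_smul, sub_smul, smul_smul, smul_eq_mul]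
          abel
        have hkey : T * (1 - ((1 + ((ρ / ‖q‖ ^ 2 - 1 : ℝ) : ℂ))⁻¹) • vecMulVec (star b) b) * Tᴴ =
            condProj φ P z * (condProj φ P z)ᴴ := by
          have := tilt_matrix_identity hP hPP hv hp hpv hz hpp hρ0 (Complex.conj_ofReal ρ)
          rw [← hb, ← hT] at this
          have h1 : (1 + ((ρ / ‖q‖ ^ 2 - 1 : ℝ) : ℂ)) = (ρ : ℂ) / (q * star q) := by
            rw [hqn]; push_cast; ring
          rw [h1, this]
          rfl
        set Ψ : (Fin k → I → ℂ) → ENNReal := fun c =>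
          ENNReal.ofReal (jac (fieldDer φ (c, z))) * g (c, z) with hΨ
        have hΨm : Measurable Ψ := ((measurable_jac_fieldDer hφ).comp measurable_prodMk_right).mul
          (hg.comp measurable_prodMk_right)
        have hGb : ∀ c : Fin k → I → ℂ, G (fun j => b ⬝ᵥ c j) =
            ENNReal.ofReal (Real.pi⁻¹) ^ k * ∏ j, ENNReal.ofReal (Real.exp (-‖b ⬝ᵥ c j‖ ^ 2)) := by
          intro c
          rw [hG]
          simp only [div_eq_inv_mul, ENNReal.ofReal_mul (inv_nonneg.2 Real.pi_pos.le),
            Finset.prod_mul_distrib, Finset.prod_const, Finset.card_univ, Fintype.card_fin]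
        have hΦT : ∀ c : Fin k → I → ℂ, Φ (rowMul M c) z =
            ENNReal.ofReal ((‖q⁻¹‖ ^ 2) ^ k) * ENNReal.ofReal (Real.pi⁻¹) ^ k *
              ((∏ j, ENNReal.ofReal (Real.exp (-‖b ⬝ᵥ c j‖ ^ 2))) * Ψ (rowMul T c)) := by
          intro c
          rw [hΦ]
          simp only [hshift]
          rw [show solve φ (rowMul M c) v z = fun j => b ⬝ᵥ c j from funext (hsol c), hGb]
          simp only [hΨ, ← hq]
          ring
        have hbc : Continuous fun c : I → ℂ => b ⬝ᵥ c := by simp only [dotProduct]; fun_prop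
        have hprod : Measurable fun c : Fin k → I → ℂ =>
            ∏ j, ENNReal.ofReal (Real.exp (-‖b ⬝ᵥ c j‖ ^ 2)) :=
          Finset.measurable_fun_prod _ fun j _ => (Real.continuous_exp.comp
            (hbc.norm.pow 2).neg).measurable.ennreal_ofReal.comp (measurable_pi_apply j)
        have hmeas : Measurable fun c : Fin k → I → ℂ =>
            (∏ j, ENNReal.ofReal (Real.exp (-‖b ⬝ᵥ c j‖ ^ 2))) * Ψ (rowMul T c) :=
          hprod.mul (hΨm.comp (measurable_rowMul T))
        rw [lintegral_congr hΦT, lintegral_const_mul _ hmeas, lintegral_rows_tilt hβ hkey hΨm, ← mul_assoc]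
        congr 1
        -- The Jacobian factor $|q|^{-2k}$, the density constant $\pi^{-k}$ and the tilt factor
        -- $(\rho/|q|^2)^{-k}$ combine to $(\pi\rho)^{-k}$.
        rw [ENNReal.ofReal_pow (by positivity), ← mul_pow, ← mul_pow,
          ← ENNReal.ofReal_mul (by positivity), ← ENNReal.ofReal_mul (by positivity)]
        congr 2
        rw [norm_inv]
        field_simp
        ring

/-- The one-point Kac–Rice formula for the zeros at which the field has positive variance. -/
theorem kacRice (hφ : ∀ i, ContDiff ℂ 1 fun z => φ z i) {P : Matrix I I ℂ} (hP : Pᴴ = P)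
    (hPP : P * P = P) {g : (Fin k → I → ℂ) × Aff m → ENNReal} (hg : Measurable g)
    (hg0 : ∀ c z, varAt φ P z = 0 → g (c, z) = 0) :
    ∫⁻ c, ∫⁻ z, g (rowMul P c, z) ∂((isFamily_field hφ).kernel (rowMul P c)) ∂(gaussRows k I) =
      ∫⁻ z, ENNReal.ofReal ((Real.pi * varAt φ P z)⁻¹) ^ k *
        ∫⁻ c, ENNReal.ofReal (jac (fieldDer φ (rowMul (condProj φ P z) c, z))) *
          g (rowMul (condProj φ P z) c, z) ∂(gaussRows k I) := by
  have hcont := continuous_condVec hφ P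
  have hvar := continuous_varAt hφ P
  have hrow := measurable_rowMul_condProj (k := k) hφ P
  -- Positive variance means that some coordinate of `condVec` is nonzero. Induction on the set of
  -- coordinates cuts `g` into parts, each supported where a given coordinate is nonzero and hence
  -- covered by one chart.
  suffices H : ∀ S : Finset I, ∀ g : (Fin k → I → ℂ) × Aff m → ENNReal, Measurable g →
      (∀ c z, (∀ i ∈ S, condVec φ P z i = 0) → g (c, z) = 0) →
      ∫⁻ c, ∫⁻ z, g (rowMul P c, z) ∂((isFamily_field hφ).kernel (rowMul P c)) ∂(gaussRows k I) =
      ∫⁻ z, ENNReal.ofReal ((Real.pi * varAt φ P z)⁻¹) ^ k *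
        ∫⁻ c, ENNReal.ofReal (jac (fieldDer φ (rowMul (condProj φ P z) c, z))) *
          g (rowMul (condProj φ P z) c, z) ∂(gaussRows k I) from
    H Finset.univ g hg fun c z hz => hg0 c z
      ((condVec_eq_zero_iff hP hPP z).1 (funext fun i => hz i (Finset.mem_univ i)))
  intro S
  induction S using Finset.induction_on with
  | empty =>
    intro g _ h0
    simp [h0]
  | insert i S _ ih =>
    intro g hg h0
    set U : Set ((Fin k → I → ℂ) × Aff m) := {p | condVec φ P p.2 i ≠ 0} with hU
    have hUm : MeasurableSet U :=
      (isOpen_ne_fun (((continuous_apply i).comp hcont).comp continuous_snd)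
        continuous_const).measurableSet
    have hg1 : Measurable (U.indicator g) := hg.indicator hUm
    have hg2 : Measurable (Uᶜ.indicator g) := hg.indicator hUm.compl
    have hsum : ∀ p, g p = U.indicator g p + Uᶜ.indicator g p := fun p =>
      (congrFun (Set.indicator_self_add_compl U g) p).symm
    have e2 := ih (Uᶜ.indicator g) hg2 fun c z hz => by
      by_cases hi : condVec φ P z i = 0
      · rw [Set.indicator_of_mem (show (c, z) ∈ Uᶜ from fun h => h hi)]
        exact h0 c z (by simpa [hi] using hz)
      · exact Set.indicator_of_notMem (fun h : (c, z) ∈ Uᶜ => h hi) _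
    have e1 : ∫⁻ c, ∫⁻ z, U.indicator g (rowMul P c, z)
          ∂((isFamily_field hφ).kernel (rowMul P c)) ∂(gaussRows k I) =
        ∫⁻ z, ENNReal.ofReal ((Real.pi * varAt φ P z)⁻¹) ^ k *
        ∫⁻ c, ENNReal.ofReal (jac (fieldDer φ (rowMul (condProj φ P z) c, z))) *
          U.indicator g (rowMul (condProj φ P z) c, z) ∂(gaussRows k I) := by
      -- The field of coefficients $Pe_i$ at `z` is the conjugate of coordinate `i` of `condVec`;
      -- normalised, it is the chart direction. If it vanishes, so does that part of `g`.
      set w : I → ℂ := P *ᵥ Pi.single i 1 with hw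
      have hzw : ∀ z, φ z ⬝ᵥ w = star (condVec φ P z i) := by
        intro z
        rw [hw, dotProduct_mulVec, ← star_condVec hP]
        simp
      by_cases hw0 : w = 0
      · have : U = ∅ := by
          ext p
          have := hzw p.2
          rw [hw0, dotProduct_zero] at this
          simp only [hU, Set.mem_ofPred_eq, Set.mem_empty_iff_false, iff_false, not_not]
          exact star_eq_zero.1 this.symm
        simp [this]
      · have hn := dotProduct_star_self_nonneg w
        have hne : star w ⬝ᵥ w ≠ 0 := fun h => hw0 (dotProduct_star_self_eq_zero.1 h)
        set r : ℝ := (star w ⬝ᵥ w).re with hr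
        have hrw : star w ⬝ᵥ w = (r : ℂ) :=
          Complex.ext rfl (by rw [Complex.ofReal_im]; exact (Complex.nonneg_iff.1 hn).2.symm)
        have hr0 : 0 < r := lt_of_le_of_ne (Complex.nonneg_iff.1 hn).1 fun h => hne (by
          rw [hrw, ← h, Complex.ofReal_zero])
        have hs0 : ((Real.sqrt r : ℝ) : ℂ) ≠ 0 := by
          exact_mod_cast (Real.sqrt_pos.2 hr0).ne'
        have hss : ((Real.sqrt r : ℝ) : ℂ) * (Real.sqrt r : ℝ) = r := by
          rw [← Complex.ofReal_mul, Real.mul_self_sqrt hr0.le]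
        refine kacRice_chart (v := ((Real.sqrt r : ℝ) : ℂ)⁻¹ • w) hφ hP hPP ?_ ?_ hg1 ?_
        · rw [mulVec_smul, hw, mulVec_mulVec, hPP]
        · rw [star_smul, smul_dotProduct, dotProduct_smul, hrw, star_inv₀, Complex.star_def,
            Complex.conj_ofReal, ← hss]
          simp only [smul_eq_mul]
          field_simp
        · intro c z hz
          rw [dotProduct_smul, hzw, smul_eq_zero] at hz
          have : condVec φ P z i = 0 := star_eq_zero.1 (hz.resolve_left (inv_ne_zero hs0))
          exact Set.indicator_of_notMem (fun h : (c, z) ∈ U => h this) _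
    simp_rw [hsum, mul_add]
    have hjacm : ∀ z, Measurable fun c : Fin k → I → ℂ =>
        ENNReal.ofReal (jac (fieldDer φ (rowMul (condProj φ P z) c, z))) := fun z =>
      (measurable_jac_fieldDer hφ).comp ((measurable_rowMul _).prodMk measurable_const)
    have hgc : ∀ {h : (Fin k → I → ℂ) × Aff m → ENNReal}, Measurable h → ∀ z, Measurable
        fun c : Fin k → I → ℂ => h (rowMul (condProj φ P z) c, z) := fun hh z =>
      hh.comp ((measurable_rowMul _).prodMk measurable_const)
    have hker : Measurable fun c : Fin k → I → ℂ => ∫⁻ z, U.indicator g (rowMul P c, z)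
        ∂((isFamily_field hφ).kernel (rowMul P c)) :=
      (Measurable.lintegral_kernel_prod_right' (κ := (isFamily_field (k := k) hφ).kernel) hg1).comp
        (measurable_rowMul P)
    have hR1 : Measurable fun z => ENNReal.ofReal ((Real.pi * varAt φ P z)⁻¹) ^ k *
        ∫⁻ c, ENNReal.ofReal (jac (fieldDer φ (rowMul (condProj φ P z) c, z))) *
          U.indicator g (rowMul (condProj φ P z) c, z) ∂(gaussRows k I) := by
      refine Measurable.mul ?_ (Measurable.lintegral_prod_left' (μ := gaussRows k I)
        (f := fun p : (Fin k → I → ℂ) × Aff m => ENNReal.ofReal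
          (jac (fieldDer φ (rowMul (condProj φ P p.2) p.1, p.2))) *
            U.indicator g (rowMul (condProj φ P p.2) p.1, p.2)) ?_)
      · exact ((measurable_const.mul hvar.measurable).inv.ennreal_ofReal).pow_const k
      · exact ((measurable_jac_fieldDer hφ).comp (hrow.prodMk measurable_snd)).mul
          (hg1.comp (hrow.prodMk measurable_snd))
    calc _ = ∫⁻ c, ((∫⁻ z, U.indicator g (rowMul P c, z)
          ∂((isFamily_field hφ).kernel (rowMul P c))) + ∫⁻ z, Uᶜ.indicator g (rowMul P c, z)
          ∂((isFamily_field hφ).kernel (rowMul P c))) ∂(gaussRows k I) :=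
          lintegral_congr fun c => lintegral_add_left (hg1.comp measurable_prodMk_left) _
      _ = _ := by
        rw [lintegral_add_left hker, e1, e2, ← lintegral_add_left hR1]
        refine lintegral_congr fun z => ?_
        have h1 : Measurable fun c : Fin k → I → ℂ =>
            ENNReal.ofReal (jac (fieldDer φ (rowMul (condProj φ P z) c, z))) *
              U.indicator g (rowMul (condProj φ P z) c, z) := (hjacm z).mul (hgc hg1 z)
        rw [← mul_add, lintegral_add_left h1]

end

/-! ### Conditioning on several points and the n-point Kac–Rice formula. -/

section
variable {I : Type*} [Fintype I] {m n : ℕ} {φ : Aff m → I → ℂ}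

/-- The values of the functions `φ` at the points `z`. -/
def basisMat (φ : Aff m → I → ℂ) (z : Fin n → Aff m) : Matrix (Fin n) I ℂ := of fun p => φ (z p)

/-- The covariance matrix of the values at `z` of the field with coefficients projected by `P`. -/
def gram (φ : Aff m → I → ℂ) (P : Matrix I I ℂ) (z : Fin n → Aff m) : Matrix (Fin n) (Fin n) ℂ :=
  basisMat φ z * P * (basisMat φ z)ᴴ

/-- The projection `P` conditioned on the vanishing of the field at the points `z`. -/
def resProj (φ : Aff m → I → ℂ) (P : Matrix I I ℂ) (z : Fin n → Aff m) : Matrix I I ℂ :=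
  P - P * (basisMat φ z)ᴴ * (gram φ P z)⁻¹ * (basisMat φ z * P)

theorem gram_apply (P : Matrix I I ℂ) (z : Fin n → Aff m) (p q : Fin n) :
    gram φ P z p q = φ (z p) ⬝ᵥ condVec φ P (z q) := by
  rw [gram, Matrix.mul_assoc]
  rfl

theorem conjTranspose_condProj {P : Matrix I I ℂ} (hP : Pᴴ = P) (a : Aff m) :
    (condProj φ P a)ᴴ = condProj φ P a := by
  simp [condProj, hP, conjTranspose_vecMulVec]

theorem condVec_condProj (P : Matrix I I ℂ) (a b : Aff m) :
    condVec φ (condProj φ P a) b = condVec φ P b -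
      ((varAt φ P a : ℂ)⁻¹ * star (φ b ⬝ᵥ condVec φ P a)) • condVec φ P a := by
  rw [condVec, condProj, sub_mulVec, Matrix.smul_mulVec, vecMulVec_mulVec, op_smul_eq_smul,
    smul_smul, star_dotProduct, star_star, ← condVec]

theorem condProj_mul_self {P : Matrix I I ℂ} (hP : Pᴴ = P) (hPP : P * P = P) (a : Aff m) :
    condProj φ P a * condProj φ P a = condProj φ P a := by
  by_cases h0 : varAt φ P a = 0
  · simp [condProj, h0, hPP]
  · have h1 : (varAt φ P a : ℂ) ≠ 0 := by exact_mod_cast h0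
    have hp : P *ᵥ condVec φ P a = condVec φ P a := by rw [condVec, mulVec_mulVec, hPP]
    have hp' : star (condVec φ P a) ᵥ* P = star (condVec φ P a) := by
      rw [star_condVec hP, vecMul_vecMul, hPP]
    have hpp : star (condVec φ P a) ⬝ᵥ condVec φ P a = (varAt φ P a : ℂ) := by
      rw [star_condVec_dotProduct hP hPP, dotProduct_condVec hP hPP]
    simp only [condProj, Matrix.mul_sub, Matrix.sub_mul, hPP, Matrix.smul_mul, Matrix.mul_smul,
      mul_vecMulVec, vecMulVec_mul, hp, hp', vecMulVec_mulVec, hpp, op_smul_eq_smul, smul_smul,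
      inv_mul_cancel₀ h1, one_smul, sub_mulVec, smul_mulVec]
    simp

theorem dotProduct_condVec_condProj_self {P : Matrix I I ℂ} (hP : Pᴴ = P) (hPP : P * P = P)
    (a b : Aff m) : φ b ⬝ᵥ condVec φ (condProj φ P a) a = 0 := by
  rw [condVec_condProj, dotProduct_condVec hP hPP]
  by_cases h0 : varAt φ P a = 0
  · rw [(condVec_eq_zero_iff hP hPP a).2 h0]
    simp
  · have h1 : (varAt φ P a : ℂ) ≠ 0 := by exact_mod_cast h0
    simp [h1]

theorem vecMul_condProj_self {P : Matrix I I ℂ} (hP : Pᴴ = P) (hPP : P * P = P) (a : Aff m) :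
    φ a ᵥ* condProj φ P a = 0 := by
  rw [← star_condVec (conjTranspose_condProj hP a), star_eq_zero,
    condVec_eq_zero_iff (conjTranspose_condProj hP a) (condProj_mul_self hP hPP a), varAt,
    dotProduct_condVec_condProj_self hP hPP]
  rfl

/-- One step of Gaussian elimination. Subtracting multiples of row `0` replaces the covariance by
the one conditioned at `a`, so joint densities multiply as in the chain rule. -/
theorem det_gram_cons {P : Matrix I I ℂ} (hP : Pᴴ = P) (hPP : P * P = P) (a : Aff m)
    (y : Fin n → Aff m) :
    (gram φ P (Fin.cons a y : Fin (n + 1) → Aff m)).det =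
      varAt φ P a * (gram φ (condProj φ P a) y).det := by
  set z : Fin (n + 1) → Aff m := Fin.cons a y with hz
  set B : Matrix (Fin (n + 1)) (Fin (n + 1)) ℂ := of fun p q =>
    Fin.cases (gram φ P z 0 q) (fun p => gram φ (condProj φ P a) z p.succ q) p with hB
  have h1 : (gram φ P z).det = B.det := by
    refine det_eq_of_forall_row_eq_smul_add_const (Fin.cases 0 fun p =>
      (varAt φ P a : ℂ)⁻¹ * (φ (y p) ⬝ᵥ condVec φ P a)) 0 rfl fun p q => ?_
    refine Fin.cases ?_ (fun p => ?_) p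
    · simp [hB]
    · have : (B p.succ q : ℂ) = gram φ (condProj φ P a) z p.succ q := rfl
      rw [this, show B 0 q = gram φ P z 0 q from rfl, gram_apply, gram_apply, gram_apply,
        condVec_condProj]
      have e : star (φ (z q) ⬝ᵥ condVec φ P a) = φ a ⬝ᵥ condVec φ P (z q) := by
        change _ = φ a ⬝ᵥ P *ᵥ star (φ (z q))
        rw [dotProduct_mulVec, ← star_condVec hP, star_dotProduct, star_star]
      simp only [hz, Fin.cons_succ, Fin.cons_zero, Fin.cases_succ, dotProduct_sub, dotProduct_smul,
        smul_eq_mul] at e ⊢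
      rw [e]
      ring
  have hB0 : ∀ p : Fin n, B p.succ 0 = 0 := fun p => by
    change gram φ (condProj φ P a) z p.succ 0 = 0
    rw [gram_apply]
    exact dotProduct_condVec_condProj_self hP hPP a _
  have hB00 : B 0 0 = varAt φ P a := by
    change gram φ P z 0 0 = _
    rw [gram_apply]
    exact dotProduct_condVec hP hPP a
  rw [h1, det_succ_column_zero, Fin.sum_univ_succ, hB00, Finset.sum_eq_zero fun p _ => by
    rw [hB0]; simp]
  simp only [Fin.val_zero, pow_zero, one_mul, add_zero]
  congr 2

/-- Characterises `resProj` by its shape and by the vanishing at the points: these determine $X$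
through the invertible Gram matrix. It avoids inverting block matrices. -/
theorem eq_resProj {P : Matrix I I ℂ} {z : Fin n → Aff m} (hdet : (gram φ P z).det ≠ 0)
    {R : Matrix I I ℂ} {X : Matrix (Fin n) I ℂ} (hR : R = P - P * ((basisMat φ z)ᴴ * X))
    (h0 : basisMat φ z * R = 0) : R = resProj φ P z := by
  have h1 : gram φ P z * X = basisMat φ z * P := by
    rw [hR, Matrix.mul_sub, sub_eq_zero] at h0
    rw [h0, gram]
    simp only [Matrix.mul_assoc]
  have h2 : X = (gram φ P z)⁻¹ * (basisMat φ z * P) := by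
    rw [← h1, nonsing_inv_mul_cancel_left _ _ (isUnit_iff_ne_zero.2 hdet)]
  rw [hR, resProj, h2]
  simp only [Matrix.mul_assoc]

theorem basisMat_mul_resProj {P : Matrix I I ℂ} {z : Fin n → Aff m}
    (hdet : (gram φ P z).det ≠ 0) : basisMat φ z * resProj φ P z = 0 := by
  have : basisMat φ z * (P * (basisMat φ z)ᴴ * (gram φ P z)⁻¹ * (basisMat φ z * P)) =
      gram φ P z * ((gram φ P z)⁻¹ * (basisMat φ z * P)) := by
    rw [gram]
    simp only [Matrix.mul_assoc]
  rw [resProj, Matrix.mul_sub, this, mul_nonsing_inv_cancel_left _ _ (isUnit_iff_ne_zero.2 hdet),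
    sub_self]

/-- Conditioning on `a` and then on `y` is conditioning on all the points; both projections have the
shape required by `eq_resProj`. -/
theorem resProj_cons {P : Matrix I I ℂ} (hP : Pᴴ = P) (hPP : P * P = P) (a : Aff m)
    (y : Fin n → Aff m) (hdet : (gram φ P (Fin.cons a y : Fin (n + 1) → Aff m)).det ≠ 0) :
    resProj φ (condProj φ P a) y = resProj φ P (Fin.cons a y : Fin (n + 1) → Aff m) := by
  have hd := hdet
  rw [det_gram_cons hP hPP] at hd
  have hd1 := left_ne_zero_of_mul hd
  have hd2 := right_ne_zero_of_mul hd
  set X' : Matrix (Fin n) I ℂ :=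
    (gram φ (condProj φ P a) y)⁻¹ * (basisMat φ y * condProj φ P a) with hX'
  have hRX : resProj φ (condProj φ P a) y =
      condProj φ P a - condProj φ P a * ((basisMat φ y)ᴴ * X') := by
    rw [resProj, hX']
    simp only [Matrix.mul_assoc]
  set x0 : I → ℂ := (varAt φ P a : ℂ)⁻¹ • (star (condVec φ P a) -
    star (condVec φ P a) ᵥ* ((basisMat φ y)ᴴ * X')) with hx0
  have hsplit : (basisMat φ (Fin.cons a y : Fin (n + 1) → Aff m))ᴴ * (of (Fin.cons x0 X')) =
      vecMulVec (star (φ a)) x0 + (basisMat φ y)ᴴ * X' := by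
    ext i j
    simp [Matrix.mul_apply, Fin.sum_univ_succ, basisMat, vecMulVec_apply]
    rfl
  refine eq_resProj hdet (X := of (Fin.cons x0 X')) ?_ ?_
  · rw [hsplit, hRX, Matrix.mul_add, mul_vecMulVec, ← condVec, condProj, Matrix.sub_mul,
      Matrix.smul_mul, vecMulVec_mul, hx0, vecMulVec_smul, vecMulVec_sub, smul_sub]
    abel
  · ext p j
    refine Fin.cases ?_ (fun p => ?_) p
    · change (φ a ᵥ* resProj φ (condProj φ P a) y) j = 0
      rw [hRX, vecMul_sub, ← vecMul_vecMul, vecMul_condProj_self hP hPP, zero_vecMul, sub_zero]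
      rfl
    · have := basisMat_mul_resProj hd2
      exact congrFun (congrFun this p) j

end

/-- The parameter space is quantified inside the induction because each step enlarges it by the
point just split off. -/
theorem measurable_lintegral_pi.{u} {E : Type} [MeasurableSpace E] {n : ℕ} :
    ∀ {X : Type u} [MeasurableSpace X] (κ : Kernel X E) [IsSFiniteKernel κ]
      [∀ x, SigmaFinite (κ x)] {g : X × (Fin n → E) → ENNReal}, Measurable g →
      Measurable fun x => ∫⁻ y, g (x, y) ∂(Measure.pi fun _ : Fin n => κ x) := by
  induction n with
  | zero =>
    intro X _ κ _ _ g hg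
    have : ∀ x, ∫⁻ y, g (x, y) ∂(Measure.pi fun _ : Fin 0 => κ x) = g (x, default) := fun x => by
      rw [Measure.pi_of_empty _ default]
      exact lintegral_dirac' _ (hg.comp measurable_prodMk_left)
    simp_rw [this]
    exact hg.comp measurable_prodMk_right
  | succ n ih =>
    intro X _ κ _ _ g hg
    have h1 : ∀ x, ∫⁻ y, g (x, y) ∂(Measure.pi fun _ : Fin (n + 1) => κ x) =
        ∫⁻ a, ∫⁻ y, g (x, Fin.cons a y) ∂(Measure.pi fun _ : Fin n => κ x) ∂(κ x) := fun x =>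
      lintegral_pi_succ (κ x) (hg.comp measurable_prodMk_left)
    simp_rw [h1]
    have hcons : Measurable fun p : (X × E) × (Fin n → E) =>
        (p.1.1, (Fin.cons p.1.2 p.2 : Fin (n + 1) → E)) := by
      refine (measurable_fst.comp measurable_fst).prodMk (measurable_pi_lambda _ fun i => ?_)
      refine Fin.cases ?_ (fun i => ?_) i
      · exact measurable_snd.comp measurable_fst
      · exact (measurable_pi_apply i).comp measurable_snd
    have hσ : ∀ x, SigmaFinite ((κ.comap Prod.fst measurable_fst : Kernel (X × E) E) x) :=
      fun x => by rw [Kernel.comap_apply]; infer_instance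
    have := ih (κ.comap Prod.fst measurable_fst : Kernel (X × E) E) (hg.comp hcons)
    exact Measurable.lintegral_kernel_prod_right' this

section
variable {I : Type*} [Fintype I] {k m n : ℕ} {φ : Aff m → I → ℂ}

/-- The ratio of Fubini–Study volume to Euclidean volume along the zeros of a field. -/
def zeroWeight (φ : Aff m → I → ℂ) (p : (Fin k → I → ℂ) × Aff m) : ENNReal :=
  ENNReal.ofReal (fsVolRatio p.2 ⊤ * fsJac p.2 (fieldDer φ p) / jac (fieldDer φ p))

theorem continuous_fsJac_fieldDer (hφ : ∀ i, ContDiff ℂ 1 fun z => φ z i) :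
    Continuous fun p : (Fin k → I → ℂ) × Aff m => fsJac p.2 (fieldDer φ p) := by
  have h1 : Continuous fun p : (Fin k → I → ℂ) × Aff m => mat (fieldDer φ p) :=
    continuous_mat.comp (continuous_fieldDer hφ)
  have h2 : Continuous fun p : (Fin k → I → ℂ) × Aff m => fsDual p.2 :=
    continuous_fsDual.comp continuous_snd
  have h3 := ((h1.matrix_mul h2).matrix_mul h1.matrix_conjTranspose).matrix_det
  exact Complex.continuous_re.comp h3

theorem measurable_zeroWeight (hφ : ∀ i, ContDiff ℂ 1 fun z => φ z i) :
    Measurable (zeroWeight (k := k) φ) := by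
  have h1 : Continuous fun p : (Fin k → I → ℂ) × Aff m => fsVolRatio p.2 ⊤ :=
    continuous_fsVolRatio_top.comp continuous_snd
  have h2 : Continuous fun p : (Fin k → I → ℂ) × Aff m => jac (fieldDer φ p) :=
    continuous_jac.comp (continuous_fieldDer hφ)
  exact ((h1.mul (continuous_fsJac_fieldDer hφ)).measurable.div h2.measurable).ennreal_ofReal

/-- Fubini–Study volume along the regular zeros of a field. -/
def fieldKernel (hφ : ∀ i, ContDiff ℂ 1 fun z => φ z i) : Kernel (Fin k → I → ℂ) (Aff m) :=
  (isFamily_field hφ).kernel.withDensity fun c z => zeroWeight φ (c, z)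

theorem fieldKernel_apply (hφ : ∀ i, ContDiff ℂ 1 fun z => φ z i) (c : Fin k → I → ℂ) :
    fieldKernel hφ c = ((isFamily_field hφ).kernel c).withDensity fun z => zeroWeight φ (c, z) :=
  Kernel.withDensity_apply (f := fun c z => zeroWeight φ (c, z)) _ (measurable_zeroWeight hφ) c

instance (hφ : ∀ i, ContDiff ℂ 1 fun z => φ z i) : IsSFiniteKernel (fieldKernel (k := k) hφ) :=
  Kernel.IsSFiniteKernel.withDensity _ fun _ _ => ENNReal.ofReal_ne_top

instance (hφ : ∀ i, ContDiff ℂ 1 fun z => φ z i) (c : Fin k → I → ℂ) :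
    SigmaFinite (fieldKernel hφ c) := by
  rw [fieldKernel_apply]
  exact SigmaFinite.withDensity_ofReal _

/-- The density of the Fubini–Study volume of the zero set in the Kac–Rice formula. -/
def kacRiceWeight (φ : Aff m → I → ℂ) (p : (Fin k → I → ℂ) × Aff m) : ENNReal :=
  ENNReal.ofReal (fsVolRatio p.2 ⊤ * fsJac p.2 (fieldDer φ p))

theorem measurable_kacRiceWeight (hφ : ∀ i, ContDiff ℂ 1 fun z => φ z i) :
    Measurable (kacRiceWeight (k := k) φ) := by
  have h1 : Continuous fun p : (Fin k → I → ℂ) × Aff m => fsVolRatio p.2 ⊤ :=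
    continuous_fsVolRatio_top.comp continuous_snd
  exact (h1.mul (continuous_fsJac_fieldDer hφ)).measurable.ennreal_ofReal

theorem jac_nonneg (L : Aff m →L[ℂ] (Fin k → ℂ)) : 0 ≤ jac L := by
  by_cases h : Function.Surjective L
  · exact (jac_pos h).le
  · exact (jac_eq_zero h).ge

/-- At critical points both `jac` and `fsJac` vanish, so the division in `zeroWeight` does no harm.
-/
theorem jac_mul_zeroWeight (φ : Aff m → I → ℂ) (p : (Fin k → I → ℂ) × Aff m) :
    ENNReal.ofReal (jac (fieldDer φ p)) * zeroWeight φ p = kacRiceWeight φ p := by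
  rw [zeroWeight, kacRiceWeight, ← ENNReal.ofReal_mul (jac_nonneg _)]
  by_cases h : Function.Surjective (fieldDer φ p)
  · rw [mul_div_cancel₀ _ (jac_pos h).ne']
  · rw [fsJac_eq_zero _ h]
    simp

variable [DecidableEq I]

theorem kacRice_fieldKernel (hφ : ∀ i, ContDiff ℂ 1 fun z => φ z i) {P : Matrix I I ℂ} (hP : Pᴴ = P)
    (hPP : P * P = P) {g : (Fin k → I → ℂ) × Aff m → ENNReal} (hg : Measurable g)
    (hg0 : ∀ c z, varAt φ P z = 0 → g (c, z) = 0) :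
    ∫⁻ c, ∫⁻ z, g (rowMul P c, z) ∂(fieldKernel hφ (rowMul P c)) ∂(gaussRows k I) =
      ∫⁻ z, ENNReal.ofReal ((Real.pi * varAt φ P z)⁻¹) ^ k *
        ∫⁻ c, kacRiceWeight φ (rowMul (condProj φ P z) c, z) *
          g (rowMul (condProj φ P z) c, z) ∂(gaussRows k I) := by
  have h := kacRice hφ hP hPP ((measurable_zeroWeight hφ).mul hg) fun c z hz => by
    simp [hg0 c z hz]
  simp only [Pi.mul_apply, ← mul_assoc, jac_mul_zeroWeight] at h
  rw [← h]
  refine lintegral_congr fun c => ?_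
  rw [fieldKernel_apply]
  exact lintegral_withDensity_eq_lintegral_mul _
    ((measurable_zeroWeight hφ).comp measurable_prodMk_left) (hg.comp measurable_prodMk_left)

omit [Fintype I] [DecidableEq I] in
theorem continuous_basisMat (hφ : ∀ i, ContDiff ℂ 1 fun z => φ z i) :
    Continuous fun z : Fin n → Aff m => basisMat φ z :=
  continuous_matrix fun p i => (hφ i).continuous.comp (continuous_apply p)

omit [DecidableEq I] in
theorem continuous_gram (hφ : ∀ i, ContDiff ℂ 1 fun z => φ z i) (P : Matrix I I ℂ) :
    Continuous fun z : Fin n → Aff m => gram φ P z :=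
  ((continuous_basisMat hφ).matrix_mul continuous_const).matrix_mul
    (continuous_basisMat hφ).matrix_conjTranspose

omit [DecidableEq I] in
theorem measurable_resProj (hφ : ∀ i, ContDiff ℂ 1 fun z => φ z i) (P : Matrix I I ℂ) (i j : I) :
    Measurable fun z : Fin n → Aff m => resProj φ P z i j := by
  have hinv : ∀ p q, Measurable fun z : Fin n → Aff m => (gram φ P z)⁻¹ p q := fun p q => by
    simp only [inv_def, Ring.inverse_eq_inv', Matrix.smul_apply, smul_eq_mul]
    exact ((continuous_gram hφ P).matrix_det.measurable.inv).mul
      (((continuous_gram hφ P).matrix_adjugate.matrix_elem p q).measurable)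
  have hl : ∀ p, Measurable fun z : Fin n → Aff m => (P * (basisMat φ z)ᴴ) i p := fun p =>
    ((continuous_const.matrix_mul
      (continuous_basisMat hφ).matrix_conjTranspose).matrix_elem i p).measurable
  have hr : ∀ p, Measurable fun z : Fin n → Aff m => (basisMat φ z * P) p j := fun p =>
    (((continuous_basisMat hφ).matrix_mul continuous_const).matrix_elem p j).measurable
  have hprod : ∀ z : Fin n → Aff m, resProj φ P z i j = P i j - ∑ p, (∑ q,
      (P * (basisMat φ z)ᴴ) i q * (gram φ P z)⁻¹ q p) * (basisMat φ z * P) p j := fun z => rfl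
  simp only [hprod]
  refine Measurable.const_sub (Finset.measurable_fun_sum _ fun p _ =>
    Measurable.mul (Finset.measurable_fun_sum _ fun q _ => ?_) (hr p)) _
  exact (hl q).mul (hinv q p)

omit [DecidableEq I] in
theorem measurable_rowMul_resProj (hφ : ∀ i, ContDiff ℂ 1 fun z => φ z i) (P : Matrix I I ℂ) :
    Measurable fun p : (Fin k → I → ℂ) × (Fin n → Aff m) => rowMul (resProj φ P p.2) p.1 := by
  refine measurable_pi_lambda _ fun j => measurable_pi_lambda _ fun i => ?_
  simp only [rowMul, mulVec, dotProduct]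
  refine Finset.measurable_fun_sum _ fun l _ =>
    Measurable.mul ?_ (Continuous.measurable (by fun_prop))
  exact (measurable_resProj hφ P i l).comp measurable_snd

/-- The Kac–Rice formula for `n` points. -/
theorem kacRice_pi (hφ : ∀ i, ContDiff ℂ 1 fun z => φ z i) :
    ∀ {n : ℕ} {P : Matrix I I ℂ} (_ : Pᴴ = P) (_ : P * P = P)
      {G : (Fin k → I → ℂ) × (Fin n → Aff m) → ENNReal} (_ : Measurable G)
      (_ : ∀ c z, (gram φ P z).det = 0 → G (c, z) = 0),
    ∫⁻ c, ∫⁻ z, G (rowMul P c, z) ∂(Measure.pi fun _ => fieldKernel hφ (rowMul P c))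
        ∂(gaussRows k I) =
      ∫⁻ z, ENNReal.ofReal ((Real.pi ^ n * (gram φ P z).det.re)⁻¹) ^ k *
        ∫⁻ c, (∏ p, kacRiceWeight φ (rowMul (resProj φ P z) c, z p)) *
          G (rowMul (resProj φ P z) c, z) ∂(gaussRows k I) ∂(Measure.pi fun _ => volume) := by
  intro n
  induction n with
  | zero =>
    intro P hP hPP G hG _
    have hz : ∀ z : Fin 0 → Aff m, resProj φ P z = P := fun z => by
      have : P * (basisMat φ z)ᴴ * (gram φ P z)⁻¹ * (basisMat φ z * P) = 0 := by
        ext i j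
        rw [Matrix.mul_apply]
        simp
      rw [resProj, this, sub_zero]
    have h1 : ∀ c : Fin k → I → ℂ, ∫⁻ z, G (rowMul P c, z)
        ∂(Measure.pi fun _ : Fin 0 => fieldKernel hφ (rowMul P c)) = G (rowMul P c, default) :=
      fun c => by
        rw [Measure.pi_of_empty _ default]
        exact lintegral_dirac' _ (hG.comp measurable_prodMk_left)
    rw [lintegral_congr h1, Measure.pi_of_empty _ default, lintegral_dirac]
    simp [hz]
  | succ n ih =>
    intro P hP hPP G hG hG0
    have hcons : Measurable fun p : ((Fin k → I → ℂ) × Aff m) × (Fin n → Aff m) =>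
        (p.1.1, (Fin.cons p.1.2 p.2 : Fin (n + 1) → Aff m)) := by
      refine (measurable_fst.comp measurable_fst).prodMk (measurable_pi_lambda _ fun i => ?_)
      refine Fin.cases ?_ (fun i => ?_) i
      · exact measurable_snd.comp measurable_fst
      · exact (measurable_pi_apply i).comp measurable_snd
    -- All points but the first are integrated out, leaving a one-point problem.
    set g : (Fin k → I → ℂ) × Aff m → ENNReal := fun p =>
      ∫⁻ y, G (p.1, Fin.cons p.2 y) ∂(Measure.pi fun _ : Fin n => fieldKernel hφ p.1) with hgd
    have hσ : ∀ x, SigmaFinite (((fieldKernel hφ).comap Prod.fst measurable_fst :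
        Kernel ((Fin k → I → ℂ) × Aff m) (Aff m)) x) :=
      fun x => by rw [Kernel.comap_apply]; infer_instance
    have hg : Measurable g :=
      measurable_lintegral_pi ((fieldKernel hφ).comap Prod.fst measurable_fst :
        Kernel ((Fin k → I → ℂ) × Aff m) (Aff m)) (hG.comp hcons)
    have hg0 : ∀ c a, varAt φ P a = 0 → g (c, a) = 0 := by
      intro c a ha
      have : ∀ y : Fin n → Aff m, G (c, Fin.cons a y) = 0 := fun y => hG0 _ _ (by
        rw [det_gram_cons hP hPP, ha]
        simp)
      simp [hgd, this]
    have hR : Measurable fun z : Fin (n + 1) → Aff m =>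
        ENNReal.ofReal ((Real.pi ^ (n + 1) * (gram φ P z).det.re)⁻¹) ^ k *
        ∫⁻ c, (∏ p, kacRiceWeight φ (rowMul (resProj φ P z) c, z p)) *
          G (rowMul (resProj φ P z) c, z) ∂(gaussRows k I) := by
      refine Measurable.mul ?_ (Measurable.lintegral_prod_left' (μ := gaussRows k I)
        (f := fun p : (Fin k → I → ℂ) × (Fin (n + 1) → Aff m) =>
          (∏ q, kacRiceWeight φ (rowMul (resProj φ P p.2) p.1, p.2 q)) *
            G (rowMul (resProj φ P p.2) p.1, p.2)) ?_)
      · exact ((measurable_const.mul (Complex.continuous_re.comp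
          (continuous_gram hφ P).matrix_det).measurable).inv.ennreal_ofReal).pow_const k
      · refine Measurable.mul (Finset.measurable_fun_prod _ fun q _ => ?_)
          (hG.comp ((measurable_rowMul_resProj hφ P).prodMk measurable_snd))
        exact (measurable_kacRiceWeight hφ).comp ((measurable_rowMul_resProj hφ P).prodMk
          ((measurable_pi_apply q).comp measurable_snd))
    have h1 : ∀ c : Fin k → I → ℂ, ∫⁻ z, G (rowMul P c, z)
        ∂(Measure.pi fun _ : Fin (n + 1) => fieldKernel hφ (rowMul P c)) =
        ∫⁻ a, g (rowMul P c, a) ∂(fieldKernel hφ (rowMul P c)) := fun c =>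
      lintegral_pi_succ _ (hG.comp measurable_prodMk_left)
    rw [lintegral_congr h1, kacRice_fieldKernel hφ hP hPP hg hg0, lintegral_pi_succ _ hR]
    refine lintegral_congr fun a => ?_
    -- The weight of the first point joins the integrand before the induction hypothesis is applied,
    -- so that it is finally evaluated at coefficients conditioned on all points.
    have hG' : Measurable fun p : (Fin k → I → ℂ) × (Fin n → Aff m) =>
        kacRiceWeight φ (p.1, a) * G (p.1, Fin.cons a p.2) :=
      ((measurable_kacRiceWeight hφ).comp (measurable_fst.prodMk measurable_const)).mul
        (hG.comp (hcons.comp ((measurable_fst.prodMk measurable_const).prodMk measurable_snd)))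
    have hih := ih (conjTranspose_condProj hP a) (condProj_mul_self hP hPP a) hG' fun c y hy => by
      rw [hG0 c (Fin.cons a y) (by rw [det_gram_cons hP hPP, hy, mul_zero]), mul_zero]
    have h2 : ∀ c : Fin k → I → ℂ, kacRiceWeight φ (rowMul (condProj φ P a) c, a) *
          g (rowMul (condProj φ P a) c, a) =
        ∫⁻ y, kacRiceWeight φ (rowMul (condProj φ P a) c, a) *
          G (rowMul (condProj φ P a) c, Fin.cons a y)
            ∂(Measure.pi fun _ : Fin n => fieldKernel hφ (rowMul (condProj φ P a) c)) := fun c =>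
      (lintegral_const_mul _ (hG.comp (hcons.comp
        ((measurable_const (a := rowMul (condProj φ P a) c)).prodMk
          (measurable_const (a := a)) |>.prodMk measurable_id)))).symm
    rw [lintegral_congr h2, hih, ← lintegral_const_mul']
    · refine lintegral_congr fun y => ?_
      by_cases hd : (gram φ P (Fin.cons a y : Fin (n + 1) → Aff m)).det = 0
      · simp [hG0 _ _ hd]
      · rw [resProj_cons hP hPP a y hd, det_gram_cons hP hPP, Complex.re_ofReal_mul, ← mul_assoc,
          ← mul_pow, ← ENNReal.ofReal_mul (inv_nonneg.2
            (mul_nonneg Real.pi_pos.le (varAt_nonneg hP hPP a)))]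
        congr 1
        · congr 2
          rw [← mul_inv]
          congr 1
          ring
        · refine lintegral_congr fun c => ?_
          rw [Fin.prod_univ_succ]
          simp only [Fin.cons_zero, Fin.cons_succ]
          ring
    · exact ENNReal.pow_ne_top ENNReal.ofReal_ne_top

end

/-! ### Gaussian moments and Wick's formula. -/

theorem integrable_norm_pow_stdGaussian (a : ℕ) :
    Integrable (fun c : ℂ => ((‖c‖ ^ a : ℝ) : ℂ)) stdGaussian := by
  have h1 : Integrable fun c : ℂ => ‖c‖ ^ (a : ℝ) * Real.exp (-‖c‖ ^ (2 : ℝ)) := by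
    by_contra hn
    have h := Complex.integral_rpow_mul_exp_neg_rpow (p := 2) (q := a) (by norm_num) (by
      have : (0 : ℝ) ≤ a := Nat.cast_nonneg a
      linarith)
    rw [integral_undef hn] at h
    have : 0 < Real.Gamma ((a + 2 : ℝ) / 2) := Real.Gamma_pos_of_pos (by positivity)
    have := Real.pi_pos
    exact absurd h (by positivity)
  rw [stdGaussian, integrable_withDensity_iff_integrable_smul' measurable_gaussian_density
    (Eventually.of_forall fun _ => ENNReal.ofReal_lt_top)]
  have h2 := (h1.ofReal (𝕜 := ℂ)).div_const (Real.pi : ℂ)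
  refine h2.congr (Eventually.of_forall fun c => ?_)
  simp only [ENNReal.toReal_ofReal (show 0 ≤ Real.exp (-‖c‖ ^ 2) / Real.pi by positivity)]
  rw [Complex.real_smul, Real.rpow_natCast, Real.rpow_ofNat]
  simp only [Complex.ofReal_mul, Complex.ofReal_div, Complex.coe_algebraMap]
  ring

theorem integrable_monomial_stdGaussian (a b : ℕ) :
    Integrable (fun c : ℂ => c ^ a * star c ^ b) stdGaussian := by
  refine (integrable_norm_pow_stdGaussian (a + b)).mono
    (Continuous.aestronglyMeasurable (by fun_prop)) (Eventually.of_forall fun c => le_of_eq ?_)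
  simp [pow_add]

theorem integral_monomial_stdGaussian (a b : ℕ) :
    ∫ c, c ^ a * star c ^ b ∂stdGaussian = if a = b then (a.factorial : ℂ) else 0 := by
  rw [integral_stdGaussian]
  split_ifs with h
  · subst h
    have h := Complex.integral_rpow_mul_exp_neg_rpow (p := 2) (q := 2 * a) (by norm_num) (by
      have : (0 : ℝ) ≤ a := Nat.cast_nonneg a
      linarith)
    rw [show (2 * a + 2 : ℝ) / 2 = a + 1 by ring, Real.Gamma_nat_eq_factorial] at h
    have h2 : ∀ c : ℂ, ((Real.exp (-‖c‖ ^ 2) / Real.pi : ℝ) : ℂ) * (c ^ a * star c ^ a) =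
        ((Real.pi⁻¹ * (‖c‖ ^ (2 * a : ℝ) * Real.exp (-‖c‖ ^ (2 : ℝ))) : ℝ) : ℂ) := by
      intro c
      rw [← mul_pow, Complex.star_def, Complex.mul_conj, Complex.normSq_eq_norm_sq,
        ← Complex.ofReal_pow, ← Complex.ofReal_mul, ← pow_mul,
        show (2 * a : ℝ) = ((2 * a : ℕ) : ℝ) by push_cast; ring, Real.rpow_natCast,
        Real.rpow_ofNat]
      congr 1
      ring
    simp_rw [h2]
    rw [integral_complex_ofReal, integral_const_mul, h]
    have := Real.pi_ne_zero
    norm_cast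
    field_simp
  · set F : ℂ → ℂ := fun c =>
      ((Real.exp (-‖c‖ ^ 2) / Real.pi : ℝ) : ℂ) * (c ^ a * star c ^ b) with hF
    have hab : (a : ℝ) - b ≠ 0 := sub_ne_zero.2 (by exact_mod_cast h)
    -- For $a\ne b$, rotation by $\pi/(a-b)$ preserves the Gaussian and changes the sign of the
    -- monomial, so the integral is zero.
    set u : Circle := Circle.exp (Real.pi / (a - b)) with hu
    have hu1 : (u : ℂ) ^ a * star (u : ℂ) ^ b = -1 := by
      rw [hu, Circle.coe_exp, Complex.star_def, ← Complex.exp_conj, ← Complex.exp_nat_mul,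
        ← Complex.exp_nat_mul, ← Complex.exp_add, ← Complex.exp_pi_mul_I]
      congr 1
      have hab' : (a : ℂ) - b ≠ 0 := by exact_mod_cast hab
      simp only [map_mul, Complex.conj_ofReal, Complex.conj_I]
      push_cast
      field_simp
      ring
    have h1 := (rotation u).measurePreserving.integral_comp
      (rotation u).toHomeomorph.measurableEmbedding F
    have h2 : ∀ c, F (rotation u c) = -F c := by
      intro c
      rw [rotation_apply, hF]
      simp only [norm_mul, Circle.norm_coe, one_mul, mul_pow, star_mul']
      linear_combination ((Real.exp (-‖c‖ ^ 2) / Real.pi : ℝ) : ℂ) * (c ^ a * star c ^ b) * hu1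
    simp_rw [h2] at h1
    rw [integral_neg] at h1
    exact CharZero.neg_eq_self_iff.1 h1

section
variable {T X : Type*} [Fintype T] [DecidableEq T] [Fintype X] [DecidableEq X]

/-- Permutations carrying `h` to `g` exist only if corresponding fibres have equal size. They then
form a coset of the stabiliser of `g`, a product of symmetric groups. -/
theorem card_perm_comp_eq (g h : T → X) :
    Fintype.card {π : Equiv.Perm T // h ∘ π = g} =
      ∏ x, if Fintype.card {t // g t = x} = Fintype.card {t // h t = x} then
        (Fintype.card {t // g t = x}).factorial else 0 := by
  by_cases H : ∀ x, Fintype.card {t // g t = x} = Fintype.card {t // h t = x}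
  · set π₀ : T ≃ T := Equiv.ofFiberEquiv fun x => Fintype.equivOfCardEq (H x) with hπ
    have h0 : ∀ t, h (π₀ t) = g t := fun t => Equiv.ofFiberEquiv_map _ t
    have e : {π : Equiv.Perm T // h ∘ π = g} ≃ {π : Equiv.Perm T // g ∘ π = g} :=
      (Equiv.mulLeft π₀⁻¹).subtypeEquiv fun π => by
        have : g ∘ ⇑(Equiv.mulLeft π₀⁻¹ π) = h ∘ π := by
          funext t
          simp [← h0]
        rw [this]
    rw [Fintype.card_congr e, DomMulAct.stabilizer_card]
    exact Finset.prod_congr rfl fun x _ => by rw [if_pos (H x)]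
  · push Not at H
    obtain ⟨x, hx⟩ := H
    rw [Finset.prod_eq_zero (Finset.mem_univ x) (if_neg hx), Fintype.card_eq_zero_iff]
    refine ⟨fun ⟨π, hπ⟩ => hx ?_⟩
    refine Fintype.card_congr (π.subtypeEquiv fun t => ?_)
    rw [← hπ]
    rfl

omit [DecidableEq T] in
theorem prod_comp_eq_prod_pow {R : Type*} [CommMonoid R] (g : T → X) (F : X → R) :
    ∏ t, F (g t) = ∏ x, F x ^ Fintype.card {t // g t = x} := by
  rw [← Finset.prod_fiberwise' Finset.univ g F]
  exact Finset.prod_congr rfl fun x _ => by rw [Finset.prod_const, Fintype.card_subtype]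

end

section
variable {I : Type*} [Fintype I] {k : ℕ} {T : Type*} [Fintype T]

theorem monomial_rows [DecidableEq I] (g h : T → Fin k × I) (c : Fin k → I → ℂ) :
    ∏ t, c (g t).1 (g t).2 * star (c (h t).1 (h t).2) =
      ∏ j, ∏ i, c j i ^ Fintype.card {t // g t = (j, i)} *
        star (c j i) ^ Fintype.card {t // h t = (j, i)} := by
  classical
  rw [Finset.prod_mul_distrib, prod_comp_eq_prod_pow g fun x => c x.1 x.2,
    prod_comp_eq_prod_pow h fun x => star (c x.1 x.2), ← Finset.prod_mul_distrib,
    Fintype.prod_prod_type]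

theorem integrable_monomial_rows (g h : T → Fin k × I) :
    Integrable (fun c : Fin k → I → ℂ => ∏ t, c (g t).1 (g t).2 * star (c (h t).1 (h t).2))
      (gaussRows k I) := by
  classical
  simp_rw [monomial_rows]
  exact Integrable.fintype_prod fun j => Integrable.fintype_prod fun i =>
    integrable_monomial_stdGaussian _ _

/-- The moment $E|c|^{2a}=a!$ counts the matchings between $a$ factors and $a$ conjugate factors, so
the product of moments counts permutations. -/
theorem integral_monomial_rows [DecidableEq I] [DecidableEq T] (g h : T → Fin k × I) :
    ∫ c, ∏ t, c (g t).1 (g t).2 * star (c (h t).1 (h t).2) ∂(gaussRows k I) =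
      ∑ π : Equiv.Perm T, if h ∘ π = g then 1 else 0 := by
  simp_rw [monomial_rows]
  rw [integral_fintype_prod_eq_prod (𝕜 := ℂ) (μ := fun _ : Fin k => gauss I)
    (f := fun j r => ∏ i, r i ^ Fintype.card {t // g t = (j, i)} *
        star (r i) ^ Fintype.card {t // h t = (j, i)})]
  have : ∀ j, ∫ r, ∏ i, r i ^ Fintype.card {t // g t = (j, i)} *
        star (r i) ^ Fintype.card {t // h t = (j, i)} ∂(gauss I) =
      ∏ i, if Fintype.card {t // g t = (j, i)} = Fintype.card {t // h t = (j, i)} then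
        ((Fintype.card {t // g t = (j, i)}).factorial : ℂ) else 0 := fun j => by
    rw [integral_fintype_prod_eq_prod (𝕜 := ℂ) (μ := fun _ : I => stdGaussian)
      (f := fun i c => c ^ Fintype.card {t // g t = (j, i)} *
        star c ^ Fintype.card {t // h t = (j, i)})]
    exact Finset.prod_congr rfl fun i _ => integral_monomial_stdGaussian _ _
  simp_rw [this]
  rw [Finset.sum_boole, ← Fintype.card_subtype, card_perm_comp_eq, Fintype.prod_prod_type]
  push_cast
  rfl

theorem prod_dotProduct_rows (r r' : T → Fin k) (a b : T → I → ℂ) (c : Fin k → I → ℂ) [DecidableEq T] :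
    ∏ t, (a t ⬝ᵥ c (r t)) * star (b t ⬝ᵥ c (r' t)) =
      ∑ g : T → I, ∑ h : T → I, (∏ t, a t (g t) * star (b t (h t))) *
        ∏ t, c (r t) (g t) * star (c (r' t) (h t)) := by
  rw [Finset.prod_mul_distrib]
  simp only [dotProduct, star_sum, Finset.prod_univ_sum, Fintype.piFinset_univ, Finset.sum_mul_sum]
  refine Finset.sum_congr rfl fun g _ => Finset.sum_congr rfl fun h _ => ?_
  simp only [← Finset.prod_mul_distrib]
  exact Finset.prod_congr rfl fun t _ => by rw [star_mul']; ring

theorem integrable_prod_dotProduct_rows (r r' : T → Fin k) (a b : T → I → ℂ) :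
    Integrable (fun c : Fin k → I → ℂ => ∏ t, (a t ⬝ᵥ c (r t)) * star (b t ⬝ᵥ c (r' t)))
      (gaussRows k I) := by
  classical
  simp_rw [prod_dotProduct_rows]
  exact integrable_finsetSum _ fun g _ => integrable_finsetSum _ fun h _ =>
    (integrable_monomial_rows (fun t => (r t, g t)) fun t => (r' t, h t)).const_mul _

/-- Wick's formula. -/
theorem integral_prod_dotProduct_rows [DecidableEq T] (r r' : T → Fin k) (a b : T → I → ℂ) :
    ∫ c, ∏ t, (a t ⬝ᵥ c (r t)) * star (b t ⬝ᵥ c (r' t)) ∂(gaussRows k I) =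
      ∑ π : Equiv.Perm T, ∏ t, if r t = r' (π t) then a t ⬝ᵥ star (b (π t)) else 0 := by
  classical
  have hi : ∀ g h : T → I, Integrable (fun c : Fin k → I → ℂ =>
      (∏ t, a t (g t) * star (b t (h t))) * ∏ t, c (r t) (g t) * star (c (r' t) (h t)))
        (gaussRows k I) := fun g h =>
    (integrable_monomial_rows (fun t => (r t, g t)) fun t => (r' t, h t)).const_mul _
  simp_rw [prod_dotProduct_rows]
  rw [integral_finsetSum _ fun g _ => integrable_finsetSum _ fun h _ => hi g h]
  have h1 : ∀ g : T → I, ∫ c : Fin k → I → ℂ, ∑ h : T → I, (∏ t, a t (g t) * star (b t (h t))) *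
      ∏ t, c (r t) (g t) * star (c (r' t) (h t)) ∂(gaussRows k I) =
      ∑ π : Equiv.Perm T, ∏ t, if r t = r' (π t) then a t (g t) * star (b (π t) (g t)) else 0 := by
    intro g
    rw [integral_finsetSum _ fun h _ => hi g h]
    have h2 : ∀ h : T → I, ∫ c : Fin k → I → ℂ, (∏ t, a t (g t) * star (b t (h t))) *
      ∏ t, c (r t) (g t) * star (c (r' t) (h t)) ∂(gaussRows k I) =
      ∑ π : Equiv.Perm T, ∏ t, if r t = r' (π t) ∧ g t = h (π t) then
        a t (g t) * star (b (π t) (h (π t))) else 0 := by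
      intro h
      rw [integral_const_mul,
        integral_monomial_rows (fun t => (r t, g t)) (fun t => (r' t, h t)), Finset.mul_sum]
      refine Finset.sum_congr rfl fun π _ => ?_
      rw [Finset.prod_mul_distrib, ← Equiv.prod_comp π fun t => star (b t (h t)),
        ← Finset.prod_mul_distrib]
      split_ifs with hc
      · rw [mul_one]
        refine Finset.prod_congr rfl fun t _ => ?_
        have := congrFun hc t
        simp only [Function.comp_apply, Prod.mk.injEq] at this
        rw [if_pos ⟨this.1.symm, this.2.symm⟩]
      · obtain ⟨t, ht⟩ := Function.ne_iff.1 hc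
        have hne : ¬ (r t = r' (π t) ∧ g t = h (π t)) := fun e => ht (Prod.ext e.1.symm e.2.symm)
        rw [mul_zero, Finset.prod_eq_zero (Finset.mem_univ t) (if_neg hne)]
    simp_rw [h2]
    rw [Finset.sum_comm]
    refine Finset.sum_congr rfl fun π _ => ?_
    -- After reindexing `h` by `π`, the matching condition forces the new index to equal `g`, and a
    -- single term survives.
    rw [← Equiv.sum_comp (Equiv.arrowCongr π (Equiv.refl I))]
    have h3 : ∀ h : T → I, ∀ t, (Equiv.arrowCongr π (Equiv.refl I) h) (π t) = h t := fun h t => by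
      simp
    simp_rw [h3]
    rw [Finset.sum_eq_single g]
    · simp
    · intro h _ hne
      obtain ⟨t, ht⟩ := Function.ne_iff.1 hne
      exact Finset.prod_eq_zero (Finset.mem_univ t) (if_neg fun h => ht h.2.symm)
    · exact fun h => absurd (Finset.mem_univ g) h
  simp_rw [h1]
  rw [Finset.sum_comm]
  refine Finset.sum_congr rfl fun π _ => ?_
  have h4 : ∀ t, (if r t = r' (π t) then a t ⬝ᵥ star (b (π t)) else 0) =
      ∑ i, if r t = r' (π t) then a t i * star (b (π t) i) else 0 := fun t => by
    split_ifs
    · rfl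
    · simp
  simp_rw [h4]
  rw [Finset.prod_univ_sum, Fintype.piFinset_univ]

end

/-! ### The conditional expectation as a polynomial in the covariance. -/

section
variable {n k m : ℕ}

/-- The expectation of `∏ₚ det (Xₚ Hₚ Xₚ^*)` for `k` independent Gaussian rows `(Xₚ)ₚ` of
covariance `Λ`, as a polynomial. -/
def wickPoly (k : ℕ) (Λ : Matrix (Fin n × Fin m) (Fin n × Fin m) ℂ)
    (H : Fin n → Matrix (Fin m) (Fin m) ℂ) : ℂ :=
  ∑ σ : Fin n → Equiv.Perm (Fin k), ∑ f : Fin n × Fin k → Fin m, ∑ f' : Fin n × Fin k → Fin m,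
    ((∏ p, ((Equiv.Perm.sign (σ p) : ℤ) : ℂ)) * ∏ t, H t.1 (f t) (f' t)) *
      ∑ π : Equiv.Perm (Fin n × Fin k), ∏ t,
        if σ t.1 t.2 = (π t).2 then Λ (t.1, f t) ((π t).1, f' (π t)) else 0

variable {I : Type*} [Fintype I]

/-- The matrices of the linear forms `a` evaluated on the rows `c`. -/
def formMat (a : Fin n → Fin m → I → ℂ) (c : Fin k → I → ℂ) (p : Fin n) :
    Matrix (Fin k) (Fin m) ℂ := of fun j q => a p q ⬝ᵥ c j

/-- In the Leibniz expansion of $\det(XHX^*)$ each entry is already a sum of one linear form times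
one conjugate form, so the result is ready for Wick's formula. -/
theorem prod_det_formMat (a : Fin n → Fin m → I → ℂ) (H : Fin n → Matrix (Fin m) (Fin m) ℂ)
    (c : Fin k → I → ℂ) :
    ∏ p, (formMat a c p * H p * (formMat a c p)ᴴ).det =
      ∑ σ : Fin n → Equiv.Perm (Fin k), ∑ f : Fin n × Fin k → Fin m, ∑ f' : Fin n × Fin k → Fin m,
        ((∏ p, ((Equiv.Perm.sign (σ p) : ℤ) : ℂ)) * ∏ t, H t.1 (f t) (f' t)) *
          ∏ t : Fin n × Fin k,
            (a t.1 (f t) ⬝ᵥ c (σ t.1 t.2)) * star (a t.1 (f' t) ⬝ᵥ c t.2) := by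
  simp only [det_apply']
  rw [Finset.prod_univ_sum, Fintype.piFinset_univ]
  refine Finset.sum_congr rfl fun σ _ => ?_
  have h1 : ∀ t : Fin n × Fin k,
      (formMat a c t.1 * H t.1 * (formMat a c t.1)ᴴ) (σ t.1 t.2) t.2 =
      ∑ q, ∑ q', (a t.1 q ⬝ᵥ c (σ t.1 t.2)) * H t.1 q q' * star (a t.1 q' ⬝ᵥ c t.2) := by
    intro t
    simp only [Matrix.mul_apply, formMat, conjTranspose_apply, of_apply, Finset.sum_mul]
    rw [Finset.sum_comm]
  rw [Finset.prod_mul_distrib, ← Fintype.prod_prod_type' (f := fun p i =>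
    (formMat a c p * H p * (formMat a c p)ᴴ) (σ p i) i)]
  simp_rw [h1]
  rw [Finset.prod_univ_sum, Fintype.piFinset_univ, Finset.mul_sum]
  refine Finset.sum_congr rfl fun f _ => ?_
  rw [Finset.prod_univ_sum, Fintype.piFinset_univ, Finset.mul_sum]
  refine Finset.sum_congr rfl fun f' _ => ?_
  simp only [Finset.prod_mul_distrib]
  ring

theorem integrable_prod_det_formMat (a : Fin n → Fin m → I → ℂ)
    (H : Fin n → Matrix (Fin m) (Fin m) ℂ) :
    Integrable (fun c : Fin k → I → ℂ => ∏ p, (formMat a c p * H p * (formMat a c p)ᴴ).det)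
      (gaussRows k I) := by
  simp_rw [prod_det_formMat]
  exact integrable_finsetSum _ fun σ _ => integrable_finsetSum _ fun f _ =>
    integrable_finsetSum _ fun f' _ => (integrable_prod_dotProduct_rows _ _ _ _).const_mul _

theorem integral_prod_det_formMat (a : Fin n → Fin m → I → ℂ)
    (H : Fin n → Matrix (Fin m) (Fin m) ℂ) :
    ∫ c : Fin k → I → ℂ, ∏ p, (formMat a c p * H p * (formMat a c p)ᴴ).det ∂(gaussRows k I) =
      wickPoly k (of fun t t' => a t.1 t.2 ⬝ᵥ star (a t'.1 t'.2)) H := by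
  have hi : ∀ (σ : Fin n → Equiv.Perm (Fin k)) (f f' : Fin n × Fin k → Fin m),
      Integrable (fun c : Fin k → I → ℂ =>
        ((∏ p, ((Equiv.Perm.sign (σ p) : ℤ) : ℂ)) * ∏ t, H t.1 (f t) (f' t)) *
          ∏ t : Fin n × Fin k,
            (a t.1 (f t) ⬝ᵥ c (σ t.1 t.2)) * star (a t.1 (f' t) ⬝ᵥ c t.2)) (gaussRows k I) :=
    fun σ f f' => (integrable_prod_dotProduct_rows _ _ _ _).const_mul _
  simp_rw [prod_det_formMat]
  rw [integral_finsetSum _ fun σ _ => integrable_finsetSum _ fun f _ =>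
    integrable_finsetSum _ fun f' _ => hi σ f f', wickPoly]
  refine Finset.sum_congr rfl fun σ _ => ?_
  rw [integral_finsetSum _ fun f _ => integrable_finsetSum _ fun f' _ => hi σ f f']
  refine Finset.sum_congr rfl fun f _ => ?_
  rw [integral_finsetSum _ fun f' _ => hi σ f f']
  refine Finset.sum_congr rfl fun f' _ => ?_
  rw [integral_const_mul, integral_prod_dotProduct_rows (fun t : Fin n × Fin k => σ t.1 t.2)
    (fun t => t.2) (fun t => a t.1 (f t)) (fun t => a t.1 (f' t))]
  rfl

theorem continuous_wickPoly :
    Continuous fun p : Matrix (Fin n × Fin m) (Fin n × Fin m) ℂ ×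
      (Fin n → Matrix (Fin m) (Fin m) ℂ) => wickPoly k p.1 p.2 := by
  unfold wickPoly
  refine continuous_finsetSum _ fun σ _ => continuous_finsetSum _ fun f _ =>
    continuous_finsetSum _ fun f' _ => Continuous.mul (continuous_const.mul ?_) ?_
  · refine continuous_finsetProd _ fun t _ => ?_
    exact ((continuous_apply t.1).comp continuous_snd).matrix_elem _ _
  · refine continuous_finsetSum _ fun π _ => continuous_finsetProd _ fun t _ => ?_
    split_ifs
    · exact continuous_fst.matrix_elem _ _
    · exact continuous_const

end

section
variable {I : Type*} [Fintype I] {k m n : ℕ} {φ : Aff m → I → ℂ}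

/-- The partial derivatives of the functions `φ`. -/
def partialVec (φ : Aff m → I → ℂ) (z : Aff m) (q : Fin m) : I → ℂ :=
  fun i => fderiv ℂ (fun z => φ z i) z (EuclideanSpace.single q 1)

theorem mat_fieldDer (c : Fin k → I → ℂ) (z : Aff m) :
    mat (fieldDer φ (c, z)) = of fun j q => partialVec φ z q ⬝ᵥ c j := by
  ext j q
  simp only [mat, fieldDer, partialVec, dotProduct, of_apply, ContinuousLinearMap.coe_pi',
    _root_.sum_apply, _root_.smul_apply, smul_eq_mul]
  exact Finset.sum_congr rfl fun i _ => mul_comm _ _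

theorem fsJac_eq_det (z : Aff m) (L : Aff m →L[ℂ] (Fin k → ℂ)) :
    ((fsJac z L : ℝ) : ℂ) = (mat L * fsDual z * (mat L)ᴴ).det := by
  have h := ((posDef_fsDual z).posSemidef.mul_mul_conjTranspose_same (mat L)).det_nonneg
  exact Complex.ext rfl (Complex.le_def.1 h).2

theorem prod_fsJac_rowMul (R : Matrix I I ℂ) (z : Fin n → Aff m) (c : Fin k → I → ℂ) :
    ((∏ p, fsJac (z p) (fieldDer φ (rowMul R c, z p)) : ℝ) : ℂ) =
      ∏ p, (formMat (fun p q => partialVec φ (z p) q ᵥ* R) c p * fsDual (z p) *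
        (formMat (fun p q => partialVec φ (z p) q ᵥ* R) c p)ᴴ).det := by
  rw [Complex.ofReal_prod]
  refine Finset.prod_congr rfl fun p _ => ?_
  have : mat (fieldDer φ (rowMul R c, z p)) =
      formMat (fun p q => partialVec φ (z p) q ᵥ* R) c p := by
    rw [mat_fieldDer]
    ext j q
    simp only [formMat, rowMul, of_apply, dotProduct_mulVec]
  rw [fsJac_eq_det, this]

/-- The covariance matrix of the derivatives at `z` of the field with coefficients multiplied
by `R`. -/
def derCov (φ : Aff m → I → ℂ) (R : Matrix I I ℂ) (z : Fin n → Aff m) :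
    Matrix (Fin n × Fin m) (Fin n × Fin m) ℂ :=
  of fun t t' => (partialVec φ (z t.1) t.2 ᵥ* R) ⬝ᵥ star (partialVec φ (z t'.1) t'.2 ᵥ* R)

theorem integrable_prod_fsJac (R : Matrix I I ℂ) (z : Fin n → Aff m) :
    Integrable (fun c : Fin k → I → ℂ => ∏ p, fsJac (z p) (fieldDer φ (rowMul R c, z p)))
      (gaussRows k I) := by
  have h := integrable_prod_det_formMat (k := k) (fun p q => partialVec φ (z p) q ᵥ* R)
    fun p => fsDual (z p)
  simp_rw [← prod_fsJac_rowMul] at h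
  exact h.re

theorem integral_prod_fsJac (R : Matrix I I ℂ) (z : Fin n → Aff m) :
    ((∫ c : Fin k → I → ℂ, ∏ p, fsJac (z p) (fieldDer φ (rowMul R c, z p)) ∂(gaussRows k I) : ℝ) :
      ℂ) = wickPoly k (derCov φ R z) fun p => fsDual (z p) := by
  rw [derCov, ← integral_prod_det_formMat (k := k) (fun p q => partialVec φ (z p) q ᵥ* R),
    ← integral_complex_ofReal]
  simp_rw [prod_fsJac_rowMul]

theorem lintegral_prod_kacRiceWeight (R : Matrix I I ℂ) (z : Fin n → Aff m) :
    ∫⁻ c : Fin k → I → ℂ, ∏ p, kacRiceWeight φ (rowMul R c, z p) ∂(gaussRows k I) =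
      (∏ p, ENNReal.ofReal (fsVolRatio (z p) ⊤)) *
        ENNReal.ofReal (wickPoly k (derCov φ R z) fun p => fsDual (z p)).re := by
  rw [← integral_prod_fsJac, Complex.ofReal_re, ofReal_integral_eq_lintegral_ofReal
    (integrable_prod_fsJac R z) (Eventually.of_forall fun c =>
      Finset.prod_nonneg fun p _ => fsJac_nonneg _ _), ← lintegral_const_mul']
  · refine lintegral_congr fun c => ?_
    rw [ENNReal.ofReal_prod_of_nonneg fun p _ => fsJac_nonneg _ _, ← Finset.prod_mul_distrib]
    exact Finset.prod_congr rfl fun p _ => ENNReal.ofReal_mul (fsVolRatio_top_pos _).le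
  · exact ENNReal.prod_ne_top fun p _ => ENNReal.ofReal_ne_top

theorem wickPoly_derCov_nonneg (k : ℕ) (R : Matrix I I ℂ) (z : Fin n → Aff m) :
    0 ≤ (wickPoly k (derCov φ R z) fun p => fsDual (z p)).re := by
  rw [← integral_prod_fsJac, Complex.ofReal_re]
  exact integral_nonneg fun c => Finset.prod_nonneg fun p _ => fsJac_nonneg _ _

end

/-! ### The polynomials as a field with multinomial basis. -/

section
variable {n k m N : ℕ}

/-- The homogeneous coordinates `(1, z)`. -/
def homCoord (z : Aff m) : Fin (m + 1) → ℂ := Fin.cons 1 fun q => z q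

/-- The orthonormal basis of the polynomials of degree `N`. -/
def suBasis (m N : ℕ) (z : Aff m) : Expo m N → ℂ := fun J =>
  (Real.sqrt (Nat.multinomial Finset.univ J.1) : ℂ) * ∏ i, homCoord z i ^ J.1 i

theorem contDiff_suBasis (J : Expo m N) : ContDiff ℂ 1 fun z => suBasis m N z J := by
  have h : ∀ i, ContDiff ℂ 1 fun z : Aff m => homCoord z i := by
    intro i
    refine Fin.cases ?_ (fun q => ?_) i
    · simp only [homCoord, Fin.cons_zero]
      exact contDiff_const
    · simp only [homCoord, Fin.cons_succ]
      exact (EuclideanSpace.proj (𝕜 := ℂ) q : Aff m →L[ℂ] ℂ).contDiff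
  exact contDiff_const.mul (contDiff_prod fun i _ => (h i).pow _)

theorem fieldVal_suBasis (c : Coeff k m N) : fieldVal (suBasis m N) c = tuple c := by
  funext z j
  simp only [fieldVal, dotProduct, suBasis, tuple, suPoly, homCoord]
  exact Finset.sum_congr rfl fun J _ => by ring

theorem fderiv_tuple (c : Coeff k m N) (z : Aff m) :
    fderiv ℂ (tuple c) z = fieldDer (suBasis m N) (c, z) := by
  rw [← fieldVal_suBasis]
  exact ((isFamily_field contDiff_suBasis).hasFDerivAt (c, z) (Set.mem_univ _)).fderiv

/-- The two weights agree only along the regular zeros, where `jac_mul_fsVolRatio` applies; this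
suffices as the underlying measures live there. -/
theorem zeroMeasure_eq (c : Coeff k m N) :
    zeroMeasure c = fieldKernel (contDiff_suBasis (m := m) (N := N)) c := by
  rw [fieldKernel_apply, IsFamily.kernel_apply, zeroMeasure]
  have hs : regZeros c =
      zsec (fieldVal (suBasis m N)) (regSet (fieldDer (suBasis m N)) Set.univ) c := by
    ext z
    simp only [regZeros, zsec, regSet, Set.mem_ofPred_eq, Set.mem_univ, true_and,
      fieldVal_suBasis, fderiv_tuple, and_comm]
  rw [hs]
  refine withDensity_congr_ae ?_
  have hF := isFamily_field (k := k) (contDiff_suBasis (m := m) (N := N))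
  refine (ae_restrict_iff' (hF.measurableSet_zsec hF.isOpen_regSet.measurableSet
    (fun p hp => hp.1) c)).2 (Eventually.of_forall fun z hz => ?_)
  have hsurj : Function.Surjective (fieldDer (suBasis m N) (c, z)) := hz.1.2
  have h := jac_mul_fsVolRatio z hsurj
  simp only [zeroWeight, fderiv_tuple]
  rw [← h, mul_div_cancel_left₀ _ (jac_pos hsurj).ne']

theorem coeffLaw_eq : coeffLaw k m N = gaussRows k (Expo m N) := rfl

/-- The multinomial theorem: the square roots of the coefficients are chosen so that the covariance
kernel is a pure power. -/
theorem suBasis_dotProduct_star (z w : Aff m) :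
    suBasis m N z ⬝ᵥ star (suBasis m N w) = (1 + ∑ q, z q * star (w q)) ^ N := by
  have h1 : 1 + ∑ q, z q * star (w q) = ∑ i, homCoord z i * star (homCoord w i) := by
    rw [Fin.sum_univ_succ]
    simp [homCoord]
  rw [h1, Finset.sum_pow_eq_sum_piAntidiag, ← Finset.sum_coe_sort]
  refine Finset.sum_congr rfl fun J _ => ?_
  simp only [suBasis, Pi.star_apply, star_mul', Complex.star_def, Complex.conj_ofReal, map_prod,
    map_pow, mul_pow, Finset.prod_mul_distrib]
  have : ((Real.sqrt (Nat.multinomial Finset.univ J.1) : ℝ) : ℂ) *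
      (Real.sqrt (Nat.multinomial Finset.univ J.1) : ℝ) = Nat.multinomial Finset.univ J.1 := by
    rw [← Complex.ofReal_mul, Real.mul_self_sqrt (Nat.cast_nonneg _), Complex.ofReal_natCast]
  linear_combination (∏ i, homCoord z i ^ J.1 i) *
    (∏ i, (starRingEnd ℂ) (homCoord w i) ^ J.1 i) * this

end

/-! ### Uniqueness of the correlation function. -/

section
variable {n k m : ℕ}

theorem isOpen_punctured : IsOpen (punctured n m) := by
  have : punctured n m = ⋂ p : Fin n, ⋂ q : Fin n, {z | p ≠ q → z p ≠ z q} := by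
    ext z
    simp only [punctured, Set.mem_ofPred_eq, Set.mem_iInter]
    exact ⟨fun h p q hpq hz => hpq (h hz), fun h p q hz => by_contra fun hpq => h p q hpq hz⟩
  rw [this]
  refine isOpen_iInter_of_finite fun p => isOpen_iInter_of_finite fun q => ?_
  by_cases hpq : p = q
  · simp [hpq]
  · simp only [ne_eq, hpq, not_false_eq_true, forall_const]
    exact isOpen_ne_fun (continuous_apply p) (continuous_apply q)

instance : SigmaFinite (fsVolume m) := SigmaFinite.withDensity_ofReal _

theorem measurable_fsVolRatio_top :
    Measurable fun z : Aff m => ENNReal.ofReal (fsVolRatio z ⊤) :=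
  continuous_fsVolRatio_top.measurable.ennreal_ofReal

instance : (fsVolume m).IsOpenPosMeasure := by
  have : (volume : Measure (Aff m)) ≪ fsVolume m :=
    withDensity_absolutelyContinuous' measurable_fsVolRatio_top.aemeasurable
      (Eventually.of_forall fun z => (ENNReal.ofReal_pos.2 (fsVolRatio_top_pos z)).ne')
  exact this.isOpenPosMeasure

theorem pi_fsVolume : (Measure.pi fun _ : Fin n => fsVolume m) =
    (Measure.pi fun _ : Fin n => (volume : Measure (Aff m))).withDensity
      fun z => ∏ p, ENNReal.ofReal (fsVolRatio (z p) ⊤) := by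
  have : SigmaFinite ((volume : Measure (Aff m)).withDensity
    fun z => ENNReal.ofReal (fsVolRatio z ⊤)) := SigmaFinite.withDensity_ofReal _
  exact pi_withDensity (volume : Measure (Aff m)) measurable_fsVolRatio_top

/-- The zero correlation function is unique on the punctured product. -/
theorem IsZeroCorrelation.eqOn {N : ℕ} {K K' : (Fin n → Aff m) → ℝ}
    (h : IsZeroCorrelation n k m N K) (h' : IsZeroCorrelation n k m N K') :
    Set.EqOn K K' (punctured n m) := by
  set μ := Measure.pi fun _ : Fin n => fsVolume m
  have hU := isOpen_punctured (n := n) (m := m)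
  -- Equal integrals over all measurable subsets give equality almost everywhere. Continuity
  -- upgrades it, since the volume charges open sets.
  have e : (fun z => ENNReal.ofReal (K z)) =ᵐ[μ.restrict (punctured n m)]
      fun z => ENNReal.ofReal (K' z) := by
    refine ae_eq_of_forall_setLIntegral_eq_of_sigmaFinite₀
      ((h.1.aemeasurable hU.measurableSet).ennreal_ofReal)
      ((h'.1.aemeasurable hU.measurableSet).ennreal_ofReal) fun s hs _ => ?_
    rw [Measure.restrict_restrict hs]
    have hsU := hs.inter hU.measurableSet
    rw [← (h.2.2 _ hsU Set.inter_subset_right).2, (h'.2.2 _ hsU Set.inter_subset_right).2]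
  have e2 : K =ᵐ[μ.restrict (punctured n m)] K' := by
    filter_upwards [e, ae_restrict_mem hU.measurableSet] with z hz hzU
    exact (ENNReal.ofReal_eq_ofReal_iff (h.2.1 z hzU) (h'.2.1 z hzU)).1 hz
  exact Measure.eqOn_open_of_ae_eq e2 hU h.1 h'.1

end

/-- The Hermitian product `⟨z, w⟩`, conjugate linear in `w`. -/
def hdot {m : ℕ} (z w : Aff m) : ℂ := ∑ q, z q * star (w q)

/-! ### Nondegeneracy of the covariance at distinct points. -/

section
variable {n m : ℕ}

theorem star_hdot (z w : Aff m) : star (hdot z w) = hdot w z := by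
  simp only [hdot, star_sum, star_mul', star_star]
  exact Finset.sum_congr rfl fun q _ => mul_comm _ _

theorem one_add_hdot (z w : Aff m) :
    1 + hdot z w = ∑ i, homCoord z i * star (homCoord w i) := by
  rw [Fin.sum_univ_succ]
  simp [homCoord, hdot]

/-- Powers of an inner product are inner products of tensor powers, so the quadratic form is a sum
of squares, indexed by tensor coordinates. -/
theorem sum_mul_star_mul_pow {X : Type*} [Fintype X] (v : Fin n → ℂ) (y : Fin n → X → ℂ) (N : ℕ) :
    ∑ p, ∑ q, v p * star (v q) * (∑ x, y p x * star (y q x)) ^ N =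
      ∑ g : Fin N → X, ((‖∑ p, v p * ∏ t, y p (g t)‖ ^ 2 : ℝ) : ℂ) := by
  have h : ∀ g : Fin N → X, ((‖∑ p, v p * ∏ t, y p (g t)‖ ^ 2 : ℝ) : ℂ) =
      ∑ p, ∑ q, v p * star (v q) * ∏ t, y p (g t) * star (y q (g t)) := by
    intro g
    rw [← Complex.normSq_eq_norm_sq, ← Complex.mul_conj, ← Complex.star_def, star_sum,
      Finset.sum_mul_sum]
    refine Finset.sum_congr rfl fun p _ => Finset.sum_congr rfl fun q _ => ?_
    simp only [Complex.star_def, map_mul, map_prod, Finset.prod_mul_distrib]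
    ring
  simp_rw [h]
  rw [Finset.sum_comm (s := (Finset.univ : Finset (Fin N → X)))]
  refine Finset.sum_congr rfl fun p _ => ?_
  rw [Finset.sum_comm (s := (Finset.univ : Finset (Fin N → X)))]
  refine Finset.sum_congr rfl fun q _ => ?_
  rw [← Finset.mul_sum, Fintype.sum_pow]

/-- Powers of degree `N` of linear forms separate `N + 1` points. -/
theorem eq_zero_of_sum_mul_prod_homCoord_eq_zero {z : Fin n → Aff m} (hz : Function.Injective z)
    {N : ℕ} (hN : n ≤ N + 1) {v : Fin n → ℂ}
    (hv : ∀ g : Fin N → Fin (m + 1), ∑ p, v p * ∏ t, homCoord (z p) (g t) = 0) : v = 0 := by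
  funext p₀
  have hcard : Fintype.card {q : Fin n // q ≠ p₀} ≤ Fintype.card (Fin N) := by
    rw [Fintype.card_subtype_compl, Fintype.card_fin, Fintype.card_fin,
      Fintype.card_subtype_eq]
    omega
  obtain ⟨e⟩ := Function.Embedding.nonempty_of_card_le hcard
  have hsep : ∀ q : {q : Fin n // q ≠ p₀}, ∃ i, z q i ≠ z p₀ i := fun q => by
    by_contra! h
    exact q.2 (hz (by ext i; exact h i))
  choose i hi using hsep
  -- A product of $N$ linear forms isolates $z_{p_0}$: for each other point $z_q$ one factor
  -- vanishes at $z_q$ but not at $z_{p_0}$, and the spare factors are the constant coordinate.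
  set b : Fin N → Fin (m + 1) → ℂ := Function.extend e
    (fun q => Pi.single (i q).succ 1 - z q (i q) • Pi.single 0 1) fun _ => Pi.single 0 1 with hb
  have hbe : ∀ q w, ∑ l, homCoord w l * b (e q) l = w (i q) - z q (i q) := by
    intro q w
    rw [hb, e.injective.extend_apply]
    simp only [Pi.sub_apply, Pi.smul_apply, mul_sub, Finset.sum_sub_distrib, smul_eq_mul,
      Pi.single_apply, mul_ite, mul_one, mul_zero, Finset.sum_ite_eq', Finset.mem_univ, if_true]
    simp [homCoord]
  have hbn : ∀ t w, (¬∃ q, e q = t) → ∑ l, homCoord (m := m) w l * b t l = 1 := by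
    intro t w ht
    rw [hb, Function.extend_apply' _ _ _ ht]
    simp [homCoord, Pi.single_apply]
  have hsum : ∑ p, v p * ∏ t, ∑ l, homCoord (z p) l * b t l = 0 := by
    simp only [Finset.prod_univ_sum, Fintype.piFinset_univ, Finset.mul_sum,
      Finset.prod_mul_distrib]
    rw [Finset.sum_comm]
    refine Finset.sum_eq_zero fun g _ => ?_
    simp only [← mul_assoc, ← Finset.sum_mul, hv, zero_mul]
  rw [Finset.sum_eq_single p₀] at hsum
  · refine (mul_eq_zero.1 hsum).resolve_right (Finset.prod_ne_zero_iff.2 fun t _ => ?_)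
    by_cases ht : ∃ q, e q = t
    · obtain ⟨q, rfl⟩ := ht
      rw [hbe, sub_ne_zero]
      exact (hi q).symm
    · rw [hbn t _ ht]
      exact one_ne_zero
  · intro p _ hp
    rw [Finset.prod_eq_zero (Finset.mem_univ (e ⟨p, hp⟩)), mul_zero]
    rw [hbe, sub_self]
  · exact fun h => absurd (Finset.mem_univ _) h

theorem eq_zero_of_sum_one_add_hdot_pow_eq_zero {z : Fin n → Aff m} (hz : Function.Injective z)
    {N : ℕ} (hN : n ≤ N + 1) {v : Fin n → ℂ}
    (hv : ∑ p, ∑ q, v p * star (v q) * (1 + hdot (z p) (z q)) ^ N = 0) : v = 0 := by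
  simp only [one_add_hdot] at hv
  rw [sum_mul_star_mul_pow v (fun p => homCoord (z p)) N, ← Complex.ofReal_sum,
    Complex.ofReal_eq_zero, Finset.sum_eq_zero_iff_of_nonneg fun _ _ => by positivity] at hv
  refine eq_zero_of_sum_mul_prod_homCoord_eq_zero hz hN fun g => ?_
  simpa using hv g (Finset.mem_univ g)

theorem exists_sum_eq_zero_of_det_eq_zero {A : Matrix (Fin n) (Fin n) ℂ} (h : A.det = 0) :
    ∃ v : Fin n → ℂ, v ≠ 0 ∧ ∑ p, ∑ q, v p * star (v q) * A p q = 0 := by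
  obtain ⟨v, hv0, hv⟩ := exists_vecMul_eq_zero_iff.2 h
  refine ⟨v, hv0, ?_⟩
  have : (v ᵥ* A) ⬝ᵥ star v = 0 := by rw [hv, zero_dotProduct]
  rw [← this, dotProduct, Finset.sum_comm]
  refine Finset.sum_congr rfl fun q _ => ?_
  rw [vecMul, dotProduct, Finset.sum_mul]
  exact Finset.sum_congr rfl fun p _ => by rw [Pi.star_apply]; ring

theorem det_one_add_hdot_pow_ne_zero {z : Fin n → Aff m} (hz : Function.Injective z)
    {N : ℕ} (hN : n ≤ N + 1) :
    (of fun p q => (1 + hdot (z p) (z q)) ^ N : Matrix (Fin n) (Fin n) ℂ).det ≠ 0 := by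
  intro h
  obtain ⟨v, hv0, hv⟩ := exists_sum_eq_zero_of_det_eq_zero h
  exact hv0 (eq_zero_of_sum_one_add_hdot_pow_eq_zero hz hN hv)

/-- In the exponential series every degree contributes a nonnegative quadratic form. If the total is
zero, each degree vanishes, hence so does the binomial combination $(1+\langle z,w\rangle)^n$,
already known to be nondegenerate. -/
theorem det_exp_hdot_ne_zero {z : Fin n → Aff m} (hz : Function.Injective z) :
    (of fun p q => Complex.exp (hdot (z p) (z q)) : Matrix (Fin n) (Fin n) ℂ).det ≠ 0 := by
  intro h
  obtain ⟨v, hv0, hv⟩ := exists_sum_eq_zero_of_det_eq_zero h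
  refine hv0 (eq_zero_of_sum_one_add_hdot_pow_eq_zero hz (N := n) (by omega) ?_)
  set S : ℕ → ℂ := fun j => ∑ p, ∑ q, v p * star (v q) * hdot (z p) (z q) ^ j with hS
  have hS0 : ∀ j, S j = (((S j).re : ℝ) : ℂ) ∧ 0 ≤ (S j).re := by
    intro j
    have : S j = ((∑ g : Fin j → Fin m, ‖∑ p, v p * ∏ t, z p (g t)‖ ^ 2 : ℝ) : ℂ) := by
      rw [Complex.ofReal_sum]
      exact sum_mul_star_mul_pow v (fun p q => z p q) j
    rw [this, Complex.ofReal_re]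
    exact ⟨rfl, Finset.sum_nonneg fun _ _ => by positivity⟩
  have hsum : HasSum (fun j : ℕ => S j / j.factorial) 0 := by
    have h0 : ∀ x : ℂ, HasSum (fun j : ℕ => x ^ j / (j.factorial : ℂ)) (Complex.exp x) := fun x => by
      rw [Complex.exp_eq_exp_ℂ]
      exact NormedSpace.expSeries_div_hasSum_exp x
    have h2 : HasSum (fun j : ℕ => ∑ p, ∑ q, v p * star (v q) *
        (hdot (z p) (z q) ^ j / (j.factorial : ℂ)))
        (∑ p, ∑ q, v p * star (v q) * Complex.exp (hdot (z p) (z q))) :=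
      hasSum_sum fun p _ => hasSum_sum fun q _ => (h0 _).mul_left _
    have h3 : (fun j : ℕ => S j / (j.factorial : ℂ)) = fun j : ℕ => ∑ p, ∑ q, v p * star (v q) *
        (hdot (z p) (z q) ^ j / (j.factorial : ℂ)) := by
      funext j
      simp only [hS, Finset.sum_div, mul_div_assoc]
    rw [h3]
    exact hv ▸ h2
  have hre : ∀ j : ℕ, (S j / j.factorial).re = (S j).re / j.factorial := fun j => by
    rw [(hS0 j).1, ← Complex.ofReal_natCast, ← Complex.ofReal_div, Complex.ofReal_re,
      Complex.ofReal_re]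
  have hsum' : HasSum (fun j : ℕ => (S j).re / j.factorial) 0 := by
    have := Complex.hasSum_re hsum
    simpa only [hre, Complex.zero_re] using this
  have hz0 := (hasSum_zero_iff_of_nonneg fun j => div_nonneg (hS0 j).2 (Nat.cast_nonneg _)).1 hsum'
  have hSz : ∀ j, S j = 0 := fun j => by
    have := congrFun hz0 j
    simp only [Pi.zero_apply, div_eq_zero_iff, Nat.cast_eq_zero, Nat.factorial_ne_zero,
      or_false] at this
    rw [(hS0 j).1, this, Complex.ofReal_zero]
  have hexp : ∑ p, ∑ q, v p * star (v q) * (1 + hdot (z p) (z q)) ^ n =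
      ∑ j ∈ Finset.range (n + 1), (n.choose j : ℂ) * S j := by
    have h1 : ∀ p q, v p * star (v q) * (1 + hdot (z p) (z q)) ^ n = ∑ j ∈ Finset.range (n + 1),
        (n.choose j : ℂ) * (v p * star (v q) * hdot (z p) (z q) ^ j) := fun p q => by
      rw [add_comm, add_pow, Finset.mul_sum]
      exact Finset.sum_congr rfl fun j _ => by rw [one_pow]; ring
    simp only [h1, hS, Finset.mul_sum]
    rw [Finset.sum_comm (s := Finset.range (n + 1))]
    exact Finset.sum_congr rfl fun p _ => Finset.sum_comm
  rw [hexp]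
  exact Finset.sum_eq_zero fun j _ => by rw [hSz, mul_zero]

end

/-! ### Covariances of derivatives, and existence of the correlation function. -/

section
variable {I : Type*} [Fintype I] [DecidableEq I] {k m n : ℕ} {φ : Aff m → I → ℂ}

/-- The derivatives at `z` of the functions `φ`. -/
def partialMat (φ : Aff m → I → ℂ) (z : Fin n → Aff m) : Matrix (Fin n × Fin m) I ℂ :=
  of fun t => partialVec φ (z t.1) t.2

omit [DecidableEq I] in
theorem derCov_eq (R : Matrix I I ℂ) (z : Fin n → Aff m) :
    derCov φ R z = partialMat φ z * R * (partialMat φ z * R)ᴴ := rfl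

omit [DecidableEq I] in
theorem conjTranspose_gram {P : Matrix I I ℂ} (hP : Pᴴ = P) (z : Fin n → Aff m) :
    (gram φ P z)ᴴ = gram φ P z := by
  simp [gram, hP, Matrix.mul_assoc]

/-- The covariance of the derivatives conditioned on the vanishing of the field is a Schur
complement. -/
theorem derCov_resProj {z : Fin n → Aff m} (hdet : (gram φ 1 z).det ≠ 0) :
    derCov φ (resProj φ 1 z) z = partialMat φ z * (partialMat φ z)ᴴ -
      partialMat φ z * (basisMat φ z)ᴴ * (gram φ 1 z)⁻¹ *
        (partialMat φ z * (basisMat φ z)ᴴ)ᴴ := by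
  set R := resProj φ 1 z with hR
  have hRd : R = 1 - (basisMat φ z)ᴴ * (gram φ 1 z)⁻¹ * basisMat φ z := by
    rw [hR, resProj, Matrix.one_mul, Matrix.mul_one]
  have hRH : Rᴴ = R := by
    rw [hRd, conjTranspose_sub, conjTranspose_mul, conjTranspose_mul, conjTranspose_conjTranspose,
      conjTranspose_one, conjTranspose_nonsing_inv, conjTranspose_gram conjTranspose_one,
      Matrix.mul_assoc]
  have h0 : basisMat φ z * R = 0 := basisMat_mul_resProj hdet
  have hRR : R * R = R := by
    nth_rewrite 1 [hRd]
    rw [Matrix.sub_mul, Matrix.one_mul, Matrix.mul_assoc _ (basisMat φ z), h0, Matrix.mul_zero,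
      sub_zero]
  rw [derCov_eq, conjTranspose_mul, hRH, Matrix.mul_assoc, ← Matrix.mul_assoc R, hRR, hRd,
    Matrix.sub_mul, Matrix.mul_sub, Matrix.one_mul, conjTranspose_mul, conjTranspose_conjTranspose]
  simp only [Matrix.mul_assoc]

omit [DecidableEq I] in
-- Covariances involving derivatives are obtained by differentiating the covariance kernel, rather
-- than by summing over monomials.
theorem fderiv_dotProduct_star (hφ : ∀ i, ContDiff ℂ 1 fun z => φ z i) (z : Aff m) (q : Fin m)
    (v : I → ℂ) : partialVec φ z q ⬝ᵥ v =
      fderiv ℂ (fun z => φ z ⬝ᵥ v) z (EuclideanSpace.single q 1) := by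
  rw [(hasFDerivAt_dotProduct hφ v z).fderiv]
  simp only [partialVec, dotProduct, _root_.sum_apply, _root_.smul_apply, smul_eq_mul]
  exact Finset.sum_congr rfl fun i _ => mul_comm _ _

end

section
variable {k m n N : ℕ}

theorem hasFDerivAt_hdot (w z : Aff m) :
    HasFDerivAt (fun z => hdot z w)
      (∑ q, star (w q) • (EuclideanSpace.proj (𝕜 := ℂ) q : Aff m →L[ℂ] ℂ)) z :=
  HasFDerivAt.fun_sum fun q _ =>
    (EuclideanSpace.proj (𝕜 := ℂ) q : Aff m →L[ℂ] ℂ).hasFDerivAt.mul_const (star (w q))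

theorem hasFDerivAt_one_add_hdot_pow (w z : Aff m) (N : ℕ) :
    HasFDerivAt (fun z => (1 + hdot z w) ^ N) ((N * (1 + hdot z w) ^ (N - 1)) •
      (∑ q, star (w q) • (EuclideanSpace.proj (𝕜 := ℂ) q : Aff m →L[ℂ] ℂ))) z := by
  have h := ((hasFDerivAt_hdot w z).const_add 1).pow N
  simpa using h

theorem partialVec_dotProduct_suBasis (z w : Aff m) (q : Fin m) :
    partialVec (suBasis m N) z q ⬝ᵥ star (suBasis m N w) =
      N * (1 + hdot z w) ^ (N - 1) * star (w q) := by
  rw [fderiv_dotProduct_star contDiff_suBasis]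
  simp only [suBasis_dotProduct_star]
  have h := (hasFDerivAt_one_add_hdot_pow w z N).fderiv
  simp only [hdot] at h ⊢
  rw [h]
  simp

/-- The derivative in $w$ comes from the mixed covariance by conjugate symmetry, and is then
differentiated in $z$. For $N\le1$ the truncated exponent is harmless because its coefficient is
zero. -/
theorem partialVec_dotProduct_partialVec (z w : Aff m) (a b : Fin m) :
    partialVec (suBasis m N) z a ⬝ᵥ star (partialVec (suBasis m N) w b) =
      N * ((N - 1 : ℕ) * (1 + hdot z w) ^ (N - 1 - 1)) * (star (w a) * z b) +
        N * (1 + hdot z w) ^ (N - 1) * (if a = b then 1 else 0) := by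
  rw [fderiv_dotProduct_star contDiff_suBasis]
  have h1 : (fun z => suBasis m N z ⬝ᵥ star (partialVec (suBasis m N) w b)) =
      fun z => N * (1 + hdot z w) ^ (N - 1) * z b := by
    funext z
    rw [dotProduct_star, partialVec_dotProduct_suBasis]
    simp only [star_mul', star_pow, star_add, star_one, star_hdot, star_star, star_natCast]
  rw [h1]
  have h2 := ((hasFDerivAt_one_add_hdot_pow w z (N - 1)).const_mul (N : ℂ)).mul
    (EuclideanSpace.proj (𝕜 := ℂ) b : Aff m →L[ℂ] ℂ).hasFDerivAt
  have h3 := h2.fderiv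
  change fderiv ℂ (fun z : Aff m => N * (1 + hdot z w) ^ (N - 1) * z b) z = _ at h3
  rw [h3]
  simp only [_root_.add_apply, _root_.smul_apply, smul_eq_mul]
  simp [eq_comm]
  ring

/-- The covariance of the values of a polynomial of degree `N`. -/
def covVal (N : ℕ) (z : Fin n → Aff m) : Matrix (Fin n) (Fin n) ℂ :=
  of fun p q => (1 + hdot (z p) (z q)) ^ N

/-- The covariance of the derivatives and the values of a polynomial of degree `N`. -/
def covDerVal (N : ℕ) (z : Fin n → Aff m) : Matrix (Fin n × Fin m) (Fin n) ℂ :=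
  of fun t q => N * (1 + hdot (z t.1) (z q)) ^ (N - 1) * star (z q t.2)

/-- The covariance of the derivatives of a polynomial of degree `N`. -/
def covDer (N : ℕ) (z : Fin n → Aff m) : Matrix (Fin n × Fin m) (Fin n × Fin m) ℂ :=
  of fun t t' => N * ((N - 1 : ℕ) * (1 + hdot (z t.1) (z t'.1)) ^ (N - 1 - 1)) *
    (star (z t'.1 t.2) * z t.1 t'.2) +
      N * (1 + hdot (z t.1) (z t'.1)) ^ (N - 1) * (if t.2 = t'.2 then 1 else 0)

/-- The Kac–Rice density in terms of the covariances. -/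
def density (k : ℕ) (A : Matrix (Fin n) (Fin n) ℂ) (B : Matrix (Fin n × Fin m) (Fin n) ℂ)
    (C : Matrix (Fin n × Fin m) (Fin n × Fin m) ℂ) (H : Fin n → Matrix (Fin m) (Fin m) ℂ) : ℝ :=
  ((Real.pi ^ n * A.det.re)⁻¹) ^ k * (wickPoly k (C - B * A⁻¹ * Bᴴ) H).re

theorem gram_suBasis (z : Fin n → Aff m) : gram (suBasis m N) 1 z = covVal N z := by
  ext p q
  rw [gram_apply, condVec, one_mulVec, suBasis_dotProduct_star]
  rfl

theorem partialMat_mul_basisMat (z : Fin n → Aff m) :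
    partialMat (suBasis m N) z * (basisMat (suBasis m N) z)ᴴ = covDerVal N z := by
  ext t q
  exact partialVec_dotProduct_suBasis _ _ _

theorem partialMat_mul_partialMat (z : Fin n → Aff m) :
    partialMat (suBasis m N) z * (partialMat (suBasis m N) z)ᴴ = covDer N z := by
  ext t q
  exact partialVec_dotProduct_partialVec _ _ _ _

theorem det_covVal_ne_zero {z : Fin n → Aff m} (hz : z ∈ punctured n m) (hN : n ≤ N + 1) :
    (covVal N z).det ≠ 0 := det_one_add_hdot_pow_ne_zero hz hN

theorem det_covVal_re_nonneg (z : Fin n → Aff m) : 0 ≤ (covVal N z).det.re := by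
  rw [← gram_suBasis, gram, Matrix.mul_one]
  exact (Complex.le_def.1 (posSemidef_self_mul_conjTranspose _).det_nonneg).1

theorem det_covVal_re_ne_zero {z : Fin n → Aff m} (hz : z ∈ punctured n m) (hN : n ≤ N + 1) :
    (covVal N z).det.re ≠ 0 := by
  intro h
  refine det_covVal_ne_zero hz hN (Complex.ext h ?_)
  refine im_det_eq_zero ?_
  rw [← gram_suBasis]
  exact conjTranspose_gram conjTranspose_one z

theorem tendsto_matrix_mul {α a b c : Type*} [Fintype b] {l : Filter α} {A : α → Matrix a b ℂ}
    {B : α → Matrix b c ℂ} {A' : Matrix a b ℂ} {B' : Matrix b c ℂ} (hA : Tendsto A l (𝓝 A'))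
    (hB : Tendsto B l (𝓝 B')) : Tendsto (fun x => A x * B x) l (𝓝 (A' * B')) := by
  refine tendsto_pi_nhds.2 fun i => tendsto_pi_nhds.2 fun j => ?_
  exact tendsto_finsetSum _ fun q _ => (tendsto_pi_nhds.1 (tendsto_pi_nhds.1 hA i) q).mul
    (tendsto_pi_nhds.1 (tendsto_pi_nhds.1 hB q) j)

theorem continuousAt_matrix_inv {A : Matrix (Fin n) (Fin n) ℂ} (hdet : A.det ≠ 0) :
    ContinuousAt (fun A : Matrix (Fin n) (Fin n) ℂ => A⁻¹) A := by
  have hd : Continuous fun A : Matrix (Fin n) (Fin n) ℂ => A.det := continuous_id.matrix_det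
  have ha : Continuous fun A : Matrix (Fin n) (Fin n) ℂ => A.adjugate :=
    continuous_id.matrix_adjugate
  have he : (fun A : Matrix (Fin n) (Fin n) ℂ => A⁻¹) = fun A => A.det⁻¹ • A.adjugate := by
    funext A
    rw [inv_def, Ring.inverse_eq_inv']
  rw [he]
  exact (hd.continuousAt.inv₀ hdet).smul ha.continuousAt

theorem tendsto_matrix_inv {α : Type*} {l : Filter α} {A : α → Matrix (Fin n) (Fin n) ℂ}
    {A' : Matrix (Fin n) (Fin n) ℂ} (hA : Tendsto A l (𝓝 A')) (hdet : A'.det ≠ 0) :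
    Tendsto (fun x => (A x)⁻¹) l (𝓝 A'⁻¹) :=
  Tendsto.comp (g := fun A : Matrix (Fin n) (Fin n) ℂ => A⁻¹) (continuousAt_matrix_inv hdet) hA

theorem tendsto_schur {α : Type*} {l : Filter α} {A : α → Matrix (Fin n) (Fin n) ℂ}
    {B : α → Matrix (Fin n × Fin m) (Fin n) ℂ} {C : α → Matrix (Fin n × Fin m) (Fin n × Fin m) ℂ}
    {A' : Matrix (Fin n) (Fin n) ℂ} {B' : Matrix (Fin n × Fin m) (Fin n) ℂ}
    {C' : Matrix (Fin n × Fin m) (Fin n × Fin m) ℂ}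
    (hA : Tendsto A l (𝓝 A')) (hB : Tendsto B l (𝓝 B')) (hC : Tendsto C l (𝓝 C'))
    (hdet : A'.det ≠ 0) : Tendsto (fun x => C x - B x * (A x)⁻¹ * (B x)ᴴ) l
      (𝓝 (C' - B' * A'⁻¹ * B'ᴴ)) := by
  have hBH : Tendsto (fun x => (B x)ᴴ) l (𝓝 B'ᴴ) :=
    ((continuous_id.matrix_conjTranspose).tendsto B').comp hB
  exact hC.sub (tendsto_matrix_mul (tendsto_matrix_mul hB (tendsto_matrix_inv hA hdet)) hBH)

theorem tendsto_density {α : Type*} {l : Filter α} {A : α → Matrix (Fin n) (Fin n) ℂ}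
    {B : α → Matrix (Fin n × Fin m) (Fin n) ℂ}
    {C : α → Matrix (Fin n × Fin m) (Fin n × Fin m) ℂ} {H : α → Fin n → Matrix (Fin m) (Fin m) ℂ}
    {A' : Matrix (Fin n) (Fin n) ℂ} {B' : Matrix (Fin n × Fin m) (Fin n) ℂ}
    {C' : Matrix (Fin n × Fin m) (Fin n × Fin m) ℂ} {H' : Fin n → Matrix (Fin m) (Fin m) ℂ}
    (hA : Tendsto A l (𝓝 A')) (hB : Tendsto B l (𝓝 B')) (hC : Tendsto C l (𝓝 C'))
    (hH : Tendsto H l (𝓝 H')) (hdet : A'.det.re ≠ 0) :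
    Tendsto (fun x => density k (A x) (B x) (C x) (H x)) l (𝓝 (density k A' B' C' H')) := by
  have hΛ := tendsto_schur hA hB hC fun h => hdet (by rw [h]; rfl)
  have hc : Continuous fun p : Matrix (Fin n × Fin m) (Fin n × Fin m) ℂ ×
      (Fin n → Matrix (Fin m) (Fin m) ℂ) => (wickPoly k p.1 p.2).re :=
    Complex.continuous_re.comp continuous_wickPoly
  have hw := (hc.tendsto (C' - B' * A'⁻¹ * B'ᴴ, H')).comp (hΛ.prodMk_nhds hH)
  have hdc : Continuous fun A : Matrix (Fin n) (Fin n) ℂ => A.det.re :=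
    Complex.continuous_re.comp continuous_id.matrix_det
  have hre := (hdc.tendsto A').comp hA
  have hinv := ((hre.const_mul (Real.pi ^ n)).inv₀
    (mul_ne_zero (pow_ne_zero _ Real.pi_ne_zero) hdet)).pow k
  exact hinv.mul hw

/-- The zero correlation function of random polynomials. -/
def corrFun (k N : ℕ) (z : Fin n → Aff m) : ℝ :=
  density k (covVal N z) (covDerVal N z) (covDer N z) fun p => fsDual (z p)

theorem corrFun_eq {z : Fin n → Aff m} (hz : z ∈ punctured n m) (hN : n ≤ N + 1) :
    corrFun k N z = ((Real.pi ^ n * (gram (suBasis m N) 1 z).det.re)⁻¹) ^ k *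
      (wickPoly k (derCov (suBasis m N) (resProj (suBasis m N) 1 z) z) fun p => fsDual (z p)).re := by
  have hd : (gram (suBasis m N) 1 z).det ≠ 0 := by
    rw [gram_suBasis]; exact det_covVal_ne_zero hz hN
  rw [derCov_resProj hd, partialMat_mul_basisMat, partialMat_mul_partialMat, gram_suBasis]
  rfl

theorem corrFun_nonneg {z : Fin n → Aff m} (hz : z ∈ punctured n m) (hN : n ≤ N + 1) :
    0 ≤ corrFun k N z := by
  rw [corrFun_eq hz hN]
  refine mul_nonneg (pow_nonneg (inv_nonneg.2 (mul_nonneg (pow_nonneg Real.pi_pos.le _) ?_)) _)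
    (wickPoly_derCov_nonneg _ _ _)
  rw [gram_suBasis]
  exact det_covVal_re_nonneg z

theorem continuousOn_corrFun (hN : n ≤ N + 1) :
    ContinuousOn (corrFun (n := n) (m := m) k N) (punctured n m) := by
  intro z hz
  refine ContinuousAt.continuousWithinAt ?_
  have hh : ∀ p q : Fin n, Continuous fun z : Fin n → Aff m => hdot (z p) (z q) := fun p q => by
    unfold hdot
    fun_prop
  have hA : Continuous fun z : Fin n → Aff m => covVal N z :=
    continuous_matrix fun p q => (continuous_const.add (hh p q)).pow N
  have hB : Continuous fun z : Fin n → Aff m => covDerVal N z :=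
    continuous_matrix fun t q => by
      have := hh t.1 q
      simp only [covDerVal, of_apply]
      fun_prop
  have hC : Continuous fun z : Fin n → Aff m => covDer N z :=
    continuous_matrix fun t t' => by
      have := hh t.1 t'.1
      simp only [covDer, of_apply]
      fun_prop
  have hH : Continuous fun (z : Fin n → Aff m) p => fsDual (z p) :=
    continuous_pi fun p => continuous_fsDual.comp (continuous_apply p)
  exact tendsto_density (hA.tendsto z) (hB.tendsto z) (hC.tendsto z) (hH.tendsto z)
    (det_covVal_re_ne_zero hz hN)

/-- This is `kacRice_pi` for unconditioned coefficients and the indicator of `A`. The condition on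
degenerate configurations holds because the points of `A` are distinct and $n\le N+1$; the volume
ratios match the density of the product Fubini–Study volume. -/
theorem isZeroCorrelation_corrFun (hN : n ≤ N + 1) :
    IsZeroCorrelation n k m N (corrFun k N) := by
  refine ⟨continuousOn_corrFun hN, fun z hz => corrFun_nonneg hz hN, fun A hA hAU => ?_⟩
  have hφ := contDiff_suBasis (m := m) (N := N)
  set G : Coeff k m N × (Fin n → Aff m) → ENNReal := fun p => A.indicator 1 p.2 with hG
  have hGm : Measurable G := (measurable_one.indicator hA).comp measurable_snd
  have h1 : ∀ c : Coeff k m N, Measure.pi (fun _ : Fin n => zeroMeasure c) A =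
      ∫⁻ z, G (c, z) ∂(Measure.pi fun _ : Fin n => fieldKernel hφ c) := fun c => by
    simp only [hG, zeroMeasure_eq]
    rw [lintegral_indicator_one hA]
  simp_rw [h1]
  refine ⟨(measurable_lintegral_pi (fieldKernel hφ) hGm).aemeasurable, ?_⟩
  have hone : ∀ c : Coeff k m N, rowMul 1 c = c := fun c => by
    funext j
    exact one_mulVec _
  have hkr := kacRice_pi (k := k) hφ (n := n) (P := 1) conjTranspose_one (Matrix.mul_one 1) hGm
    fun c z hz => by
      by_contra h
      have hzA : z ∈ A := by
        by_contra hzA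
        exact h (Set.indicator_of_notMem hzA _)
      rw [gram_suBasis] at hz
      exact det_covVal_ne_zero (hAU hzA) hN hz
  simp only [hone] at hkr
  have hpos : ∀ z : Fin n → Aff m,
      0 ≤ (Real.pi ^ n * (gram (suBasis m N) 1 z).det.re)⁻¹ := fun z => by
    rw [gram_suBasis]
    exact inv_nonneg.2 (mul_nonneg (pow_nonneg Real.pi_pos.le _) (det_covVal_re_nonneg z))
  rw [coeffLaw_eq, hkr, pi_fsVolume, ← lintegral_indicator hA, lintegral_withDensity_eq_lintegral_mul₀']
  · refine lintegral_congr fun z => ?_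
    by_cases hzA : z ∈ A
    · simp only [hG, Set.indicator_of_mem hzA, Pi.one_apply, mul_one, Pi.mul_apply]
      rw [lintegral_prod_kacRiceWeight, corrFun_eq (hAU hzA) hN, ENNReal.ofReal_mul,
        ENNReal.ofReal_pow]
      · ring
      · exact hpos z
      · exact pow_nonneg (hpos z) _
    · simp [hG, Set.indicator_of_notMem hzA]
  · exact (Finset.measurable_fun_prod _ fun p _ =>
      measurable_fsVolRatio_top.comp (measurable_pi_apply p)).aemeasurable
  · refine (aemeasurable_indicator_iff hA).2 (AEMeasurable.ennreal_ofReal ?_)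
    exact (ContinuousOn.aemeasurable (continuousOn_corrFun hN)
      isOpen_punctured.measurableSet).mono_measure (Measure.restrict_mono hAU le_rfl)

end

/-! ### The scaling limit. -/

section
variable {k m n : ℕ}

theorem wickPoly_smul (r : ℂ) (Λ : Matrix (Fin n × Fin m) (Fin n × Fin m) ℂ)
    (H : Fin n → Matrix (Fin m) (Fin m) ℂ) :
    wickPoly k (r • Λ) H = r ^ (n * k) * wickPoly k Λ H := by
  unfold wickPoly
  simp only [Finset.mul_sum]
  refine Finset.sum_congr rfl fun σ _ => Finset.sum_congr rfl fun f _ =>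
    Finset.sum_congr rfl fun f' _ => Finset.sum_congr rfl fun π _ => ?_
  have h : ∀ t : Fin n × Fin k, (if σ t.1 t.2 = (π t).2 then
      (r • Λ) (t.1, f t) ((π t).1, f' (π t)) else 0) =
      r * if σ t.1 t.2 = (π t).2 then Λ (t.1, f t) ((π t).1, f' (π t)) else 0 := fun t => by
    split_ifs <;> simp
  simp_rw [h]
  rw [Finset.prod_mul_distrib, Finset.prod_const, Finset.card_univ, Fintype.card_prod,
    Fintype.card_fin, Fintype.card_fin]
  ring

/-- The expectation has degree $nk$ in the derivative covariance. With $r=\sqrt N$ this turns the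
factor $N^{-nk}$ into the normalisation of each derivative by $\sqrt N$. -/
theorem density_smul {r : ℝ} (hr : r ≠ 0) (A : Matrix (Fin n) (Fin n) ℂ)
    (B : Matrix (Fin n × Fin m) (Fin n) ℂ) (C : Matrix (Fin n × Fin m) (Fin n × Fin m) ℂ)
    (H : Fin n → Matrix (Fin m) (Fin m) ℂ) :
    density k A ((r : ℂ)⁻¹ • B) (((r : ℂ) ^ 2)⁻¹ • C) H =
      ((r ^ 2) ^ (n * k))⁻¹ * density k A B C H := by
  have hr' : (r : ℂ) ≠ 0 := by exact_mod_cast hr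
  have h : ((r : ℂ) ^ 2)⁻¹ • C - ((r : ℂ)⁻¹ • B) * A⁻¹ * ((r : ℂ)⁻¹ • B)ᴴ =
      ((((r ^ 2)⁻¹ : ℝ)) : ℂ) • (C - B * A⁻¹ * Bᴴ) := by
    rw [conjTranspose_smul, Matrix.smul_mul, Matrix.smul_mul, Matrix.mul_smul, smul_smul, smul_sub,
      star_inv₀, Complex.star_def, Complex.conj_ofReal]
    push_cast
    congr 2
    field_simp
  rw [density, density, h, wickPoly_smul, ← Complex.ofReal_pow, Complex.re_ofReal_mul, inv_pow]
  ring

/-- The limit of the covariance of the values. -/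
def limVal (z : Fin n → Aff m) : Matrix (Fin n) (Fin n) ℂ :=
  of fun p q => Complex.exp (hdot (z p) (z q))

/-- The limit of the covariance of the derivatives and the values. -/
def limDerVal (z : Fin n → Aff m) : Matrix (Fin n × Fin m) (Fin n) ℂ :=
  of fun t q => Complex.exp (hdot (z t.1) (z q)) * star (z q t.2)

/-- The limit of the covariance of the derivatives. -/
def limDer (z : Fin n → Aff m) : Matrix (Fin n × Fin m) (Fin n × Fin m) ℂ :=
  of fun t t' => Complex.exp (hdot (z t.1) (z t'.1)) *
    (star (z t'.1 t.2) * z t.1 t'.2 + if t.2 = t'.2 then 1 else 0)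

/-- The scaling limit of the zero correlation functions. -/
def limFun (k : ℕ) (z : Fin n → Aff m) : ℝ :=
  density k (limVal z) (limDerVal z) (limDer z) fun _ => 1

theorem conjTranspose_limVal (z : Fin n → Aff m) : (limVal z)ᴴ = limVal z := by
  ext p q
  rw [conjTranspose_apply, limVal, of_apply, of_apply, ← star_hdot (z q) (z p), Complex.star_def]
  exact (Complex.exp_conj _).symm

theorem det_limVal_ne_zero {z : Fin n → Aff m} (hz : z ∈ punctured n m) : (limVal z).det ≠ 0 :=
  det_exp_hdot_ne_zero hz

theorem det_limVal_re_ne_zero {z : Fin n → Aff m} (hz : z ∈ punctured n m) :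
    (limVal z).det.re ≠ 0 := fun h =>
  det_limVal_ne_zero hz (Complex.ext h (im_det_eq_zero (conjTranspose_limVal z)))

/-- The rescaling `z / √N`. -/
def rescale (N : ℕ) (z : Fin n → Aff m) : Fin n → Aff m :=
  fun p => (((Real.sqrt N)⁻¹ : ℝ) : ℂ) • z p

theorem hdot_rescale (N : ℕ) (z : Fin n → Aff m) (p q : Fin n) :
    hdot (rescale N z p) (rescale N z q) = hdot (z p) (z q) / N := by
  simp only [hdot, rescale, PiLp.smul_apply, smul_eq_mul, star_mul', Complex.star_def,
    Complex.conj_ofReal, Finset.sum_div]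
  refine Finset.sum_congr rfl fun i _ => ?_
  have : (((Real.sqrt N)⁻¹ : ℝ) : ℂ) * ((Real.sqrt N)⁻¹ : ℝ) = (N : ℂ)⁻¹ := by
    rw [← Complex.ofReal_mul, ← mul_inv, Real.mul_self_sqrt (Nat.cast_nonneg _)]
    push_cast
    rfl
  rw [div_eq_mul_inv, ← this]
  ring

theorem rescale_mem_punctured {N : ℕ} (hN : 0 < N) {z : Fin n → Aff m} (hz : z ∈ punctured n m) :
    rescale N z ∈ punctured n m := by
  have h : (((Real.sqrt N)⁻¹ : ℝ) : ℂ) ≠ 0 := by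
    have : 0 < Real.sqrt N := Real.sqrt_pos.2 (by exact_mod_cast hN)
    exact_mod_cast (inv_pos.2 this).ne'
  intro p q hpq
  exact hz (smul_right_injective _ h hpq)

theorem isZeroCorrelation_zeroCorrelation {N : ℕ} (hN : n ≤ N + 1) :
    IsZeroCorrelation n k m N (zeroCorrelation n k m N) := by
  have hex : ∃ K, IsZeroCorrelation n k m N K := ⟨_, isZeroCorrelation_corrFun hN⟩
  rw [zeroCorrelation, dif_pos hex]
  exact hex.choose_spec

/-- The chosen correlation function is identified with the explicit one by uniqueness, which needs
the rescaled points to remain distinct. -/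
theorem scaledCorrelation_eq {N : ℕ} (hN : 0 < N) (hnN : n ≤ N + 1) {z : Fin n → Aff m}
    (hz : z ∈ punctured n m) :
    scaledCorrelation n k m N z = density k (covVal N (rescale N z))
      ((Real.sqrt N : ℂ)⁻¹ • covDerVal N (rescale N z)) ((N : ℂ)⁻¹ • covDer N (rescale N z))
        fun p => fsDual (rescale N z p) := by
  have h1 := (isZeroCorrelation_zeroCorrelation (k := k) (m := m) hnN).eqOn (isZeroCorrelation_corrFun hnN) (rescale_mem_punctured hN hz)
  have hs : Real.sqrt N ≠ 0 := (Real.sqrt_pos.2 (by exact_mod_cast hN)).ne'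
  have h2 := density_smul (k := k) hs (covVal N (rescale N z)) (covDerVal N (rescale N z))
    (covDer N (rescale N z)) fun p => fsDual (rescale N z p)
  have h3 : (Real.sqrt N : ℂ) ^ 2 = N := by
    rw [← Complex.ofReal_pow, Real.sq_sqrt (Nat.cast_nonneg _), Complex.ofReal_natCast]
  rw [h3, Real.sq_sqrt (Nat.cast_nonneg _)] at h2
  rw [h2, scaledCorrelation]
  congr 1

theorem tendsto_one_add_div_pow_sub (x : ℂ) (j : ℕ) :
    Tendsto (fun N : ℕ => (1 + x / N) ^ (N - j)) atTop (𝓝 (Complex.exp x)) := by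
  have h1 := Complex.tendsto_one_add_div_pow_exp x
  have h2 : Tendsto (fun N : ℕ => 1 + x / N) atTop (𝓝 1) := by
    simpa using (tendsto_const_div_atTop_nhds_zero_nat x).const_add 1
  have h3 : Tendsto (fun N : ℕ => (1 + x / N) ^ N / (1 + x / N) ^ j) atTop (𝓝 (Complex.exp x)) := by
    have h := h1.div (h2.pow j) (by simp)
    rw [one_pow, div_one] at h
    exact h
  refine h3.congr' ?_
  filter_upwards [eventually_ge_atTop j, h2.eventually_ne one_ne_zero] with N hN hne
  rw [pow_sub₀ _ hne hN, div_eq_mul_inv]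

theorem tendsto_rescale (z : Fin n → Aff m) (p : Fin n) :
    Tendsto (fun N : ℕ => rescale N z p) atTop (𝓝 0) := by
  have h1 : Tendsto (fun N : ℕ => (((Real.sqrt N)⁻¹ : ℝ) : ℂ)) atTop (𝓝 ((0 : ℝ) : ℂ)) :=
    (Complex.continuous_ofReal.tendsto 0).comp
      ((Real.tendsto_sqrt_atTop.comp tendsto_natCast_atTop_atTop).inv_tendsto_atTop)
  have h2 := h1.smul_const (z p)
  rw [Complex.ofReal_zero, zero_smul] at h2
  exact h2

theorem rescale_apply (N : ℕ) (z : Fin n → Aff m) (p : Fin n) (q : Fin m) :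
    rescale N z p q = z p q / Real.sqrt N := by
  rw [rescale, PiLp.smul_apply, smul_eq_mul, Complex.ofReal_inv, div_eq_inv_mul]

theorem star_rescale_apply (N : ℕ) (z : Fin n → Aff m) (p : Fin n) (q : Fin m) :
    star (rescale N z p q) = star (z p q) / Real.sqrt N := by
  rw [rescale_apply, star_div₀, Complex.star_def, Complex.conj_ofReal]

/-- All entries of the normalised covariances converge and the metric tends to the Euclidean one.
The density is continuous at the limit because the limiting value covariance is nonsingular. -/
theorem tendsto_scaledCorrelation {z : Fin n → Aff m} (hz : z ∈ punctured n m) :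
    Tendsto (fun N : ℕ => scaledCorrelation n k m N z) atTop (𝓝 (limFun k z)) := by
  have hev : ∀ᶠ N : ℕ in atTop, density k (covVal N (rescale N z))
      ((Real.sqrt N : ℂ)⁻¹ • covDerVal N (rescale N z)) ((N : ℂ)⁻¹ • covDer N (rescale N z))
        (fun p => fsDual (rescale N z p)) = scaledCorrelation n k m N z := by
    filter_upwards [eventually_gt_atTop 0, eventually_ge_atTop n] with N h1 h2
    exact (scaledCorrelation_eq h1 (by omega) hz).symm
  refine Tendsto.congr' hev (tendsto_density ?_ ?_ ?_ ?_ (det_limVal_re_ne_zero hz))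
  · refine tendsto_pi_nhds.2 fun p => tendsto_pi_nhds.2 fun q => ?_
    simp only [covVal, of_apply, hdot_rescale]
    exact tendsto_one_add_div_pow_sub _ 0
  · refine tendsto_pi_nhds.2 fun t => tendsto_pi_nhds.2 fun q => ?_
    have h := (tendsto_one_add_div_pow_sub (hdot (z t.1) (z q)) 1).mul_const (star (z q t.2))
    refine h.congr' ?_
    filter_upwards [eventually_gt_atTop 0] with N hN
    have hs : (Real.sqrt N : ℂ) ≠ 0 := by
      exact_mod_cast (Real.sqrt_pos.2 (by exact_mod_cast hN : (0 : ℝ) < N)).ne'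
    have h3 : (N : ℂ) = (Real.sqrt N : ℂ) ^ 2 := by
      rw [← Complex.ofReal_pow, Real.sq_sqrt (Nat.cast_nonneg _), Complex.ofReal_natCast]
    simp only [covDerVal, Matrix.smul_apply, of_apply, hdot_rescale, smul_eq_mul,
      star_rescale_apply]
    set y := (1 + hdot (z t.1) (z q) / (N : ℂ)) ^ (N - 1)
    rw [h3]
    field_simp
  · refine tendsto_pi_nhds.2 fun t => tendsto_pi_nhds.2 fun t' => ?_
    have h0 : Tendsto (fun N : ℕ => ((N - 1 : ℕ) : ℂ) / N) atTop (𝓝 1) := by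
      have : Tendsto (fun N : ℕ => 1 - 1 / (N : ℂ)) atTop (𝓝 (1 - 0)) :=
        tendsto_const_nhds.sub (tendsto_const_div_atTop_nhds_zero_nat (1 : ℂ))
      rw [sub_zero] at this
      refine this.congr' ?_
      filter_upwards [eventually_gt_atTop 0] with N hN
      have : (N : ℂ) ≠ 0 := by exact_mod_cast hN.ne'
      rw [Nat.cast_sub hN]
      push_cast
      field_simp
    have h1 := (h0.mul (tendsto_one_add_div_pow_sub (hdot (z t.1) (z t'.1)) 2)).mul_const
      (star (z t'.1 t.2) * z t.1 t'.2)
    have h2 := (tendsto_one_add_div_pow_sub (hdot (z t.1) (z t'.1)) 1).mul_const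
      (if t.2 = t'.2 then (1 : ℂ) else 0)
    have h := h1.add h2
    rw [one_mul, ← mul_add] at h
    refine h.congr' ?_
    filter_upwards [eventually_gt_atTop 0] with N hN
    have hs : (Real.sqrt N : ℂ) ≠ 0 := by
      exact_mod_cast (Real.sqrt_pos.2 (by exact_mod_cast hN : (0 : ℝ) < N)).ne'
    have h3 : (N : ℂ) = (Real.sqrt N : ℂ) ^ 2 := by
      rw [← Complex.ofReal_pow, Real.sq_sqrt (Nat.cast_nonneg _), Complex.ofReal_natCast]
    simp only [covDer, Matrix.smul_apply, of_apply, hdot_rescale, smul_eq_mul, star_rescale_apply,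
      Nat.sub_sub, Nat.reduceAdd]
    rw [rescale_apply]
    set y := (1 + hdot (z t.1) (z t'.1) / (N : ℂ)) ^ (N - 1)
    set y' := (1 + hdot (z t.1) (z t'.1) / (N : ℂ)) ^ (N - 2)
    rw [h3]
    field_simp
  · refine tendsto_pi_nhds.2 fun p => ?_
    have h0 : fsDual (0 : Aff m) = 1 := by simp [fsDual]
    rw [← h0]
    exact (continuous_fsDual.tendsto 0).comp (tendsto_rescale z p)

theorem limitCorrelation_eq {z : Fin n → Aff m} (hz : z ∈ punctured n m) :
    limitCorrelation n k m z = limFun k z :=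
  (tendsto_scaledCorrelation hz).limUnder_eq

end

/-! ### One-point constant and normalised limit covariances. -/

section
variable {k m n : ℕ}

theorem det_of_ite_eq {k m : ℕ} (g : Fin k → Fin m) :
    det (of fun i j => if g j = g i then (1 : ℂ) else 0) =
      if Function.Injective g then 1 else 0 := by
  split_ifs with hg
  · refine Eq.trans (congrArg det ?_) (det_one (n := Fin k))
    ext i j
    rw [of_apply, one_apply]
    exact if_congr (hg.eq_iff.trans eq_comm) rfl rfl
  · obtain ⟨i, j, hij, hne⟩ := Function.not_injective_iff.1 hg
    refine det_zero_of_row_eq hne ?_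
    funext l
    simp only [of_apply, hij]

/-- The determinant detects injectivity of `g`, so the sum counts injections of `Fin k` into `Fin
m`. -/
theorem sum_det_of_ite_eq (k m : ℕ) :
    ∑ g : Fin k → Fin m, det (of fun i j => if g j = g i then (1 : ℂ) else 0) =
      (m.descFactorial k : ℂ) := by
  classical
  simp_rw [det_of_ite_eq]
  rw [Finset.sum_boole, ← Fintype.card_subtype,
    Fintype.card_congr (Equiv.subtypeInjectiveEquivEmbedding (Fin k) (Fin m)),
    Fintype.card_embedding_eq, Fintype.card_fin, Fintype.card_fin]

/-- The sum over permutations defining `wickPoly` for an identity covariance has only one term. -/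
theorem sum_perm_prod_one (σ : Fin n → Equiv.Perm (Fin k)) (f : Fin n × Fin k → Fin m) :
    ∑ π : Equiv.Perm (Fin n × Fin k), (∏ t, if σ t.1 t.2 = (π t).2 then
        (1 : Matrix (Fin n × Fin m) (Fin n × Fin m) ℂ) (t.1, f t) ((π t).1, f (π t)) else 0) =
      ∏ p, ∏ i, if f (p, σ p i) = f (p, i) then (1 : ℂ) else 0 := by
  rw [Finset.sum_eq_single (Equiv.prodCongrRight σ)]
  · rw [Fintype.prod_prod_type]
    refine Finset.prod_congr rfl fun p _ => Finset.prod_congr rfl fun i _ => ?_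
    simp only [Equiv.prodCongrRight_apply, if_true, one_apply, Prod.mk.injEq, true_and]
    exact if_congr eq_comm rfl rfl
  · intro π _ hπ
    obtain ⟨t, ht⟩ : ∃ t, π t ≠ Equiv.prodCongrRight σ t := by
      by_contra! h
      exact hπ (Equiv.ext h)
    refine Finset.prod_eq_zero (Finset.mem_univ t) ?_
    split_ifs with h
    · rw [one_apply_ne]
      intro h'
      rw [Prod.mk.injEq] at h'
      exact ht (Prod.ext h'.1.symm h.symm)
    · rfl
  · intro h
    exact absurd (Finset.mem_univ _) h

/-- With identity covariance the points are independent. Only the pairing matching the row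
permutations survives, and the sum factors into `n` copies of $\sum_g\det$ over maps $g$. -/
theorem wickPoly_one_one : wickPoly k (1 : Matrix (Fin n × Fin m) (Fin n × Fin m) ℂ)
    (fun _ => 1) = (m.descFactorial k : ℂ) ^ n := by
  have h1 : ∀ (σ : Fin n → Equiv.Perm (Fin k)) (f : Fin n × Fin k → Fin m),
      (∑ f' : Fin n × Fin k → Fin m, ((∏ p, ((Equiv.Perm.sign (σ p) : ℤ) : ℂ)) *
        ∏ t, (1 : Matrix (Fin m) (Fin m) ℂ) (f t) (f' t)) *
        ∑ π : Equiv.Perm (Fin n × Fin k), ∏ t, if σ t.1 t.2 = (π t).2 then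
          (1 : Matrix (Fin n × Fin m) (Fin n × Fin m) ℂ) (t.1, f t) ((π t).1, f' (π t)) else 0) =
      ∏ p, (((Equiv.Perm.sign (σ p) : ℤ) : ℂ) *
        ∏ i, if f (p, σ p i) = f (p, i) then (1 : ℂ) else 0) := by
    intro σ f
    rw [Finset.sum_eq_single f, sum_perm_prod_one, Finset.prod_mul_distrib]
    · simp
    · intro f' _ hf'
      obtain ⟨t, ht⟩ := Function.ne_iff.1 hf'
      have h0 : ∏ t, (1 : Matrix (Fin m) (Fin m) ℂ) (f t) (f' t) = 0 :=
        Finset.prod_eq_zero (Finset.mem_univ t) (one_apply_ne (Ne.symm ht))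
      rw [h0, mul_zero, zero_mul]
    · intro h
      exact absurd (Finset.mem_univ _) h
  rw [wickPoly]
  simp_rw [h1]
  rw [Finset.sum_comm]
  have h2 : ∀ f : Fin n × Fin k → Fin m,
      (∑ σ : Fin n → Equiv.Perm (Fin k), ∏ p, (((Equiv.Perm.sign (σ p) : ℤ) : ℂ) *
        ∏ i, if f (p, σ p i) = f (p, i) then (1 : ℂ) else 0)) =
      ∏ p, det (of fun i j => if f (p, i) = f (p, j) then (1 : ℂ) else 0) := by
    intro f
    simp_rw [det_apply']
    rw [Finset.prod_univ_sum, Fintype.piFinset_univ]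
    rfl
  simp_rw [h2]
  rw [← (Equiv.curry (Fin n) (Fin k) (Fin m)).symm.sum_comp]
  simp only [Equiv.curry_symm_apply, Function.uncurry_apply_pair]
  have h3 := Finset.prod_univ_sum (fun _ : Fin n => (Finset.univ : Finset (Fin k → Fin m)))
    (fun _ g => det (of fun i j => if g i = g j then (1 : ℂ) else 0))
  rw [Fintype.piFinset_univ] at h3
  rw [← h3, Finset.prod_const, Finset.card_univ, Fintype.card_fin, ← sum_det_of_ite_eq]
  congr 1
  refine Finset.sum_congr rfl fun g _ => ?_
  simp only [eq_comm]

/-- Diagonal scaling of the covariance. -/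
theorem wickPoly_diagonal_mul (d : Fin n → ℂ) (Λ : Matrix (Fin n × Fin m) (Fin n × Fin m) ℂ)
    (H : Fin n → Matrix (Fin m) (Fin m) ℂ) :
    wickPoly k (diagonal (fun t : Fin n × Fin m => d t.1) * Λ *
      diagonal fun t : Fin n × Fin m => d t.1) H =
      ((∏ p, d p) ^ 2) ^ k * wickPoly k Λ H := by
  unfold wickPoly
  simp only [Finset.mul_sum]
  refine Finset.sum_congr rfl fun σ _ => Finset.sum_congr rfl fun f _ =>
    Finset.sum_congr rfl fun f' _ => Finset.sum_congr rfl fun π _ => ?_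
  have h : ∀ t : Fin n × Fin k, (if σ t.1 t.2 = (π t).2 then
      (diagonal (fun t : Fin n × Fin m => d t.1) * Λ *
        diagonal fun t : Fin n × Fin m => d t.1)
        (t.1, f t) ((π t).1, f' (π t)) else 0) =
      (d t.1 * d (π t).1) *
        if σ t.1 t.2 = (π t).2 then Λ (t.1, f t) ((π t).1, f' (π t)) else 0 := fun t => by
    split_ifs
    · rw [mul_diagonal, diagonal_mul]
      ring
    · simp
  have h' : ∏ t : Fin n × Fin k, d t.1 = (∏ p, d p) ^ k := by
    rw [Fintype.prod_prod_type]
    simp [Finset.prod_pow]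
  simp_rw [h]
  rw [Finset.prod_mul_distrib, Finset.prod_mul_distrib,
    Equiv.prod_comp π (fun t : Fin n × Fin k => d t.1), h']
  ring

/-- Subtracting linear combinations of the values from the derivatives does not change the Schur
complement. -/
theorem schur_sub_mul {α β : Type*} [Fintype α] [DecidableEq α] [Fintype β]
    {A : Matrix α α ℂ} (hA : Aᴴ = A) (hdet : IsUnit A.det) (B S : Matrix β α ℂ)
    (C : Matrix β β ℂ) :
    (C - S * Bᴴ - B * Sᴴ + S * A * Sᴴ) - (B - S * A) * A⁻¹ * (B - S * A)ᴴ =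
      C - B * A⁻¹ * Bᴴ := by
  have h1 : (B - S * A) * A⁻¹ = B * A⁻¹ - S := by
    rw [Matrix.sub_mul, Matrix.mul_assoc S, mul_nonsing_inv _ hdet, Matrix.mul_one]
  have h2 : B * A⁻¹ * (A * Sᴴ) = B * Sᴴ := by
    rw [← Matrix.mul_assoc, Matrix.mul_assoc B, nonsing_inv_mul _ hdet, Matrix.mul_one]
  rw [h1, conjTranspose_sub, conjTranspose_mul, hA, Matrix.mul_sub, Matrix.sub_mul, Matrix.sub_mul,
    h2, Matrix.mul_assoc S]
  abel

theorem schur_diagonal_mul {α β : Type*} [Fintype α] [DecidableEq α] [Fintype β] [DecidableEq β]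
    {d : α → ℝ} (hd : ∀ p, d p ≠ 0) (e : β → ℝ) (A : Matrix α α ℂ)
    (B : Matrix β α ℂ) (C : Matrix β β ℂ) :
    diagonal (fun t => (e t : ℂ)) * C * diagonal (fun t => (e t : ℂ)) -
      (diagonal (fun t => (e t : ℂ)) * B * diagonal fun p => (d p : ℂ)) *
        (diagonal (fun p => (d p : ℂ)) * A * diagonal fun p => (d p : ℂ))⁻¹ *
        (diagonal (fun t => (e t : ℂ)) * B * diagonal fun p => (d p : ℂ))ᴴ =
    diagonal (fun t => (e t : ℂ)) * (C - B * A⁻¹ * Bᴴ) * diagonal fun t => (e t : ℂ) := by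
  set D := diagonal fun p => (d p : ℂ) with hD
  set E := diagonal fun t => (e t : ℂ) with hE
  have hDD : Dᴴ = D := by
    rw [hD, diagonal_conjTranspose]
    congr 1
    funext p
    exact Complex.conj_ofReal _
  have hEE : Eᴴ = E := by
    rw [hE, diagonal_conjTranspose]
    congr 1
    funext p
    exact Complex.conj_ofReal _
  have hdet : IsUnit D.det := by
    rw [hD, det_diagonal, isUnit_iff_ne_zero]
    exact Finset.prod_ne_zero_iff.2 fun p _ => by exact_mod_cast hd p
  have h1 : D * (D * A * D)⁻¹ * D = A⁻¹ := by
    rw [Matrix.mul_inv_rev, Matrix.mul_inv_rev, ← Matrix.mul_assoc, mul_nonsing_inv _ hdet,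
      Matrix.one_mul, Matrix.mul_assoc, nonsing_inv_mul _ hdet, Matrix.mul_one]
  have h2 : (E * B * D) * (D * A * D)⁻¹ * (E * B * D)ᴴ =
      E * B * (D * (D * A * D)⁻¹ * D) * Bᴴ * E := by
    rw [conjTranspose_mul, conjTranspose_mul, hDD, hEE]
    simp only [Matrix.mul_assoc]
  rw [h2, h1, Matrix.mul_sub, Matrix.sub_mul]
  simp only [Matrix.mul_assoc]

/-- Rescaling the field at each point multiplies both $(\det A)^k$ and the expectation by $(\prod_p
d_p)^{2k}$, so the density does not change. -/
theorem density_diagonal_mul {d : Fin n → ℝ} (hd : ∀ p, d p ≠ 0) (A : Matrix (Fin n) (Fin n) ℂ)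
    (B : Matrix (Fin n × Fin m) (Fin n) ℂ) (C : Matrix (Fin n × Fin m) (Fin n × Fin m) ℂ)
    (H : Fin n → Matrix (Fin m) (Fin m) ℂ) :
    density k (diagonal (fun p => (d p : ℂ)) * A * diagonal fun p => (d p : ℂ))
      (diagonal (fun t : Fin n × Fin m => (d t.1 : ℂ)) * B * diagonal fun p => (d p : ℂ))
      (diagonal (fun t : Fin n × Fin m => (d t.1 : ℂ)) * C *
        diagonal fun t : Fin n × Fin m => (d t.1 : ℂ)) H = density k A B C H := by
  have hp : (∏ p, d p) ≠ 0 := Finset.prod_ne_zero_iff.2 fun p _ => hd p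
  have h1 : (diagonal (fun p => (d p : ℂ)) * A * diagonal fun p => (d p : ℂ)).det =
      (((∏ p, d p) ^ 2 : ℝ) : ℂ) * A.det := by
    rw [det_mul, det_mul, det_diagonal]
    push_cast
    ring
  have h2 : (((∏ p, (d p : ℂ)) ^ 2) ^ k) = (((((∏ p, d p) ^ 2) ^ k : ℝ)) : ℂ) := by push_cast; rfl
  rw [density, schur_diagonal_mul hd (fun t : Fin n × Fin m => d t.1), h1,
    wickPoly_diagonal_mul (fun p => (d p : ℂ)), h2, Complex.re_ofReal_mul, Complex.re_ofReal_mul,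
    density, ← mul_assoc, ← mul_pow]
  congr 2
  field_simp

/-- The limit covariance of the values, normalised to have unit diagonal. -/
def normVal (z : Fin n → Aff m) : Matrix (Fin n) (Fin n) ℂ :=
  of fun p q => Complex.exp (hdot (z p) (z q) - hdot (z p) (z p) / 2 - hdot (z q) (z q) / 2)

/-- The normalised limit covariance of the covariant derivatives and the values. -/
def normDerVal (z : Fin n → Aff m) : Matrix (Fin n × Fin m) (Fin n) ℂ :=
  of fun t q => normVal z t.1 q * (star (z q t.2) - star (z t.1 t.2))

/-- The normalised limit covariance of the covariant derivatives. -/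
def normDer (z : Fin n → Aff m) : Matrix (Fin n × Fin m) (Fin n × Fin m) ℂ :=
  of fun t t' => normVal z t.1 t'.1 * ((if t.2 = t'.2 then 1 else 0) +
    (star (z t'.1 t.2) - star (z t.1 t.2)) * (z t.1 t'.2 - z t'.1 t'.2))

/-- The connection form at the points `z`. -/
def connForm (z : Fin n → Aff m) : Matrix (Fin n × Fin m) (Fin n) ℂ :=
  of fun t q => if t.1 = q then star (z q t.2) else 0

theorem connForm_mul {β : Type*} (z : Fin n → Aff m) (X : Matrix (Fin n) β ℂ) (t : Fin n × Fin m)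
    (y : β) : (connForm z * X) t y = star (z t.1 t.2) * X t.1 y := by
  simp [mul_apply, connForm]

theorem mul_connForm {β : Type*} (z : Fin n → Aff m) (X : Matrix β (Fin n) ℂ) (t : Fin n × Fin m)
    (y : β) : (X * (connForm z)ᴴ) y t = X y t.1 * z t.1 t.2 := by
  simp [mul_apply, connForm, apply_ite star]

theorem hdot_self_re (z : Aff m) : ((‖z‖ ^ 2 : ℝ) : ℂ) = hdot z z := by
  rw [EuclideanSpace.norm_sq_eq, hdot]
  push_cast
  exact Finset.sum_congr rfl fun q _ => (Complex.mul_conj' _).symm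

/-- Multiplication by $e^{-|z|^2/2}$ gives unit variance. Subtracting $\bar z$ times the value makes
the derivative at a point uncorrelated with the value there and does not affect the Schur
complement. Now covariances depend on positions only through differences, up to unimodular factors.
-/
theorem limFun_eq {z : Fin n → Aff m} (hz : z ∈ punctured n m) :
    limFun k z = density k (normVal z) (normDerVal z) (normDer z) fun _ => 1 := by
  set d : Fin n → ℝ := fun p => Real.exp (-(‖z p‖ ^ 2 / 2)) with hd
  have hdc : ∀ p, (d p : ℂ) = Complex.exp (-(hdot (z p) (z p) / 2)) := fun p => by
    rw [hd, ← hdot_self_re]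
    push_cast
    rfl
  have hA : normVal z = diagonal (fun p => (d p : ℂ)) * limVal z * diagonal fun p => (d p : ℂ) := by
    ext p q
    rw [mul_diagonal, diagonal_mul, hdc, hdc, normVal, limVal, of_apply, of_apply, ← Complex.exp_add,
      ← Complex.exp_add]
    congr 1
    ring
  have hA' : ∀ p q, normVal z p q = d p * limVal z p q * d q := fun p q => by
    rw [hA, mul_diagonal, diagonal_mul]
  have hlH := conjTranspose_limVal z
  have hBH : ∀ q t, (limDerVal z)ᴴ q t = limVal z q t.1 * z q t.2 := fun q t => by
    rw [conjTranspose_apply, limDerVal, of_apply, star_mul', star_star]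
    congr 1
    exact congrFun (congrFun hlH q) t.1
  have hB : normDerVal z = diagonal (fun t : Fin n × Fin m => (d t.1 : ℂ)) *
      (limDerVal z - connForm z * limVal z) * diagonal fun p => (d p : ℂ) := by
    ext t q
    rw [mul_diagonal, diagonal_mul, Matrix.sub_apply, connForm_mul, normDerVal, of_apply, hA', limDerVal,
      of_apply, limVal, of_apply]
    ring
  have hC : normDer z = diagonal (fun t : Fin n × Fin m => (d t.1 : ℂ)) *
      (limDer z - connForm z * (limDerVal z)ᴴ - limDerVal z * (connForm z)ᴴ +
        connForm z * limVal z * (connForm z)ᴴ) *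
        diagonal fun t : Fin n × Fin m => (d t.1 : ℂ) := by
    ext t t'
    rw [mul_diagonal, diagonal_mul, Matrix.add_apply, Matrix.sub_apply, Matrix.sub_apply, connForm_mul, mul_connForm,
      mul_connForm, connForm_mul, hBH, normDer, of_apply, hA', limDer, of_apply, limDerVal,
      of_apply, limVal, of_apply]
    ring
  rw [hA, hB, hC, density_diagonal_mul fun p => (Real.exp_pos _).ne', limFun, density, density,
    schur_sub_mul hlH (isUnit_iff_ne_zero.2 (det_limVal_ne_zero hz))]

theorem normVal_self (z : Fin n → Aff m) (p : Fin n) : normVal z p p = 1 := by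
  rw [normVal, of_apply, sub_sub, add_halves, sub_self, Complex.exp_zero]

theorem normDerVal_self (z : Fin n → Aff m) (t : Fin n × Fin m) : normDerVal z t t.1 = 0 := by
  rw [normDerVal, of_apply, sub_self, mul_zero]

theorem normDer_of_eq (z : Fin n → Aff m) {t t' : Fin n × Fin m} (h : t.1 = t'.1) :
    normDer z t t' = (1 : Matrix (Fin n × Fin m) (Fin n × Fin m) ℂ) t t' := by
  rw [normDer, of_apply, h, normVal_self, sub_self, zero_mul, add_zero, one_mul, one_apply]
  exact if_congr ⟨fun h' => Prod.ext h h', fun h' => by rw [h']⟩ rfl rfl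

theorem limFun_one_point (z : Fin 1 → Aff m) :
    limFun k z = ((Real.pi)⁻¹) ^ k * m.descFactorial k := by
  have hz : z ∈ punctured 1 m := Function.injective_of_subsingleton z
  have hA : normVal z = 1 := by
    ext p q
    rw [Subsingleton.elim q p, normVal_self, one_apply_eq]
  have hB : normDerVal z = 0 := by
    ext t q
    rw [Subsingleton.elim q t.1, normDerVal_self, Matrix.zero_apply]
  have hC : normDer z = 1 := by
    ext t t'
    exact normDer_of_eq z (Subsingleton.elim _ _)
  rw [limFun_eq hz, hA, hB, hC, density, Matrix.zero_mul, Matrix.zero_mul, sub_zero,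
    wickPoly_one_one, det_one, pow_one, pow_one, Complex.one_re, mul_one, Complex.natCast_re]

theorem pi_inv_pow_mul_descFactorial (hkm : k ≤ m) :
    ((Real.pi)⁻¹) ^ k * m.descFactorial k =
      (m.factorial : ℝ) / (Real.pi ^ k * ((m - k).factorial : ℝ)) := by
  have h : ((m - k).factorial : ℝ) * m.descFactorial k = m.factorial := by
    exact_mod_cast Nat.factorial_mul_descFactorial hkm
  have h0 : ((m - k).factorial : ℝ) ≠ 0 := by exact_mod_cast Nat.factorial_ne_zero _
  rw [← h, inv_pow]
  field_simp

end

/-! ### Second-order perturbation of the independent case. -/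

section
variable {α ι : Type*} {l : Filter α} {ε : α → ℝ}

theorem isBigO_prod_one {F : ι → α → ℂ} (s : Finset ι)
    (hF : ∀ i ∈ s, F i =O[l] fun _ => (1 : ℝ)) :
    (fun x => ∏ i ∈ s, F i x) =O[l] fun _ => (1 : ℝ) := by
  simpa using Asymptotics.IsBigO.finsetProd hF

theorem isBigO_prod_sub_prod [DecidableEq ι] {F G : ι → α → ℂ} (s : Finset ι)
    (hF : ∀ i ∈ s, F i =O[l] fun _ => (1 : ℝ)) (hG : ∀ i ∈ s, G i =O[l] fun _ => (1 : ℝ))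
    (h : ∀ i ∈ s, (fun x => F i x - G i x) =O[l] ε) :
    (fun x => ∏ i ∈ s, F i x - ∏ i ∈ s, G i x) =O[l] ε := by
  induction s using Finset.induction_on with
  | empty => simpa using Asymptotics.isBigO_zero _ _
  | insert a s ha ih =>
    have h1 := (h a (s.mem_insert_self a)).mul
      (isBigO_prod_one s fun i hi => hF i (Finset.mem_insert_of_mem hi))
    have h2 := (hG a (s.mem_insert_self a)).mul (ih (fun i hi => hF i (Finset.mem_insert_of_mem hi))
      (fun i hi => hG i (Finset.mem_insert_of_mem hi))
      fun i hi => h i (Finset.mem_insert_of_mem hi))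
    simp only [mul_one, one_mul] at h1 h2
    refine (h1.add h2).congr_left fun x => ?_
    rw [Finset.prod_insert ha, Finset.prod_insert ha]
    ring

theorem isBigO_prod_of_two [DecidableEq ι] {F : ι → α → ℂ} {s : Finset ι} {a b : ι} (ha : a ∈ s)
    (hb : b ∈ s) (hab : b ≠ a) (hF : ∀ i ∈ s, F i =O[l] fun _ => (1 : ℝ)) (hFa : F a =O[l] ε)
    (hFb : F b =O[l] ε) : (fun x => ∏ i ∈ s, F i x) =O[l] fun x => ε x ^ 2 := by
  have hb' : b ∈ s.erase a := Finset.mem_erase.2 ⟨hab, hb⟩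
  have h := hFa.mul (hFb.mul (isBigO_prod_one ((s.erase a).erase b) fun i hi =>
    hF i (Finset.mem_of_mem_erase (Finset.mem_of_mem_erase hi))))
  refine (h.congr_left fun x => ?_).congr_right fun x => ?_
  · rw [Finset.mul_prod_erase _ (fun i => F i x) hb', Finset.mul_prod_erase _ (fun i => F i x) ha]
  · ring

/-- A permutation does not change the label of exactly one point. -/
theorem exists_ne_of_perm {n : ℕ} {T : Type*} [Fintype T] (e : T → Fin n) (π : Equiv.Perm T) {a : T}
    (ha : e (π a) ≠ e a) : ∃ b, b ≠ a ∧ e (π b) ≠ e b := by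
  classical
  by_contra! h
  -- The labels, read as integers, have total change zero under a permutation, so a single nonzero
  -- change is impossible.
  have h1 : ∑ t, (((e (π t) : ℕ) : ℤ) - ((e t : ℕ) : ℤ)) = 0 := by
    rw [Finset.sum_sub_distrib, Equiv.sum_comp π fun t => ((e t : ℕ) : ℤ), sub_self]
  rw [Finset.sum_eq_single a (fun b _ hb => by rw [h b hb, sub_self])
    fun h => absurd (Finset.mem_univ _) h] at h1
  exact ha (Fin.ext (by omega))

/-- A permutation other than the identity moves at least two indices, so its term contains two
off-diagonal factors. -/
theorem isBigO_det_sub_one {n : ℕ} {A : α → Matrix (Fin n) (Fin n) ℂ}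
    (hε : ε =O[l] fun _ => (1 : ℝ)) (hd : ∀ x p, A x p p = 1)
    (h : ∀ p q, p ≠ q → (fun x => A x p q) =O[l] ε) :
    (fun x => (A x).det - 1) =O[l] fun x => ε x ^ 2 := by
  have h1 : ∀ p q, (fun x => A x p q) =O[l] fun _ => (1 : ℝ) := fun p q => by
    by_cases hpq : p = q
    · subst hpq
      simp only [hd]
      exact Asymptotics.isBigO_const_const _ one_ne_zero _
    · exact (h p q hpq).trans hε
  have h2 : ∀ x, (A x).det - 1 = ∑ σ ∈ Finset.univ.erase (1 : Equiv.Perm (Fin n)),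
      ((Equiv.Perm.sign σ : ℤ) : ℂ) * ∏ i, A x (σ i) i := fun x => by
    rw [det_apply', ← Finset.add_sum_erase _ _ (Finset.mem_univ (1 : Equiv.Perm (Fin n)))]
    simp [hd]
  simp_rw [h2]
  refine Asymptotics.IsBigO.fun_sum fun σ hσ => Asymptotics.IsBigO.const_mul_left ?_ _
  obtain ⟨a, ha⟩ : ∃ a, σ a ≠ a := by
    by_contra! h'
    exact (Finset.mem_erase.1 hσ).1 (Equiv.ext h')
  obtain ⟨b, hba, hb⟩ := exists_ne_of_perm id σ ha
  exact isBigO_prod_of_two (Finset.mem_univ a) (Finset.mem_univ b) hba (fun i _ => h1 _ _)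
    (h _ _ ha) (h _ _ hb)

/-- A pairing preserving the points uses only diagonal blocks, each within $\varepsilon^2$ of the
identity. Any other pairing joins different points at least twice, and its term is zero for the
identity covariance. -/
theorem isBigO_wickPoly_sub {k m n : ℕ} {Λ : α → Matrix (Fin n × Fin m) (Fin n × Fin m) ℂ}
    (H : Fin n → Matrix (Fin m) (Fin m) ℂ) (hε : ε =O[l] fun _ => (1 : ℝ))
    (hd : ∀ t t' : Fin n × Fin m, t.1 = t'.1 → (fun x => Λ x t t' -
      (1 : Matrix (Fin n × Fin m) (Fin n × Fin m) ℂ) t t') =O[l] fun x => ε x ^ 2)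
    (h : ∀ t t' : Fin n × Fin m, t.1 ≠ t'.1 → (fun x => Λ x t t') =O[l] ε) :
    (fun x => wickPoly k (Λ x) H - wickPoly k 1 H) =O[l] fun x => ε x ^ 2 := by
  have hε2 : (fun x => ε x ^ 2) =O[l] fun _ => (1 : ℝ) := by
    simpa using hε.pow 2
  have hone : ∀ t t', (fun _ => (1 : Matrix (Fin n × Fin m) (Fin n × Fin m) ℂ) t t') =O[l]
      fun _ => (1 : ℝ) := fun t t' => Asymptotics.isBigO_const_const _ one_ne_zero _
  have h1 : ∀ t t', (fun x => Λ x t t') =O[l] fun _ => (1 : ℝ) := fun t t' => by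
    by_cases htt : t.1 = t'.1
    · exact (((hd t t' htt).trans hε2).add (hone t t')).congr_left fun x => by ring
    · exact (h t t' htt).trans hε
  have h2 : ∀ x, wickPoly k (Λ x) H - wickPoly k 1 H =
      ∑ σ : Fin n → Equiv.Perm (Fin k), ∑ f : Fin n × Fin k → Fin m, ∑ f' : Fin n × Fin k → Fin m,
        ((∏ p, ((Equiv.Perm.sign (σ p) : ℤ) : ℂ)) * ∏ t, H t.1 (f t) (f' t)) *
          ∑ π : Equiv.Perm (Fin n × Fin k),
            ((∏ t, if σ t.1 t.2 = (π t).2 then Λ x (t.1, f t) ((π t).1, f' (π t)) else 0) -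
              ∏ t, if σ t.1 t.2 = (π t).2 then (1 : Matrix (Fin n × Fin m) (Fin n × Fin m) ℂ)
                (t.1, f t) ((π t).1, f' (π t)) else 0) := fun x => by
    simp only [Finset.sum_sub_distrib, mul_sub]
    rfl
  simp_rw [h2]
  refine Asymptotics.IsBigO.fun_sum fun σ _ => Asymptotics.IsBigO.fun_sum fun f _ =>
    Asymptotics.IsBigO.fun_sum fun f' _ => Asymptotics.IsBigO.const_mul_left
      (Asymptotics.IsBigO.fun_sum fun π _ => ?_) _
  have hzero : ∀ {g : α → ℝ}, (fun _ : α => (0 : ℂ)) =O[l] g := Asymptotics.isBigO_zero _ _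
  have hF : ∀ t : Fin n × Fin k, (fun x => if σ t.1 t.2 = (π t).2 then
      Λ x (t.1, f t) ((π t).1, f' (π t)) else 0) =O[l] fun _ => (1 : ℝ) := fun t => by
    split_ifs
    · exact h1 _ _
    · exact hzero
  by_cases hπ : ∀ t, (π t).1 = t.1
  · refine isBigO_prod_sub_prod Finset.univ (fun t _ => hF t) (fun t _ => ?_) fun t _ => ?_
    · split_ifs
      · exact hone _ _
      · exact hzero
    · split_ifs
      · exact hd _ _ (hπ t).symm
      · simpa using hzero
  · push Not at hπ
    obtain ⟨a, ha⟩ := hπ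
    obtain ⟨b, hba, hb⟩ := exists_ne_of_perm Prod.fst π ha
    have hFε : ∀ t : Fin n × Fin k, (π t).1 ≠ t.1 → (fun x => if σ t.1 t.2 = (π t).2 then
        Λ x (t.1, f t) ((π t).1, f' (π t)) else 0) =O[l] ε := fun t ht => by
      split_ifs
      · exact h _ _ ht.symm
      · exact hzero
    have h0 : (∏ t, if σ t.1 t.2 = (π t).2 then (1 : Matrix (Fin n × Fin m) (Fin n × Fin m) ℂ)
        (t.1, f t) ((π t).1, f' (π t)) else 0) = 0 := by
      refine Finset.prod_eq_zero (Finset.mem_univ a) ?_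
      split_ifs
      · exact one_apply_ne fun h' => ha (congrArg Prod.fst h').symm
      · rfl
    rw [h0]
    simp only [sub_zero]
    exact isBigO_prod_of_two (Finset.mem_univ a) (Finset.mem_univ b) hba (fun i _ => hF i)
      (hFε a ha) (hFε b hb)

/-- Nearly independent values and derivatives at distinct points give a nearly constant density. -/
theorem isBigO_density_sub {k m n : ℕ} (hkm : k ≤ m) {A : α → Matrix (Fin n) (Fin n) ℂ}
    {B : α → Matrix (Fin n × Fin m) (Fin n) ℂ}
    {C : α → Matrix (Fin n × Fin m) (Fin n × Fin m) ℂ}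
    (hε : Tendsto ε l (𝓝 0)) (hA1 : ∀ x p, A x p p = 1)
    (hA : ∀ p q, p ≠ q → (fun x => A x p q) =O[l] ε)
    (hB : ∀ t q, (fun x => B x t q) =O[l] ε)
    (hC1 : ∀ x (t t' : Fin n × Fin m), t.1 = t'.1 →
      C x t t' = (1 : Matrix (Fin n × Fin m) (Fin n × Fin m) ℂ) t t')
    (hC : ∀ t t' : Fin n × Fin m, t.1 ≠ t'.1 → (fun x => C x t t') =O[l] ε) :
    (fun x => (Real.pi⁻¹ ^ k * m.descFactorial k)⁻¹ ^ n * density k (A x) (B x) (C x) (fun _ => 1)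
      - 1) =O[l] fun x => ε x ^ 2 := by
  have hεO : ε =O[l] fun _ => (1 : ℝ) := hε.isBigO_one ℝ
  have hε2 : Tendsto (fun x => ε x ^ 2) l (𝓝 0) := by simpa using hε.pow 2
  have hdet := isBigO_det_sub_one hεO hA1 hA
  have hdre : (fun x => (A x).det.re - 1) =O[l] fun x => ε x ^ 2 :=
    (Asymptotics.IsBigO.of_bound 1 (Eventually.of_forall fun x => by
      rw [one_mul, ← Complex.one_re, ← Complex.sub_re]
      exact Complex.abs_re_le_norm _)).trans hdet
  have hD : Tendsto (fun x => (A x).det.re) l (𝓝 1) := by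
    simpa using (hdre.trans_tendsto hε2).add_const 1
  have hDi : (fun x => (A x).det.re⁻¹) =O[l] fun _ => (1 : ℝ) :=
    (hD.inv₀ one_ne_zero).isBigO_one ℝ
  have hAlim : Tendsto A l (𝓝 1) := by
    refine tendsto_pi_nhds.2 fun p => tendsto_pi_nhds.2 fun q => ?_
    by_cases hpq : p = q
    · subst hpq
      simp only [hA1, one_apply_eq]
      exact tendsto_const_nhds
    · rw [one_apply_ne hpq]
      exact (hA p q hpq).trans_tendsto hε
  have hAi : ∀ p q, (fun x => (A x)⁻¹ p q) =O[l] fun _ => (1 : ℝ) := fun p q => by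
    have h := tendsto_matrix_inv hAlim (by rw [det_one]; exact one_ne_zero)
    exact (tendsto_pi_nhds.1 (tendsto_pi_nhds.1 h p) q).isBigO_one ℝ
  -- The conditioning correction is quadratic in `B`, with $A^{-1}$ bounded.
  have hS : ∀ t t', (fun x => (B x * (A x)⁻¹ * (B x)ᴴ) t t') =O[l] fun x => ε x ^ 2 := by
    intro t t'
    simp only [mul_apply, conjTranspose_apply, Finset.sum_mul]
    refine Asymptotics.IsBigO.fun_sum fun q _ => Asymptotics.IsBigO.fun_sum fun q' _ => ?_
    have h3 : (fun x => star (B x t' q)) =O[l] ε :=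
      (Asymptotics.IsBigO.of_norm_left ((hB t' q).norm_left.congr_left fun x => (norm_star _).symm))
    refine (((hB t q').mul (hAi q' q)).mul h3).congr_right fun x => ?_
    ring
  have hW := isBigO_wickPoly_sub (k := k)
    (Λ := fun x => C x - B x * (A x)⁻¹ * (B x)ᴴ) (fun _ => 1) hεO
    (fun t t' htt => by
      refine (hS t t').neg_left.congr_left fun x => ?_
      rw [Matrix.sub_apply, hC1 x t t' htt]
      ring)
    (fun t t' htt => by
      have h4 : (fun x => ε x ^ 2) =O[l] ε := by
        refine ((hεO.mul (Asymptotics.isBigO_refl ε l))).congr (fun x => ?_) fun x => ?_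
        · ring
        · ring
      exact (hC t t' htt).sub ((hS t t').trans h4))
  rw [wickPoly_one_one] at hW
  set W := fun x => (wickPoly k (C x - B x * (A x)⁻¹ * (B x)ᴴ) (fun _ => 1)).re with hWd
  have hM : ((m.descFactorial k : ℝ)) ≠ 0 := by
    exact_mod_cast (Nat.descFactorial_pos.2 hkm).ne'
  have hWre : (fun x => W x - (m.descFactorial k : ℝ) ^ n) =O[l] fun x => ε x ^ 2 :=
    (Asymptotics.IsBigO.of_bound 1 (Eventually.of_forall fun x => by
      have : ((m.descFactorial k : ℝ)) ^ n = (((m.descFactorial k : ℂ)) ^ n).re := by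
        rw [← Complex.ofReal_natCast, ← Complex.ofReal_pow, Complex.ofReal_re]
      rw [one_mul, this, ← Complex.sub_re]
      exact Complex.abs_re_le_norm _)).trans hW
  have hV : (fun x => ((m.descFactorial k : ℝ) ^ n)⁻¹ * W x - 1) =O[l] fun x => ε x ^ 2 := by
    refine (hWre.const_mul_left ((m.descFactorial k : ℝ) ^ n)⁻¹).congr_left fun x => ?_
    rw [mul_sub, inv_mul_cancel₀ (pow_ne_zero _ hM)]
  have hVO : (fun x => ((m.descFactorial k : ℝ) ^ n)⁻¹ * W x) =O[l] fun _ => (1 : ℝ) := by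
    refine Tendsto.isBigO_one ℝ (c := 1) ?_
    simpa using (hV.trans_tendsto hε2).add_const 1
  -- Uses $d^{-1}-1=-d^{-1}(d-1)$ with $d^{-1}$ bounded.
  have hU1 : (fun x => (A x).det.re⁻¹ - 1) =O[l] fun x => ε x ^ 2 := by
    have h5 := hDi.mul hdre.neg_left
    simp only [one_mul] at h5
    refine h5.congr' ?_ EventuallyEq.rfl
    filter_upwards [hD.eventually_ne one_ne_zero] with x hx
    field_simp
    ring
  have hU : ∀ j : ℕ, (fun x => (A x).det.re⁻¹ ^ j - 1) =O[l] fun x => ε x ^ 2 := by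
    intro j
    induction j with
    | zero => simpa using Asymptotics.isBigO_zero _ _
    | succ j ih =>
      have h6 := hDi.mul ih
      simp only [one_mul] at h6
      refine (h6.add hU1).congr_left fun x => ?_
      ring
  have h7 := (hU k).mul hVO
  simp only [mul_one] at h7
  refine (h7.add hV).congr_left fun x => ?_
  have h8 : (Real.pi⁻¹ ^ k * (m.descFactorial k : ℝ))⁻¹ ^ n *
      density k (A x) (B x) (C x) (fun _ => 1) =
      (A x).det.re⁻¹ ^ k * (((m.descFactorial k : ℝ) ^ n)⁻¹ * W x) := by
    have hπ : Real.pi ≠ 0 := Real.pi_ne_zero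
    have h9 : (Real.pi⁻¹ ^ k * (m.descFactorial k : ℝ))⁻¹ ^ n =
        (Real.pi ^ n) ^ k * ((m.descFactorial k : ℝ) ^ n)⁻¹ := by
      rw [mul_inv, inv_pow, inv_inv, mul_pow, inv_pow, ← pow_mul, ← pow_mul, mul_comm k n]
    rw [h9, density, mul_inv, mul_pow]
    have h10 : (Real.pi ^ n)⁻¹ ^ k * (Real.pi ^ n) ^ k = 1 := by
      rw [← mul_pow, inv_mul_cancel₀ (pow_ne_zero _ hπ), one_pow]
    linear_combination ((A x).det.re⁻¹ ^ k * (((m.descFactorial k : ℝ) ^ n)⁻¹ * W x)) * h10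
  rw [h8]
  ring

end

/-! ### Gaussian decay of the normalised covariances, and the conclusion. -/

section
variable {k m n : ℕ}

/-- The function $x^2e^{-x^2/2}$ decreases beyond its maximum at $\sqrt2$. In place of a derivative,
$e^u\ge1+u$ is used with $u=(x^2-r^2)/2$ and $r^2\ge2$. -/
theorem sq_mul_exp_neg_le {r x : ℝ} (hr : √2 ≤ r) (hx : r ≤ x) :
    x ^ 2 * Real.exp (-(x ^ 2 / 2)) ≤ r ^ 2 * Real.exp (-(r ^ 2 / 2)) := by
  have hr0 : 0 ≤ r := (Real.sqrt_nonneg 2).trans hr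
  have h2 : 2 ≤ r ^ 2 := (Real.sqrt_le_left hr0).1 hr
  have h3 : r ^ 2 ≤ x ^ 2 := pow_le_pow_left₀ hr0 hx 2
  have h4 : x ^ 2 ≤ r ^ 2 * Real.exp (x ^ 2 / 2 - r ^ 2 / 2) := by
    have h5 := mul_le_mul_of_nonneg_left (Real.add_one_le_exp (x ^ 2 / 2 - r ^ 2 / 2))
      (sq_nonneg r)
    nlinarith
  calc x ^ 2 * Real.exp (-(x ^ 2 / 2))
      ≤ r ^ 2 * Real.exp (x ^ 2 / 2 - r ^ 2 / 2) * Real.exp (-(x ^ 2 / 2)) :=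
        mul_le_mul_of_nonneg_right h4 (Real.exp_pos _).le
    _ = r ^ 2 * Real.exp (-(r ^ 2 / 2)) := by
        rw [mul_assoc, ← Real.exp_add]
        congr 2
        ring

theorem minSep_le (z : Fin n → Aff m) {p q : Fin n} (hpq : p ≠ q) : minSep z ≤ ‖z p - z q‖ :=
  ciInf_le (Set.finite_range fun pq : {pq : Fin n × Fin n // pq.1 ≠ pq.2} =>
    ‖z pq.1.1 - z pq.1.2‖).bddBelow ⟨(p, q), hpq⟩

theorem mem_punctured_of_minSep_pos {z : Fin n → Aff m} (h : 0 < minSep z) :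
    z ∈ punctured n m := fun p q hpq => by
  by_contra hne
  have := minSep_le z hne
  rw [hpq, sub_self, norm_zero] at this
  exact this.not_gt h

theorem hdot_re_comm (z w : Aff m) : (hdot z w).re = (hdot w z).re := by
  rw [← star_hdot w z]
  rfl

/-- Polarisation: the real part of the exponent is $-\tfrac12|z^p-z^q|^2$. -/
theorem norm_normVal (z : Fin n → Aff m) (p q : Fin n) :
    ‖normVal z p q‖ = Real.exp (-(‖z p - z q‖ ^ 2 / 2)) := by
  rw [normVal, of_apply, Complex.norm_exp]
  congr 1
  have h1 : ‖z p - z q‖ ^ 2 = (hdot (z p - z q) (z p - z q)).re := by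
    rw [← hdot_self_re, Complex.ofReal_re]
  have h2 : hdot (z p - z q) (z p - z q) =
      hdot (z p) (z p) - hdot (z p) (z q) - hdot (z q) (z p) + hdot (z q) (z q) := by
    simp only [hdot, PiLp.sub_apply, star_sub, ← Finset.sum_sub_distrib, ← Finset.sum_add_distrib]
    exact Finset.sum_congr rfl fun i _ => by ring
  have h3 : ∀ c : ℂ, (c / 2).re = c.re / 2 := fun c => by simp
  rw [h1, h2, Complex.sub_re, Complex.sub_re, h3, h3, Complex.add_re, Complex.sub_re,
    Complex.sub_re, hdot_re_comm (z q) (z p)]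
  ring

theorem norm_star_sub_star_le (z w : Aff m) (i : Fin m) : ‖star (z i) - star (w i)‖ ≤ ‖w - z‖ := by
  rw [← star_sub, norm_star, norm_sub_rev]
  exact PiLp.norm_apply_le (w - z) i

variable {z : Fin n → Aff m} {p q : Fin n}

/-- The factor $1+|z^p-z^q|^2$ dominates the polynomial factors in all three covariance blocks, so
one bound serves for them all; it is at most $2|z^p-z^q|^2$ here. -/
theorem norm_normVal_le (hz : √2 ≤ minSep z) (hpq : p ≠ q) :
    (1 + ‖z p - z q‖ ^ 2) * ‖normVal z p q‖ ≤
      2 * (minSep z ^ 2 * Real.exp (-(minSep z ^ 2 / 2))) := by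
  have h := minSep_le z hpq
  have h2 : 2 ≤ ‖z p - z q‖ ^ 2 := (Real.sqrt_le_left (norm_nonneg _)).1 (hz.trans h)
  refine le_trans ?_ (mul_le_mul_of_nonneg_left (sq_mul_exp_neg_le hz h) zero_le_two)
  rw [norm_normVal, ← mul_assoc]
  exact mul_le_mul_of_nonneg_right (by linarith) (Real.exp_pos _).le

theorem norm_normDerVal_le (hz : √2 ≤ minSep z) {t : Fin n × Fin m} (hpq : t.1 ≠ q) :
    ‖normDerVal z t q‖ ≤ 2 * (minSep z ^ 2 * Real.exp (-(minSep z ^ 2 / 2))) := by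
  refine le_trans ?_ (norm_normVal_le hz hpq)
  rw [normDerVal, of_apply, norm_mul, mul_comm]
  refine mul_le_mul_of_nonneg_right ((norm_star_sub_star_le _ _ _).trans ?_) (norm_nonneg _)
  nlinarith [sq_nonneg (‖z t.1 - z q‖ - 1)]

theorem norm_normDer_le (hz : √2 ≤ minSep z) {t t' : Fin n × Fin m} (hpq : t.1 ≠ t'.1) :
    ‖normDer z t t'‖ ≤ 2 * (minSep z ^ 2 * Real.exp (-(minSep z ^ 2 / 2))) := by
  refine le_trans ?_ (norm_normVal_le hz hpq)
  rw [normDer, of_apply, norm_mul, mul_comm]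
  refine mul_le_mul_of_nonneg_right ((norm_add_le _ _).trans (add_le_add ?_ ?_)) (norm_nonneg _)
  · split_ifs <;> simp
  · rw [norm_mul, sq]
    exact mul_le_mul (norm_star_sub_star_le _ _ _) (PiLp.norm_apply_le (z t.1 - z t'.1) t'.2)
      (norm_nonneg _) (norm_nonneg _)

theorem tendsto_sq_mul_exp_neg :
    Tendsto (fun r : ℝ => r ^ 2 * Real.exp (-(r ^ 2 / 2))) atTop (𝓝 0) := by
  have h := (Real.tendsto_pow_mul_exp_neg_atTop_nhds_zero 1).comp
    ((tendsto_pow_atTop (α := ℝ) two_ne_zero).atTop_div_const (zero_lt_two))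
  have h2 := h.const_mul 2
  rw [mul_zero] at h2
  refine h2.congr fun r => ?_
  simp only [Function.comp_apply, pow_one]
  ring

/-- The perturbation bound is applied with $\varepsilon=r^2e^{-r^2/2}$, whose square is the stated
rate. For $n\le1$ the infimum over the empty set is the default value $0$, so the filter is trivial
and the estimate is void. -/
theorem isBigO_limFun_sub_one (hkm : k ≤ m) :
    (fun z : Fin n → Aff m => (Real.pi⁻¹ ^ k * m.descFactorial k)⁻¹ ^ n * limFun k z - 1)
      =O[comap minSep atTop] fun z => minSep z ^ 4 * Real.exp (-minSep z ^ 2) := by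
  have hsep : ∀ c : ℝ, ∀ᶠ z : Fin n → Aff m in comap minSep atTop, c ≤ minSep z := fun c =>
    tendsto_comap.eventually (eventually_ge_atTop c)
  have hbig : ∀ F : (Fin n → Aff m) → ℂ, (∀ z, √2 ≤ minSep z →
      ‖F z‖ ≤ 2 * (minSep z ^ 2 * Real.exp (-(minSep z ^ 2 / 2)))) →
      F =O[comap minSep atTop] fun z => minSep z ^ 2 * Real.exp (-(minSep z ^ 2 / 2)) := by
    intro F hF
    refine Asymptotics.IsBigO.of_bound 2 ?_
    filter_upwards [hsep √2] with z hz
    refine (hF z hz).trans (mul_le_mul_of_nonneg_left (le_abs_self _) zero_le_two)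
  have h := isBigO_density_sub (k := k) (l := comap minSep atTop) hkm
    (A := fun z : Fin n → Aff m => normVal z) (B := normDerVal) (C := normDer)
    (tendsto_sq_mul_exp_neg.comp tendsto_comap) normVal_self
    (fun p q hpq => hbig _ fun z hz => le_trans
      (le_mul_of_one_le_left (norm_nonneg _) (by nlinarith [sq_nonneg ‖z p - z q‖]))
      (norm_normVal_le hz hpq))
    (fun t q => hbig _ fun z hz => by
      by_cases htq : t.1 = q
      · rw [← htq, normDerVal_self, norm_zero]
        positivity
      · exact norm_normDerVal_le hz htq)
    (fun z t t' => normDer_of_eq z)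
    (fun t t' htt => hbig _ fun z hz => norm_normDer_le hz htt)
  refine h.congr' ?_ (Eventually.of_forall fun z => ?_)
  · filter_upwards [hsep 1] with z hz
    rw [limFun_eq (mem_punctured_of_minSep_pos (zero_lt_one.trans_le hz))]
  · simp only [Function.comp_apply]
    rw [mul_pow, ← Real.exp_nat_mul, ← pow_mul]
    congr 2
    push_cast
    ring

theorem limitCorrelation_one_point (z : Fin 1 → Aff m) :
    limitCorrelation 1 k m z = Real.pi⁻¹ ^ k * m.descFactorial k := by
  rw [limitCorrelation_eq (Function.injective_of_subsingleton z), limFun_one_point]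

theorem isBigO_normalizedLimitCorrelation_sub_one (hkm : k ≤ m) :
    (fun z : Fin n → Aff m => normalizedLimitCorrelation n k m z - 1)
      =O[comap minSep atTop] fun z => minSep z ^ 4 * Real.exp (-minSep z ^ 2) := by
  refine (isBigO_limFun_sub_one hkm).congr' ?_ EventuallyEq.rfl
  filter_upwards [tendsto_comap.eventually (eventually_ge_atTop (1 : ℝ))] with z hz
  rw [normalizedLimitCorrelation, limitCorrelation_one_point,
    limitCorrelation_eq (mem_punctured_of_minSep_pos (zero_lt_one.trans_le hz))]

end

end ShortRange

end

theorem theorem4p1 (n k m : ℕ) (hn : 1 ≤ n) (hk : 1 ≤ k) (hkm : k ≤ m) :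
    -- the correlation functions exist for all large degrees
    (∀ᶠ N : ℕ in atTop,
      ShortRange.IsZeroCorrelation n k m N (ShortRange.zeroCorrelation n k m N)) ∧
    -- their scaling limit exists
    (∀ z ∈ ShortRange.punctured n m,
      Tendsto (fun N : ℕ => ShortRange.scaledCorrelation n k m N z) atTop
        (𝓝 (ShortRange.limitCorrelation n k m z))) ∧
    -- the one-point limit is a nonzero constant
    (∀ z : Fin 1 → ShortRange.Aff m,
      ShortRange.limitCorrelation 1 k m z =
        (m.factorial : ℝ) / (Real.pi ^ k * ((m - k).factorial : ℝ))) ∧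
    -- the normalised limit correlations are short range, as `r → ∞`
    (fun z : Fin n → ShortRange.Aff m => ShortRange.normalizedLimitCorrelation n k m z - 1)
      =O[comap ShortRange.minSep atTop]
        fun z => ShortRange.minSep z ^ 4 * Real.exp (-(ShortRange.minSep z) ^ 2) := by
  refine ⟨?_, fun z hz => ?_, fun z => ?_,
    ShortRange.isBigO_normalizedLimitCorrelation_sub_one hkm⟩
  · filter_upwards [eventually_ge_atTop n] with N hN
    exact ShortRange.isZeroCorrelation_zeroCorrelation (by omega)
  · rw [ShortRange.limitCorrelation_eq hz]
    exact ShortRange.tendsto_scaledCorrelation hz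
  · rw [ShortRange.limitCorrelation_one_point, ShortRange.pi_inv_pow_mul_descFactorial hkm]
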